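/- Let $d\ge 1$ and let $Q$ be a real polynomial on $\mathbb{R}^d$ of degree $q\ge 1$ which is elliptic, i.e. its homogeneous part of degree $q$ does not vanish on $\mathbb{R}^d\setminus\{0\}$. Let $V=V_1+V_2$, where $V_1,V_2:\mathbb{R}^d\to\mathbb{R}$ are bounded, $V_1$ is $C^\infty$, $V_2$ is measurable, and $V(x)\to 0$ as $|x|\to\infty$. Let $H=Q(p)+V(x)$, $p=-\mathrm{i}\nabla$, be the operator on $L^2(\mathbb{R}^d)$ with domain $\{\phi\in L^2(\mathbb{R}^d): Q(p)\phi\in L^2(\mathbb{R}^d)\}$, where $Q(p)\phi$ is understood in the sense of distributions. Suppose that for some $\delta>0$, as $|x|\to\infty$, $$V_2(x)=O\big(|x|^{-q/2-\delta}\big),\qquad \partial^\alpha V_1(x)=O\big(|x|^{-(\delta+q+|\alpha|)/2}\big)\quad\text{for all multi-indices } \alpha \text{ with } 1\le|\alpha|\le q .$$ Let $\lambda\in\mathbb{R}$ and let $\phi\in L^2(\mathbb{R}^d)$ satisfy $(H-\lambda)\phi=0$. If $\phi\ne 0$, then the critical decay rate $$\sigma_{\mathrm c}=\sup\{\sigma\ge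 0 : e^{\sigma|x|}\phi\in L^2(\mathbb{R}^d)\}\in[0,\infty]$$ is finite. -/

import Mathlib

open MeasureTheory Filter Asymptotics
open scoped ENNReal NNReal Topology SchwartzMap LineDeriv ContDiff

noncomputable section

namespace HigherOrderSchrodinger

/-- The space `ℝ^d` with its Euclidean norm. -/
abbrev Space (d : ℕ) : Type := EuclideanSpace ℝ (Fin d)

/-- The Hilbert space `L²(ℝ^d)` of complex-valued functions (modulo null sets). -/
abbrev L2 (d : ℕ) : Type := Lp ℂ 2 (volume : Measure (Space d))

/-- The `j`-th standard basis vector of `ℝ^d`. -/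
def stdVec {d : ℕ} (j : Fin d) : Space d := EuclideanSpace.single j 1

/-- A real polynomial on `ℝ^d` is elliptic if its principal part (the homogeneous component of top
degree) has no real zero other than the origin. -/
def IsElliptic {d : ℕ} (Q : MvPolynomial (Fin d) ℝ) : Prop :=
  ∀ ξ : Fin d → ℝ, ξ ≠ 0 →
    MvPolynomial.eval ξ (MvPolynomial.homogeneousComponent Q.totalDegree Q) ≠ 0

/-- The component `p_j = -i ∂_j` of the momentum operator, on tempered distributions. -/
def momentum {d : ℕ} (j : Fin d) : 𝓢'(Space d, ℂ) →L[ℂ] 𝓢'(Space d, ℂ) :=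
  (-Complex.I) • LineDeriv.lineDerivOpCLM ℂ 𝓢'(Space d, ℂ) (stdVec j)

/-- The monomial `p^α = p_1^{α_1} ⋯ p_d^{α_d}`; products of operators are compositions. -/
def momentumPow {d : ℕ} (α : Fin d →₀ ℕ) : 𝓢'(Space d, ℂ) →L[ℂ] 𝓢'(Space d, ℂ) :=
  (List.ofFn fun j => momentum j ^ α j).prod

/-- The constant coefficient differential operator `Q(p) = ∑_α c_α p^α`, where `Q = ∑_α c_α ξ^α`,
on tempered distributions. -/
def polyMomentum {d : ℕ} (Q : MvPolynomial (Fin d) ℝ) :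
    𝓢'(Space d, ℂ) →L[ℂ] 𝓢'(Space d, ℂ) :=
  ∑ α ∈ Q.support, ((Q.coeff α : ℝ) : ℂ) • momentumPow α

/-- `φ` lies in the domain of `H = Q(p) + V` on `L²` and `(H - lam) φ = 0`. Here the domain of `H`
is that of `Q(p)`, that is the set of all `φ ∈ L²` such that the distribution `Q(p) φ` is
(represented by) an element `ψ` of `L²`. -/
def SolvesEigenEq {d : ℕ} (Q : MvPolynomial (Fin d) ℝ) (V : Space d → ℝ) (lam : ℝ)
    (φ : L2 d) : Prop :=
  ∃ ψ : L2 d,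
    Lp.toTemperedDistribution ψ = polyMomentum Q (Lp.toTemperedDistribution φ) ∧
    ∀ᵐ x ∂(volume : Measure (Space d)), ψ x + (V x : ℂ) * φ x - (lam : ℂ) * φ x = 0

/-- The critical decay rate `σ_c = sup {σ ≥ 0 | e^{σ|x|} φ ∈ L²}`, with values in `[0, ∞]`. -/
def criticalDecayRate {d : ℕ} (φ : L2 d) : ℝ≥0∞ :=
  sSup {s : ℝ≥0∞ | ∃ σ : ℝ≥0, s = (σ : ℝ≥0∞) ∧
    MemLp (fun x : Space d => (Real.exp (σ * ‖x‖) : ℂ) * φ x) 2 volume}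

/-- The partial derivative `∂_{J 0} ⋯ ∂_{J (k-1)} f` of order `k` of a smooth function; as `J` varies
over all `k`-tuples of indices these are exactly the `∂^α f` with `|α| = k`. -/
def partialDeriv {d k : ℕ} (J : Fin k → Fin d) (f : Space d → ℝ) (x : Space d) : ℝ :=
  iteratedFDeriv ℝ k f x (fun i => stdVec (J i))

end HigherOrderSchrodinger

end

/-! Suppose `φ` decays faster than every exponential; a Carleman estimate then forces `φ = 0`. Write
`Q^{(L)} = ∂_L Q` for a word `L` of coordinate indices and `t_L` for the product of the `t j` over
its letters.

The estimate starts from a quadratic weight `g` with Hessian `diag t`, `t ≥ 0`. Conjugation by `e^g`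
turns the momenta into operators `aⱼ` with adjoints `bⱼ` and `[bⱼ, aₖ] = 2 tⱼ δⱼₖ`. Normal ordering
of `b(P) a(P)` gives an exact formula for `‖a(P) u‖²` as a sum of nonnegative terms
(`norm_sq_eq_sum_iterNorm`), whence the Treves inequality (`treves`, `treves_word`): `∑_L t_L ‖e^g
Q^{(L)}(p) v‖² ≤ C₀ ‖e^g (Q(p) + c) v‖²`, with `C₀` independent of `g` and of the real number `c`.

This is transplanted to the weight `f(x) = σ ∑ⱼ h(xⱼ)`, where `h'' = a⁻²` and `a(s) = (1 + |s|)^β`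
with `β > 1/2`. As `a⁻²` is integrable, `h` grows at most linearly, so `e^f` is an admissible weight
for `φ`. On the box about `y` with half sides `κ a(yⱼ)`, `f` is replaced by its second order Taylor
polynomial, with `tⱼ = σ a(yⱼ)⁻²`. If `k = σ κ²` is kept fixed, then: the Taylor error is `O(k κ)`;
a derivative of the cutoff costs `(κ a)⁻²` in the squared norm, that is `t / k`, which is small for
large `k`; `V₁` is frozen at `y` and put into `c`, and the rest of the potential is `O(a^{-q})`. Its
square is compared with `t^q = σ^q a^{-2q}`, which occurs on the left because `∂ⱼ^q Q` is a nonzero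
constant for elliptic `Q`, and it is absorbed for large `σ`. Averaging the local estimates over all
centres (`lintegral_le_of_boxes`) bounds the total weighted energy by half of itself, so it vanishes
if it is finite (`ApproxData.eq_zero`).

Finiteness requires superexponential decay of all `Q^{(L)}(p) φ`. It is inherited from `φ` and `Q(p)
φ = (λ - V) φ` by an elliptic estimate with a large parameter on unit boxes
(`ApproxData.lintegral_exp_energy_ne_top`). Everything is proved for Schwartz functions and carried
to `φ` by approximation in the graph norm (`exists_approx_derivs`). -/

namespace HigherOrderSchrodinger

open MvPolynomial

/-! ### Degree bounds for polynomials -/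

section Degree

variable {σ : Type*}

/-- All monomials of `P` have degree less than `n`; for `n = 0` this means `P = 0`. -/
def DegLT (n : ℕ) (P : MvPolynomial σ ℝ) : Prop := ∀ α, P.coeff α ≠ 0 → α.degree < n

lemma DegLT.pderiv {n : ℕ} {P : MvPolynomial σ ℝ} (h : DegLT (n + 1) P) (j : σ) :
    DegLT n (pderiv j P) := by
  intro α hα
  rw [coeff_pderiv] at hα
  have := h _ (left_ne_zero_of_mul hα)
  rw [map_add, Finsupp.degree_single] at this
  omega

lemma DegLT.mono {n k : ℕ} {P : MvPolynomial σ ℝ} (h : DegLT n P) (hk : n ≤ k) : DegLT k P :=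
  fun α hα => (h α hα).trans_le hk

lemma degLT_zero_iff {P : MvPolynomial σ ℝ} : DegLT 0 P ↔ P = 0 := by
  constructor
  · intro h
    ext α
    by_contra hα
    exact absurd (h α hα) (by omega)
  · rintro rfl α hα
    simp at hα

end Degree

/-! ### An abstract Leibniz formula in exponential form -/

section Expansion

variable {σ : Type*} [Fintype σ] {M N : Type*} [AddCommGroup M] [Module ℝ M]
  [AddCommGroup N] [Module ℝ N]

/-- The `k`-th iterate of `∑ⱼ δⱼ ⊗ ∂ⱼ` applied to a bilinear map `Z`. -/
noncomputable def iterPairing (δ : σ → M →ₗ[ℝ] M) (Z : M →ₗ[ℝ] MvPolynomial σ ℝ →ₗ[ℝ] N) :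
    ℕ → M → MvPolynomial σ ℝ → N
  | 0, m, P => Z m P
  | k + 1, m, P => ∑ j, iterPairing δ Z k (δ j m) (pderiv j P)

variable (δ : σ → M →ₗ[ℝ] M) (Z : M →ₗ[ℝ] MvPolynomial σ ℝ →ₗ[ℝ] N)

lemma iterPairing_add (k : ℕ) (m : M) (P R : MvPolynomial σ ℝ) :
    iterPairing δ Z k m (P + R) = iterPairing δ Z k m P + iterPairing δ Z k m R := by
  induction k generalizing m P R with
  | zero => simp [iterPairing]
  | succ k ih => simp [iterPairing, ih, Finset.sum_add_distrib]

lemma iterPairing_zero (k : ℕ) (m : M) : iterPairing δ Z k m 0 = 0 := by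
  induction k generalizing m with
  | zero => simp [iterPairing]
  | succ k ih => simp [iterPairing, ih]

lemma iterPairing_smul_left (k : ℕ) (c : ℝ) (m : M) (P : MvPolynomial σ ℝ) :
    iterPairing δ Z k (c • m) P = c • iterPairing δ Z k m P := by
  induction k generalizing m P with
  | zero => simp [iterPairing]
  | succ k ih => simp [iterPairing, ih, Finset.smul_sum]

variable {δ Z} {b : MvPolynomial σ ℝ →ₐ[ℝ] Module.End ℝ N}

lemma mul_iterPairing_zero
    (hb : ∀ j m P, b (X j) (Z m P) = Z m (X j * P) + Z (δ j m) P)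
    (j : σ) (m : M) (P : MvPolynomial σ ℝ) :
    b (X j) (iterPairing δ Z 0 m P) =
      iterPairing δ Z 0 m (X j * P) + iterPairing δ Z 0 (δ j m) P := hb j m P

/-- Each of the `k + 1` derivatives may fall on the factor `X j`; this produces the coefficient `k +
1`, which turns `1 / (k + 1)!` into `1 / k!` and makes the exponential series telescope. -/
lemma mul_iterPairing_succ
    (hδ : ∀ i j m, δ i (δ j m) = δ j (δ i m))
    (hb : ∀ j m P, b (X j) (Z m P) = Z m (X j * P) + Z (δ j m) P)
    (k : ℕ) (j : σ) (m : M) (P : MvPolynomial σ ℝ) :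
    b (X j) (iterPairing δ Z (k + 1) m P) =
      iterPairing δ Z (k + 1) m (X j * P) - ((k : ℝ) + 1) • iterPairing δ Z k (δ j m) P
        + iterPairing δ Z (k + 1) (δ j m) P := by
  classical
  have key : ∀ k m P, iterPairing δ Z (k + 1) m (X j * P) =
      ∑ i, iterPairing δ Z k (δ i m) (X j * pderiv i P) + iterPairing δ Z k (δ j m) P := by
    intro k m P
    have : ∀ i, iterPairing δ Z k (δ i m) (pderiv i (X j * P)) =
        iterPairing δ Z k (δ i m) (X j * pderiv i P) +
          (if i = j then iterPairing δ Z k (δ j m) P else 0) := by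
      intro i
      rw [pderiv_mul, add_comm, iterPairing_add]
      congr 1
      split_ifs with h
      · subst h; simp
      · rw [pderiv_X_of_ne (Ne.symm h), zero_mul, iterPairing_zero]
    simp only [iterPairing, this, Finset.sum_add_distrib]
    simp
  induction k generalizing m P with
  | zero =>
    rw [key 0]
    simp only [iterPairing, map_sum, hb, Finset.sum_add_distrib]
    simp only [hδ j]
    simp
  | succ k ih =>
    rw [key (k + 1)]
    have h1 : b (X j) (iterPairing δ Z (k + 1 + 1) m P) =
        ∑ i, b (X j) (iterPairing δ Z (k + 1) (δ i m) (pderiv i P)) := by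
      rw [iterPairing, map_sum]
    rw [h1]
    simp only [ih, Finset.sum_add_distrib, Finset.sum_sub_distrib, ← Finset.smul_sum]
    simp only [hδ j]
    have h2 : ∀ k, ∑ i, iterPairing δ Z k (δ i (δ j m)) (pderiv i P)
        = iterPairing δ Z (k + 1) (δ j m) P := fun _ => rfl
    rw [h2, h2]
    push_cast
    module

/-- The length of the series is left unspecified, as long as it is large, so that the induction on
`P` need not follow degrees; the exact length is recovered in `expansion`. -/
lemma exists_expansion
    (hδ : ∀ i j m, δ i (δ j m) = δ j (δ i m))
    (hb : ∀ j m P, b (X j) (Z m P) = Z m (X j * P) + Z (δ j m) P)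
    (P : MvPolynomial σ ℝ) :
    ∃ N₀ : ℕ, ∀ n ≥ N₀, ∀ m, b P (Z m 1) =
      ∑ k ∈ Finset.range n, (1 / (k.factorial : ℝ)) • iterPairing δ Z k m P := by
  induction P using MvPolynomial.induction_on with
  | C c =>
    refine ⟨1, fun n hn m => ?_⟩
    obtain ⟨n, rfl⟩ : ∃ n', n = n' + 1 := ⟨n - 1, by omega⟩
    rw [Finset.sum_range_succ', Finset.sum_eq_zero]
    · have : (C c : MvPolynomial σ ℝ) = c • 1 := by rw [smul_eq_C_mul, mul_one]
      rw [this, map_smul, map_one]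
      simp [iterPairing]
    · intro k _
      simp [iterPairing, iterPairing_zero]
  | add P R hP hR =>
    obtain ⟨N₁, h₁⟩ := hP
    obtain ⟨N₂, h₂⟩ := hR
    refine ⟨max N₁ N₂, fun n hn m => ?_⟩
    simp only [iterPairing_add, smul_add, Finset.sum_add_distrib, map_add, LinearMap.add_apply]
    rw [h₁ n (le_trans (le_max_left _ _) hn), h₂ n (le_trans (le_max_right _ _) hn)]
  | mul_X P j hP =>
    obtain ⟨N₁, h₁⟩ := hP
    refine ⟨N₁ + 1, fun n hn m => ?_⟩
    obtain ⟨n, rfl⟩ : ∃ n', n = n' + 1 := ⟨n - 1, by omega⟩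
    -- The sums of lengths `n` and `n + 1` both represent `b P (Z (δ j m) 1)`, so the last term, the
    -- boundary term of the telescoping below, is zero.
    have hz : (1 / (n.factorial : ℝ)) • iterPairing δ Z n (δ j m) P = 0 := by
      have e1 := h₁ n (by omega) (δ j m)
      have e2 := h₁ (n + 1) (by omega) (δ j m)
      rw [Finset.sum_range_succ, ← e1] at e2
      simpa using e2
    rw [mul_comm P, map_mul, Module.End.mul_apply, h₁ (n + 1) (by omega) m]
    have tele : ∀ n, b (X j) (∑ k ∈ Finset.range (n + 1),
          (1 / (k.factorial : ℝ)) • iterPairing δ Z k m P) =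
        ∑ k ∈ Finset.range (n + 1), (1 / (k.factorial : ℝ)) • iterPairing δ Z k m (X j * P) +
          (1 / (n.factorial : ℝ)) • iterPairing δ Z n (δ j m) P := by
      intro n
      induction n with
      | zero => simp [mul_iterPairing_zero hb]
      | succ n ih =>
        rw [Finset.sum_range_succ, map_add, ih, map_smul, mul_iterPairing_succ hδ hb,
          Finset.sum_range_succ (fun k => (1 / (k.factorial : ℝ)) •
            iterPairing δ Z k m (X j * P)) (n + 1)]
        have : (1 / ((n + 1).factorial : ℝ)) * ((n : ℝ) + 1) = 1 / (n.factorial : ℝ) := by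
          rw [Nat.factorial_succ]; push_cast; field_simp
        rw [smul_add, smul_sub, smul_smul, this]
        abel
    rw [tele, hz, add_zero]

lemma iterPairing_eq_zero (n : ℕ) {P : MvPolynomial σ ℝ} (h : DegLT n P) (m : M) :
    iterPairing δ Z n m P = 0 := by
  induction n generalizing m P with
  | zero => rw [degLT_zero_iff.1 h, iterPairing_zero]
  | succ n ih =>
    rw [iterPairing]
    exact Finset.sum_eq_zero fun j _ => ih (h.pderiv j) _

/-- If `bⱼ Z(m, P) = Z(m, Xⱼ P) + Z(δⱼ m, P)` then `b(P) Z(m, 1) = exp(∑ⱼ δⱼ ⊗ ∂ⱼ) Z (m, P)`. -/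
theorem expansion
    (hδ : ∀ i j m, δ i (δ j m) = δ j (δ i m))
    (hb : ∀ j m P, b (X j) (Z m P) = Z m (X j * P) + Z (δ j m) P)
    {n : ℕ} {P : MvPolynomial σ ℝ} (h : DegLT n P) (m : M) :
    b P (Z m 1) = ∑ k ∈ Finset.range n, (1 / (k.factorial : ℝ)) • iterPairing δ Z k m P := by
  obtain ⟨N₀, hN⟩ := exists_expansion hδ hb P
  rw [hN (max N₀ n) (le_max_left _ _)]
  symm
  apply Finset.sum_subset (by simp)
  intro k _ hk
  rw [iterPairing_eq_zero k (h.mono (by simpa using hk)), smul_zero]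

end Expansion

/-! ### The Treves identity for creation and annihilation type operators -/

section Treves

/-- Restriction of scalars from `ℂ` to `ℝ` for endomorphisms. -/
noncomputable def endRestrictScalars (V : Type*) [AddCommGroup V] [Module ℂ V] [Module ℝ V]
    [IsScalarTower ℝ ℂ V] : Module.End ℂ V →ₐ[ℝ] Module.End ℝ V :=
  AlgHom.ofLinearMap
    { toFun := fun f => f.restrictScalars ℝ
      map_add' := fun _ _ => rfl
      map_smul' := fun _ _ => rfl } rfl fun _ _ => rfl

variable {σ : Type*} {V H : Type*} [AddCommGroup V] [Module ℂ V] [Module ℝ V]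
  [IsScalarTower ℝ ℂ V]
  [NormedAddCommGroup H] [InnerProductSpace ℂ H]

variable {ι : V →ₗ[ℂ] H} {a b : MvPolynomial σ ℝ →ₐ[ℝ] Module.End ℂ V} {t : σ → ℝ}

/-- Adjunction extends from the generators because the coefficients are real and the reversal of
products is harmless in a commutative ring. -/
lemma inner_aeval_eq
    (hadj : ∀ j u v, inner ℂ (ι (a (X j) u)) (ι v) = inner ℂ (ι u) (ι (b (X j) v)))
    (P : MvPolynomial σ ℝ) (u v : V) :
    inner ℂ (ι (a P u)) (ι v) = inner ℂ (ι u) (ι (b P v)) := by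
  induction P using MvPolynomial.induction_on generalizing u v with
  | C c =>
    have : (C c : MvPolynomial σ ℝ) = c • 1 := by rw [smul_eq_C_mul, mul_one]
    rw [this, map_smul, map_smul, map_one, map_one]
    simp only [LinearMap.smul_apply, Module.End.one_apply]
    have e : ∀ w : V, c • w = (c : ℂ) • w := fun w => by
      rw [← Complex.coe_algebraMap, algebraMap_smul]
    rw [e, e, map_smul, map_smul, inner_smul_left, inner_smul_right]
    simp
  | add P R hP hR =>
    simp only [map_add, LinearMap.add_apply, inner_add_left, inner_add_right, hP, hR]
  | mul_X P j hP =>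
    rw [map_mul, Module.End.mul_apply, hP, hadj, ← Module.End.mul_apply, ← map_mul, mul_comm]

variable [Fintype σ]

/-- The quadratic form `∑_J (2t)_J ‖b(∂_J P) u‖²`, with `J` running over the `k`-tuples
of indices. -/
noncomputable def iterNorm (ι : V →ₗ[ℂ] H) (b : MvPolynomial σ ℝ →ₐ[ℝ] Module.End ℂ V)
    (t : σ → ℝ) (u : V) : ℕ → MvPolynomial σ ℝ → ℝ
  | 0, P => ‖ι (b P u)‖ ^ 2
  | k + 1, P => ∑ j, 2 * t j * iterNorm ι b t u k (pderiv j P)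

lemma iterNorm_nonneg (ht : ∀ j, 0 ≤ t j) (u : V) (k : ℕ) (P : MvPolynomial σ ℝ) :
    0 ≤ iterNorm ι b t u k P := by
  induction k generalizing P with
  | zero => exact sq_nonneg _
  | succ k ih => exact Finset.sum_nonneg fun j _ => mul_nonneg (by linarith [ht j]) (ih _)

/-- Normal ordering: in `⟨u, b(P) a(P) u⟩` every `b` is moved to the right of every `a` by
`expansion`. The resulting terms `⟨u, a(R) b(R) u⟩`, with `R` a derivative of `P`, are the squares
`‖b(R) u‖²`. -/
lemma norm_sq_eq_sum_iterNorm
    (hadj : ∀ j u v, inner ℂ (ι (a (X j) u)) (ι v) = inner ℂ (ι u) (ι (b (X j) v)))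
    (hcomm : ∀ j P u, b (X j) (a P u) = a P (b (X j) u) + (2 * t j) • a (pderiv j P) u)
    {n : ℕ} {P : MvPolynomial σ ℝ} (h : DegLT n P) (u : V) :
    ‖ι (a P u)‖ ^ 2 = ∑ k ∈ Finset.range n, (1 / (k.factorial : ℝ)) * iterNorm ι b t u k P := by
  let δ : σ → MvPolynomial σ ℝ →ₗ[ℝ] MvPolynomial σ ℝ :=
    fun j => (2 * t j) • (pderiv j).toLinearMap
  let Z : MvPolynomial σ ℝ →ₗ[ℝ] MvPolynomial σ ℝ →ₗ[ℝ] V :=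
    LinearMap.mk₂ ℝ (fun P R => a P (b R u)) (by simp) (by simp) (by simp) (by simp)
  have hδ : ∀ i j m, δ i (δ j m) = δ j (δ i m) := by
    intro i j m
    simp only [δ, LinearMap.smul_apply, map_smul, Derivation.coeFn_coe]
    rw [smul_comm]
    congr 2
    ext α
    simp only [coeff_pderiv]
    by_cases hij : i = j
    · subst hij; rfl
    · rw [add_right_comm]
      simp [hij, Ne.symm hij]
      ring
  let β : MvPolynomial σ ℝ →ₐ[ℝ] Module.End ℝ V := (endRestrictScalars V).comp b
  have hβ : ∀ P v, β P v = b P v := fun _ _ => rfl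
  have hb : ∀ j m P, β (X j) (Z m P) = Z m (X j * P) + Z (δ j m) P := by
    intro j m P
    simp only [hβ, Z, LinearMap.mk₂_apply, hcomm, δ, map_mul, Module.End.mul_apply,
      LinearMap.smul_apply, map_smul, Derivation.coeFn_coe]
  have hit : ∀ k P, (inner ℂ (ι u) (ι (iterPairing δ Z k P P))).re = iterNorm ι b t u k P := by
    intro k
    induction k with
    | zero =>
      intro P
      simp only [iterPairing, iterNorm, Z, LinearMap.mk₂_apply]
      rw [← inner_conj_symm, inner_aeval_eq hadj, Complex.conj_re]
      exact inner_self_eq_norm_sq (𝕜 := ℂ) _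
    | succ k ih =>
      intro P
      simp only [iterPairing, iterNorm, map_sum, inner_sum, Complex.re_sum]
      refine Finset.sum_congr rfl fun j _ => ?_
      have e : δ j P = (2 * t j) • pderiv j P := rfl
      have e' : ∀ (c : ℝ) (w : V), c • w = (c : ℂ) • w := fun c w => by
        rw [← Complex.coe_algebraMap, algebraMap_smul]
      rw [e, iterPairing_smul_left, e', map_smul, inner_smul_right, Complex.re_ofReal_mul, ih]
  have hexp := expansion hδ hb h P
  have e1 : Z P 1 = a P u := by simp [Z]
  rw [e1, hβ] at hexp
  have e2 : ‖ι (a P u)‖ ^ 2 = (inner ℂ (ι u) (ι (b P (a P u)))).re := by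
    rw [← inner_aeval_eq hadj]
    exact (inner_self_eq_norm_sq (𝕜 := ℂ) _).symm
  rw [e2, hexp, map_sum, inner_sum, Complex.re_sum]
  refine Finset.sum_congr rfl fun k _ => ?_
  have e' : ∀ (c : ℝ) (w : V), c • w = (c : ℂ) • w := fun c w => by
    rw [← Complex.coe_algebraMap, algebraMap_smul]
  rw [e', map_smul, inner_smul_right, Complex.re_ofReal_mul, hit]

/-- An exact form of the Treves inequality for operators with `[bⱼ, aⱼ] = 2 tⱼ`, `bⱼ = aⱼ*`. -/
theorem treves
    (hadj : ∀ j u v, inner ℂ (ι (a (X j) u)) (ι v) = inner ℂ (ι u) (ι (b (X j) v)))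
    (hcomm : ∀ j P u, b (X j) (a P u) = a P (b (X j) u) + (2 * t j) • a (pderiv j P) u)
    {n : ℕ} {P : MvPolynomial σ ℝ} (h : DegLT n P) (ht : ∀ j, 0 ≤ t j) (u : V) :
    ∑ j, 2 * t j * ‖ι (a (pderiv j P) u)‖ ^ 2 ≤ n * ‖ι (a P u)‖ ^ 2 := by
  have h1 : ∀ j, ‖ι (a (pderiv j P) u)‖ ^ 2 =
      ∑ k ∈ Finset.range n, (1 / (k.factorial : ℝ)) * iterNorm ι b t u k (pderiv j P) :=
    fun j => norm_sq_eq_sum_iterNorm hadj hcomm ((h.mono (Nat.le_succ n)).pderiv j) u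
  have h2 : ∑ j, 2 * t j * ‖ι (a (pderiv j P) u)‖ ^ 2 =
      ∑ k ∈ Finset.range n, (1 / (k.factorial : ℝ)) * iterNorm ι b t u (k + 1) P := by
    simp only [h1, iterNorm, Finset.mul_sum]
    rw [Finset.sum_comm]
    refine Finset.sum_congr rfl fun k _ => Finset.sum_congr rfl fun j _ => ?_
    ring
  rw [h2, norm_sq_eq_sum_iterNorm hadj hcomm (h.mono (Nat.le_succ n)) u, Finset.mul_sum,
    Finset.sum_range_succ']
  -- Passing from `P` to its first derivatives shifts the series by one place, and `1 / k! = (k + 1)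
  -- / (k + 1)!` with `k + 1 ≤ n`.
  have : ∑ k ∈ Finset.range n, (1 / (k.factorial : ℝ)) * iterNorm ι b t u (k + 1) P ≤
      ∑ k ∈ Finset.range n, n * (1 / ((k + 1).factorial : ℝ) * iterNorm ι b t u (k + 1) P) := by
    refine Finset.sum_le_sum fun k hk => ?_
    have hk' : (k : ℝ) + 1 ≤ n := by exact_mod_cast Finset.mem_range.1 hk
    rw [← mul_assoc]
    refine mul_le_mul_of_nonneg_right ?_ (iterNorm_nonneg ht u _ P)
    rw [Nat.factorial_succ]
    push_cast
    rw [mul_one_div, div_le_div_iff₀ (by positivity) (by positivity)]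
    have : (0 : ℝ) < k.factorial := by positivity
    nlinarith
  refine this.trans (le_add_of_nonneg_right ?_)
  have := iterNorm_nonneg (ι := ι) (b := b) ht u 0 P
  positivity

end Treves

end HigherOrderSchrodinger

namespace HigherOrderSchrodinger

open MvPolynomial

/-! ### Polynomials in commuting operators -/

section CommEval

variable {σ V : Type*} [AddCommGroup V] [Module ℂ V] [Module ℝ V] [IsScalarTower ℝ ℂ V]

/-- Evaluation of real polynomials at a family of commuting endomorphisms. -/
noncomputable def commEval (A : σ → Module.End ℂ V) (h : ∀ i j, A i * A j = A j * A i) :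
    MvPolynomial σ ℝ →ₐ[ℝ] Module.End ℂ V :=
  -- `aeval` asks for a commutative target, so the evaluation takes place in the subalgebra
  -- generated by the family.
  have hc : IsMulCommutative (Algebra.adjoin ℝ (Set.range A)) :=
    Algebra.isMulCommutative_adjoin ℝ (by rintro _ ⟨i, rfl⟩ _ ⟨j, rfl⟩; exact h i j)
  letI : CommRing (Algebra.adjoin ℝ (Set.range A)) :=
    { (inferInstance : Ring (Algebra.adjoin ℝ (Set.range A))) with
      mul_comm := hc.is_comm.comm }
  (Algebra.adjoin ℝ (Set.range A)).val.comp
    (aeval fun j => (⟨A j, Algebra.subset_adjoin ⟨j, rfl⟩⟩ : Algebra.adjoin ℝ (Set.range A)))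

lemma commEval_X (A : σ → Module.End ℂ V) (h : ∀ i j, A i * A j = A j * A i) (j : σ) :
    commEval A h (X j) = A j := by
  simp [commEval]

end CommEval

/-! ### Momentum and multiplication operators on Schwartz functions -/

variable {d : ℕ}

lemma fderiv_fderiv_comm {E F : Type*} [NormedAddCommGroup E] [NormedSpace ℝ E]
    [NormedAddCommGroup F] [NormedSpace ℝ F] {f : E → F} (hf : ContDiff ℝ ∞ f) (x v w : E) :
    fderiv ℝ (fun y => fderiv ℝ f y v) x w = fderiv ℝ (fun y => fderiv ℝ f y w) x v := by
  have hd : DifferentiableAt ℝ (fderiv ℝ f) x :=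
    ((hf.fderiv_right (m := ∞) le_rfl).differentiable (by norm_num)) x
  have h := (hf.contDiffAt (x := x)).isSymmSndFDerivAt
    (by simpa using (WithTop.coe_le_coe.2 (le_top : (2 : ℕ∞) ≤ ⊤)))
  have e : ∀ v w : E, fderiv ℝ (fun y => fderiv ℝ f y v) x w = fderiv ℝ (fderiv ℝ f) x w v := by
    intro v w
    rw [fderiv_clm_apply hd (differentiableAt_const v)]
    simp
  rw [e, e]
  exact h w v

/-- The momentum operator `-i ∂ⱼ` on Schwartz functions. -/
noncomputable def momS (j : Fin d) : Module.End ℂ 𝓢(Space d, ℂ) :=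
  (-Complex.I) • (LineDeriv.lineDerivOpCLM ℂ 𝓢(Space d, ℂ) (stdVec j)).toLinearMap

lemma momS_apply (j : Fin d) (u : 𝓢(Space d, ℂ)) (x : Space d) :
    momS j u x = -Complex.I * fderiv ℝ u x (stdVec j) := by
  simp [momS, SchwartzMap.lineDerivOp_apply_eq_fderiv]

lemma momS_comm (i j : Fin d) : momS i * momS j = momS (d := d) j * momS i := by
  ext u x
  have h : ∀ i : Fin d, ⇑(momS i u) = fun y => -Complex.I * fderiv ℝ u y (stdVec i) :=
    fun i => funext fun y => momS_apply i u y
  have hd : ∀ i : Fin d, DifferentiableAt ℝ (fun y => fderiv ℝ u y (stdVec i)) x := fun i =>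
    (((u.smooth ⊤).fderiv_right (m := ∞) le_rfl).differentiable
      (by norm_num) x).clm_apply (differentiableAt_const _)
  simp only [Module.End.mul_apply, momS_apply, h]
  rw [fderiv_const_mul (hd j), fderiv_const_mul (hd i)]
  simp only [smul_apply]
  rw [fderiv_fderiv_comm (u.smooth ⊤)]

/-- The differential operator `P(-i∇)` on Schwartz functions. -/
noncomputable def opS : MvPolynomial (Fin d) ℝ →ₐ[ℝ] Module.End ℂ 𝓢(Space d, ℂ) :=
  commEval momS momS_comm

lemma opS_X (j : Fin d) : opS (X j) = momS j := commEval_X _ _ _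

lemma opS_C (c : ℝ) (u : 𝓢(Space d, ℂ)) : opS (C c) u = c • u := by
  have : (C c : MvPolynomial (Fin d) ℝ) = c • 1 := by rw [smul_eq_C_mul, mul_one]
  rw [this, map_smul, map_one]
  rfl

/-- The embedding of Schwartz functions into `L²`. -/
noncomputable def toL2 : 𝓢(Space d, ℂ) →ₗ[ℂ] L2 d :=
  (SchwartzMap.toLpCLM ℂ ℂ 2 (volume : Measure (Space d))).toLinearMap

lemma toL2_apply (u : 𝓢(Space d, ℂ)) : toL2 u = u.toLp 2 := rfl

lemma inner_toL2 (u v : 𝓢(Space d, ℂ)) :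
    inner ℂ (toL2 u) (toL2 v) = ∫ x, inner ℂ (u x) (v x) :=
  SchwartzMap.inner_toL2_toL2_eq u v volume

lemma norm_toL2_sq (u : 𝓢(Space d, ℂ)) : ‖toL2 u‖ ^ 2 = ∫ x, ‖u x‖ ^ 2 := by
  have h := inner_self_eq_norm_sq_to_K (𝕜 := ℂ) (toL2 u)
  rw [inner_toL2] at h
  have h2 : (fun x => inner ℂ (u x) (u x)) = fun x => ((‖u x‖ ^ 2 : ℝ) : ℂ) := by
    funext x
    rw [inner_self_eq_norm_sq_to_K]
    simp
  rw [h2, integral_complex_ofReal] at h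
  exact Complex.ofReal_injective (by push_cast; exact h.symm)

lemma momS_symm (j : Fin d) (u v : 𝓢(Space d, ℂ)) :
    inner ℂ (toL2 (momS j u)) (toL2 v) = inner ℂ (toL2 u) (toL2 (momS j v)) := by
  rw [inner_toL2, inner_toL2]
  have h := SchwartzMap.integral_bilinear_lineDerivOp_right_eq_neg_left (μ := volume) u v
    ((ContinuousLinearMap.mul ℝ ℂ).comp (Complex.conjCLE : ℂ →L[ℝ] ℂ)) (stdVec j)
  simp only [ContinuousLinearMap.comp_apply, ContinuousLinearMap.mul_apply',
    SchwartzMap.lineDerivOp_apply_eq_fderiv] at h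
  have e1 : ∀ x, inner ℂ (momS j u x) (v x) =
      Complex.I * (starRingEnd ℂ (fderiv ℝ u x (stdVec j)) * v x) := by
    intro x; rw [momS_apply, RCLike.inner_apply]; simp; ring
  have e2 : ∀ x, inner ℂ (u x) (momS j v x) =
      -Complex.I * (starRingEnd ℂ (u x) * fderiv ℝ v x (stdVec j)) := by
    intro x; rw [momS_apply, RCLike.inner_apply]; ring
  simp only [e1, e2, integral_const_mul]
  have h' : ∫ x, starRingEnd ℂ (u x) * fderiv ℝ v x (stdVec j) =
    -∫ x, starRingEnd ℂ (fderiv ℝ u x (stdVec j)) * v x := h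
  rw [h']
  ring

/-- Multiplication of Schwartz functions by the affine function `bⱼ + tⱼ xⱼ`. -/
noncomputable def affMul (b t : Fin d → ℝ) (j : Fin d) : Module.End ℂ 𝓢(Space d, ℂ) :=
  (SchwartzMap.smulLeftCLM ℂ (fun x : Space d => ((b j + t j * x j : ℝ) : ℂ))).toLinearMap

lemma affMul_apply (b t : Fin d → ℝ) (j : Fin d) (u : 𝓢(Space d, ℂ)) (x : Space d) :
    affMul b t j u x = ((b j + t j * x j : ℝ) : ℂ) * u x := by
  have h1 : Function.HasTemperateGrowth (fun x : Space d => b j + t j * x j) :=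
    (Function.HasTemperateGrowth.const (b j)).add
      ((Function.HasTemperateGrowth.const (t j)).mul
        (EuclideanSpace.proj (𝕜 := ℝ) j : Space d →L[ℝ] ℝ).hasTemperateGrowth)
  have h2 : Function.HasTemperateGrowth (fun x : Space d => ((b j + t j * x j : ℝ) : ℂ)) :=
    Function.Complex.hasTemperateGrowth_ofReal.comp h1
  change SchwartzMap.smulLeftCLM ℂ (fun x : Space d => ((b j + t j * x j : ℝ) : ℂ)) u x = _
  rw [SchwartzMap.smulLeftCLM_apply_apply h2, smul_eq_mul]

lemma stdVec_apply (i j : Fin d) : (stdVec i : Space d) j = if j = i then 1 else 0 := by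
  simp [stdVec]

lemma sum_smul_stdVec (x : Space d) : ∑ j, x j • (stdVec j : Space d) = x := by
  ext i; simp [stdVec_apply]

lemma norm_le_sum_abs (x : Space d) : ‖x‖ ≤ ∑ j, |x j| := by
  conv_lhs => rw [← sum_smul_stdVec x]
  refine (norm_sum_le _ _).trans (Finset.sum_le_sum fun j _ => ?_)
  rw [norm_smul, Real.norm_eq_abs, stdVec]
  simp

lemma hasFDerivAt_coord (j : Fin d) (x : Space d) :
    HasFDerivAt (fun x : Space d => x j) (EuclideanSpace.proj (𝕜 := ℝ) j : Space d →L[ℝ] ℝ) x :=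
  (EuclideanSpace.proj (𝕜 := ℝ) j : Space d →L[ℝ] ℝ).hasFDerivAt

lemma momS_affMul (b t : Fin d → ℝ) (i j : Fin d) (u : 𝓢(Space d, ℂ)) :
    momS i (affMul b t j u) = affMul b t j (momS i u) +
      (if j = i then -Complex.I * t j else 0) • u := by
  ext x
  have h : ⇑(affMul b t j u) = fun x => (b j + t j * x j : ℝ) • u x := by
    funext y; rw [affMul_apply]; simp
  have hg : HasFDerivAt (fun x : Space d => b j + t j * x j)
      (t j • (EuclideanSpace.proj (𝕜 := ℝ) j : Space d →L[ℝ] ℝ)) x :=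
    ((hasFDerivAt_coord j x).const_mul (t j)).const_add (b j)
  rw [momS_apply, h, (hg.fun_smul (u.hasFDerivAt x)).fderiv]
  simp only [add_apply,
    smul_apply, affMul_apply, momS_apply]
  simp [stdVec_apply]
  split_ifs <;> ring

lemma affMul_comm (b t : Fin d → ℝ) (i j : Fin d) :
    affMul b t i * affMul b t j = affMul b t j * affMul b t i := by
  ext u x
  simp only [Module.End.mul_apply, affMul_apply]
  ring

lemma affMul_symm (b t : Fin d → ℝ) (j : Fin d) (u v : 𝓢(Space d, ℂ)) :
    inner ℂ (toL2 (affMul b t j u)) (toL2 v) = inner ℂ (toL2 u) (toL2 (affMul b t j v)) := by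
  rw [inner_toL2, inner_toL2]
  congr 1
  funext x
  rw [affMul_apply, affMul_apply, RCLike.inner_apply, RCLike.inner_apply, map_mul,
    Complex.conj_ofReal]
  ring

/-! ### Conjugation by exponentials of quadratic polynomials -/

/-- The operators `-i ∂ⱼ + s (bⱼ + tⱼ xⱼ)`. -/
noncomputable def twist (s : ℂ) (b t : Fin d → ℝ) (j : Fin d) : Module.End ℂ 𝓢(Space d, ℂ) :=
  momS j + s • affMul b t j

/-- For `i ≠ j` the `j`-th affine function does not depend on `x i`, so all commutators vanish: the
Hessian of the weight is diagonal. -/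
lemma twist_comm (s : ℂ) (b t : Fin d → ℝ) (i j : Fin d) :
    twist s b t i * twist s b t j = twist s b t j * twist s b t i := by
  apply LinearMap.ext
  intro u
  have h1 := LinearMap.congr_fun (momS_comm i j) u
  have h2 := LinearMap.congr_fun (affMul_comm b t i j) u
  simp only [Module.End.mul_apply] at h1 h2
  simp only [twist, Module.End.mul_apply, LinearMap.add_apply, LinearMap.smul_apply, map_add,
    map_smul, momS_affMul, h1, h2]
  by_cases hij : i = j
  · subst hij; rfl
  · simp only [if_neg hij, if_neg (Ne.symm hij), zero_smul, add_zero]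
    module

/-- The conjugated operator `e^g P(-i∇) e^{-g}`, where `∂ⱼ g = bⱼ + tⱼ xⱼ`. -/
noncomputable def twistOp (s : ℂ) (b t : Fin d → ℝ) :
    MvPolynomial (Fin d) ℝ →ₐ[ℝ] Module.End ℂ 𝓢(Space d, ℂ) :=
  commEval (twist s b t) (twist_comm s b t)

lemma twistOp_X (s : ℂ) (b t : Fin d → ℝ) (j : Fin d) :
    twistOp s b t (X j) = twist s b t j := commEval_X _ _ _

lemma twistOp_adjoint (b t : Fin d → ℝ) (j : Fin d) (u v : 𝓢(Space d, ℂ)) :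
    inner ℂ (toL2 (twistOp Complex.I b t (X j) u)) (toL2 v) =
      inner ℂ (toL2 u) (toL2 (twistOp (-Complex.I) b t (X j) v)) := by
  simp only [twistOp_X, twist, LinearMap.add_apply, LinearMap.smul_apply, map_add, map_smul,
    inner_add_left, inner_add_right, inner_smul_left, inner_smul_right, momS_symm, affMul_symm,
    Complex.conj_I]

/-- The signs of `Complex.I` in the two factors are opposite, so the two commutators of momentum
with the affine function add up to `2 tⱼ` instead of cancelling. -/
lemma twist_twist (b t : Fin d → ℝ) (j k : Fin d) (u : 𝓢(Space d, ℂ)) :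
    twist (-Complex.I) b t j (twist Complex.I b t k u) =
      twist Complex.I b t k (twist (-Complex.I) b t j u) +
        (if j = k then 2 * t j else 0 : ℝ) • u := by
  have h1 := LinearMap.congr_fun (momS_comm j k) u
  have h2 := LinearMap.congr_fun (affMul_comm b t j k) u
  simp only [Module.End.mul_apply] at h1 h2
  have e : ∀ (c : ℝ) (w : 𝓢(Space d, ℂ)), c • w = (c : ℂ) • w := fun c w => by
    rw [← Complex.coe_algebraMap, algebraMap_smul]
  simp only [twist, LinearMap.add_apply, LinearMap.smul_apply, map_add,
    map_smul, momS_affMul, h1, h2, e]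
  by_cases hij : j = k
  · subst hij
    simp only [if_true, smul_add, smul_smul, neg_smul, smul_neg, neg_mul, ← mul_assoc,
      Complex.I_mul_I]
    push_cast
    module
  · simp only [if_neg hij, if_neg (Ne.symm hij), zero_smul, add_zero, Complex.ofReal_zero]
    module

/-- The commutator with a fixed operator is a derivation, so the relation on generators propagates
to `pderiv`. -/
lemma twistOp_comm (b t : Fin d → ℝ) (j : Fin d) (P : MvPolynomial (Fin d) ℝ)
    (u : 𝓢(Space d, ℂ)) :
    twistOp (-Complex.I) b t (X j) (twistOp Complex.I b t P u) =
      twistOp Complex.I b t P (twistOp (-Complex.I) b t (X j) u) +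
        (2 * t j) • twistOp Complex.I b t (pderiv j P) u := by
  induction P using MvPolynomial.induction_on generalizing u with
  | C c =>
    have : (C c : MvPolynomial (Fin d) ℝ) = c • 1 := by rw [smul_eq_C_mul, mul_one]
    rw [pderiv_C, this]
    simp only [map_smul, map_one, LinearMap.smul_apply, Module.End.one_apply, map_zero,
      LinearMap.zero_apply, smul_zero, add_zero]
    exact (twistOp (-Complex.I) b t (X j)).map_smul_of_tower c u
  | add P R hP hR =>
    simp only [map_add, LinearMap.add_apply, hP, hR, smul_add]
    abel
  | mul_X P k hP =>
    rw [map_mul, Module.End.mul_apply, hP, pderiv_mul, map_add, map_mul, map_mul,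
      LinearMap.add_apply, Module.End.mul_apply, Module.End.mul_apply, Module.End.mul_apply,
      twistOp_X, twistOp_X, twist_twist, map_add]
    have : twistOp Complex.I b t P ((if j = k then 2 * t j else 0 : ℝ) • u) =
        (2 * t j) • twistOp Complex.I b t P (twistOp Complex.I b t (pderiv j (X k)) u) := by
      rw [LinearMap.map_smul_of_tower]
      by_cases h : j = k
      · subst h; simp
      · rw [if_neg h, pderiv_X_of_ne (Ne.symm h)]; simp
    rw [this, smul_add]
    abel

/-- A quadratic polynomial with diagonal Hessian. -/
noncomputable def quadWeight (c : ℝ) (b t : Fin d → ℝ) (x : Space d) : ℝ :=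
  c + ∑ j, (b j * x j + t j * x j ^ 2 / 2)

lemma hasFDerivAt_quadWeight (c : ℝ) (b t : Fin d → ℝ) (x : Space d) :
    HasFDerivAt (quadWeight c b t)
      (∑ j, (b j + t j * x j) • (EuclideanSpace.proj (𝕜 := ℝ) j : Space d →L[ℝ] ℝ)) x := by
  unfold quadWeight
  refine HasFDerivAt.const_add _ (HasFDerivAt.fun_sum fun j _ => ?_)
  have h := hasFDerivAt_coord j x
  refine ((h.const_mul (b j)).add (((h.pow 2).const_mul (t j)).mul_const (1 / 2))).congr_fderiv ?_
    |>.congr_of_eventuallyEq ?_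
  · ext v
    simp
    ring
  · refine Eventually.of_forall fun y => ?_
    simp
    ring

/-- `U` is a given Schwartz function that agrees with `e^g v`, because multiplication by `e^g` does
not preserve the Schwartz space. -/
lemma twist_eq_exp_mul (c : ℝ) (b t : Fin d → ℝ) (j : Fin d) (U v : 𝓢(Space d, ℂ))
    (h : ∀ x, U x = (Real.exp (quadWeight c b t x) : ℂ) * v x) (x : Space d) :
    twist Complex.I b t j U x = (Real.exp (quadWeight c b t x) : ℂ) * momS j v x := by
  have hU : ⇑U = fun x => Real.exp (quadWeight c b t x) • v x := by
    funext y; rw [h y]; simp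
  have hd := ((hasFDerivAt_quadWeight c b t x).exp).fun_smul (v.hasFDerivAt x)
  have hm : momS j U x = -Complex.I * fderiv ℝ U x (stdVec j) := momS_apply j U x
  rw [hU, hd.fderiv] at hm
  have e : (∑ k, (b k + t k * x k) • (EuclideanSpace.proj (𝕜 := ℝ) k : Space d →L[ℝ] ℝ))
      (stdVec j) = b j + t j * x j := by
    simp [stdVec_apply]
  rw [twist, LinearMap.add_apply, LinearMap.smul_apply, add_apply,
    smul_apply, affMul_apply, hm, momS_apply, h x]
  simp only [add_apply, smul_apply,
    ContinuousLinearMap.smulRight_apply, e, smul_eq_mul, Complex.real_smul]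
  push_cast
  ring

/-- Conjugation of `P(-i∇)` by the exponential of a quadratic polynomial. -/
lemma twistOp_eq_exp_mul (c : ℝ) (b t : Fin d → ℝ) (P : MvPolynomial (Fin d) ℝ)
    (U v : 𝓢(Space d, ℂ))
    (h : ∀ x, U x = (Real.exp (quadWeight c b t x) : ℂ) * v x) (x : Space d) :
    twistOp Complex.I b t P U x = (Real.exp (quadWeight c b t x) : ℂ) * opS P v x := by
  induction P using MvPolynomial.induction_on generalizing U v x with
  | C a =>
    have : (C a : MvPolynomial (Fin d) ℝ) = a • 1 := by rw [smul_eq_C_mul, mul_one]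
    rw [this]
    simp only [map_smul, map_one, LinearMap.smul_apply, Module.End.one_apply,
      smul_apply, h, Complex.real_smul]
    ring
  | add P R hP hR =>
    simp only [map_add, LinearMap.add_apply, add_apply, hP U v h, hR U v h]
    ring
  | mul_X P k hP =>
    rw [map_mul, map_mul, Module.End.mul_apply, Module.End.mul_apply, twistOp_X, opS_X]
    exact hP _ _ (twist_eq_exp_mul c b t k U v h) x

end HigherOrderSchrodinger

namespace HigherOrderSchrodinger

open MvPolynomial

variable {d : ℕ}

/-! ### Words of indices and iterated derivatives -/

section Words

/-- The words of length `k` in the indices `1, …, d`. -/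
def words (d : ℕ) : ℕ → Finset (List (Fin d))
  | 0 => {[]}
  | k + 1 => (Finset.univ ×ˢ words d k).image fun p => p.1 :: p.2

lemma mem_words {k : ℕ} {L : List (Fin d)} : L ∈ words d k ↔ L.length = k := by
  induction k generalizing L with
  | zero => simp [words]
  | succ k ih =>
    cases L with
    | nil => simp [words]
    | cons j L => simp [words, ih]

lemma sum_words_succ {N : Type*} [AddCommMonoid N] (k : ℕ) (F : List (Fin d) → N) :
    ∑ L ∈ words d (k + 1), F L = ∑ j, ∑ L ∈ words d k, F (j :: L) := by
  rw [words, Finset.sum_image, Finset.sum_product]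
  rintro ⟨i, L⟩ _ ⟨j, L'⟩ _ h
  simpa using h

/-- The nonempty words of length at most `q`. -/
def wordsLE (d q : ℕ) : Finset (List (Fin d)) := (Finset.Icc 1 q).biUnion (words d)

lemma mem_wordsLE {q : ℕ} {L : List (Fin d)} :
    L ∈ wordsLE d q ↔ 1 ≤ L.length ∧ L.length ≤ q := by
  simp [wordsLE, mem_words]

lemma sum_wordsLE {N : Type*} [AddCommMonoid N] (q : ℕ) (F : List (Fin d) → N) :
    ∑ L ∈ wordsLE d q, F L = ∑ k ∈ Finset.Icc 1 q, ∑ L ∈ words d k, F L := by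
  rw [wordsLE, Finset.sum_biUnion]
  intro k _ l _ hkl
  refine Finset.disjoint_left.2 fun L hL hL' => hkl ?_
  rw [← mem_words.1 hL, ← mem_words.1 hL']

/-- The iterated partial derivative `∂_L P`. -/
noncomputable def polyD : List (Fin d) → MvPolynomial (Fin d) ℝ → MvPolynomial (Fin d) ℝ
  | [], P => P
  | j :: L, P => polyD L (pderiv j P)

/-- The product of the `tⱼ` over the letters of a word. -/
def wordProd (t : Fin d → ℝ) (L : List (Fin d)) : ℝ := (L.map t).prod

@[simp] lemma wordProd_nil (t : Fin d → ℝ) : wordProd t [] = 1 := rfl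

@[simp] lemma wordProd_cons (t : Fin d → ℝ) (j : Fin d) (L : List (Fin d)) :
    wordProd t (j :: L) = t j * wordProd t L := by simp [wordProd]

lemma wordProd_nonneg {t : Fin d → ℝ} (ht : ∀ j, 0 ≤ t j) (L : List (Fin d)) :
    0 ≤ wordProd t L := by
  induction L with
  | nil => simp
  | cons j L ih => rw [wordProd_cons]; exact mul_nonneg (ht j) ih

lemma wordProd_le_wordProd {s t : Fin d → ℝ} (hs : ∀ j, 0 ≤ s j) (hst : ∀ j, s j ≤ t j)
    (L : List (Fin d)) : wordProd s L ≤ wordProd t L := by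
  induction L with
  | nil => simp
  | cons j L ih =>
    rw [wordProd_cons, wordProd_cons]
    exact mul_le_mul (hst j) ih (wordProd_nonneg hs L) ((hs j).trans (hst j))

lemma wordProd_mul (s t : Fin d → ℝ) (L : List (Fin d)) :
    wordProd (fun j => s j * t j) L = wordProd s L * wordProd t L := by
  induction L with
  | nil => simp
  | cons j L ih => simp only [wordProd_cons, ih]; ring

lemma wordProd_const (c : ℝ) (L : List (Fin d)) : wordProd (fun _ => c) L = c ^ L.length := by
  induction L with
  | nil => simp
  | cons j L ih => simp only [wordProd_cons, ih, List.length_cons]; ring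

/-- Through this the frozen value of the potential can be added to the symbol without changing the
left side of the Carleman estimate. -/
lemma polyD_add_C {L : List (Fin d)} (hL : L ≠ []) (P : MvPolynomial (Fin d) ℝ) (c : ℝ) :
    polyD L (P + C c) = polyD L P := by
  cases L with
  | nil => exact absurd rfl hL
  | cons j L => simp [polyD]

end Words

/-! ### The Carleman inequality with quadratic weights -/

section WeightedTreves

/-- The squared `L²` norm over `S` with weight `e^{2g}`. -/
noncomputable def wInt (g : Space d → ℝ) (S : Set (Space d)) (u : Space d → ℂ) : ℝ :=
  ∫ x in S, Real.exp (2 * g x) * ‖u x‖ ^ 2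

lemma wInt_nonneg (g : Space d → ℝ) (S : Set (Space d)) (u : Space d → ℂ) : 0 ≤ wInt g S u :=
  integral_nonneg fun x => by positivity

lemma contDiff_quadWeight (c : ℝ) (b t : Fin d → ℝ) : ContDiff ℝ ∞ (quadWeight c b t) := by
  unfold quadWeight
  have : ∀ j : Fin d, ContDiff ℝ ∞ (fun x : Space d => x j) := fun j =>
    (EuclideanSpace.proj (𝕜 := ℝ) j : Space d →L[ℝ] ℝ).contDiff
  exact contDiff_const.add (ContDiff.sum fun j _ => (contDiff_const.mul (this j)).add
    ((contDiff_const.mul ((this j).pow 2)).div_const 2))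

lemma exists_exp_mul (c : ℝ) (b t : Fin d → ℝ) (v : 𝓢(Space d, ℂ)) (hv : HasCompactSupport v) :
    ∃ U : 𝓢(Space d, ℂ), ∀ x, U x = (Real.exp (quadWeight c b t x) : ℂ) * v x := by
  have h1 : HasCompactSupport (fun x => (Real.exp (quadWeight c b t x) : ℂ) * v x) := hv.mul_left
  have h2 : ContDiff ℝ ∞ (fun x => (Real.exp (quadWeight c b t x) : ℂ) * v x) :=
    (Complex.ofRealCLM.contDiff.comp (contDiff_quadWeight c b t).exp).mul (v.smooth ⊤)
  exact ⟨h1.toSchwartzMap h2, fun x => rfl⟩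

lemma norm_twistOp_sq (c : ℝ) (b t : Fin d → ℝ) (P : MvPolynomial (Fin d) ℝ)
    (U v : 𝓢(Space d, ℂ))
    (h : ∀ x, U x = (Real.exp (quadWeight c b t x) : ℂ) * v x) :
    ‖toL2 (twistOp Complex.I b t P U)‖ ^ 2 = wInt (quadWeight c b t) Set.univ (opS P v) := by
  rw [norm_toL2_sq, wInt, setIntegral_univ]
  congr 1
  funext x
  rw [twistOp_eq_exp_mul c b t P U v h x, norm_mul, Complex.norm_real, Real.norm_eq_abs,
    Real.abs_exp, mul_pow, ← Real.exp_nat_mul]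
  norm_num

/-- A Treves type inequality for weights `e^{2g}` with `g` a quadratic polynomial. -/
theorem treves_word (c : ℝ) (b : Fin d → ℝ) {t : Fin d → ℝ} (ht : ∀ j, 0 ≤ t j) {n : ℕ}
    (L : List (Fin d)) {P : MvPolynomial (Fin d) ℝ} (hP : DegLT n P)
    {v : 𝓢(Space d, ℂ)} (hv : HasCompactSupport v) :
    wordProd t L * wInt (quadWeight c b t) Set.univ (opS (polyD L P) v) ≤
      n ^ L.length * wInt (quadWeight c b t) Set.univ (opS P v) := by
  obtain ⟨U, hU⟩ := exists_exp_mul c b t v hv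
  induction L generalizing P with
  | nil => simp [polyD]
  | cons j L ih =>
    -- The degree bound is kept at `n` for the derivative, so that every letter costs the same
    -- factor.
    have h1 := ih (P := pderiv j P) ((hP.mono (Nat.le_succ n)).pderiv j)
    have h2 := treves (ι := toL2) (twistOp_adjoint b t) (twistOp_comm b t) hP ht U
    simp only [norm_twistOp_sq c b t _ U v hU] at h2
    have h3 : 2 * t j * wInt (quadWeight c b t) Set.univ (opS (pderiv j P) v) ≤
        n * wInt (quadWeight c b t) Set.univ (opS P v) :=
      (Finset.single_le_sum (f := fun j => 2 * t j *
        wInt (quadWeight c b t) Set.univ (opS (pderiv j P) v))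
        (fun i _ => mul_nonneg (by linarith [ht i]) (wInt_nonneg _ _ _))
        (Finset.mem_univ j)).trans h2
    have h4 : t j * wInt (quadWeight c b t) Set.univ (opS (pderiv j P) v) ≤
        n * wInt (quadWeight c b t) Set.univ (opS P v) := by
      have := mul_nonneg (ht j) (wInt_nonneg (quadWeight c b t) Set.univ (opS (pderiv j P) v))
      linarith
    rw [wordProd_cons, polyD, List.length_cons, pow_succ]
    calc _ = t j * (wordProd t L * wInt (quadWeight c b t) Set.univ
              (opS (polyD L (pderiv j P)) v)) := by ring
      _ ≤ t j * (n ^ L.length * wInt (quadWeight c b t) Set.univ (opS (pderiv j P) v)) :=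
        mul_le_mul_of_nonneg_left h1 (ht j)
      _ = n ^ L.length * (t j * wInt (quadWeight c b t) Set.univ (opS (pderiv j P) v)) := by ring
      _ ≤ n ^ L.length * (n * wInt (quadWeight c b t) Set.univ (opS P v)) := by gcongr
      _ = _ := by ring

end WeightedTreves

/-! ### The Leibniz rule for cutoffs -/

section Leibniz

/-- The product of two Schwartz functions. -/
noncomputable def mulS (χ u : 𝓢(Space d, ℂ)) : 𝓢(Space d, ℂ) :=
  SchwartzMap.pairing (ContinuousLinearMap.mul ℂ ℂ) χ u

lemma mulS_apply (χ u : 𝓢(Space d, ℂ)) (x : Space d) : mulS χ u x = χ x * u x := by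
  rw [mulS, SchwartzMap.pairing_apply_apply]; rfl

/-- Iterated application of the momentum operators along a word. -/
noncomputable def momW : List (Fin d) → 𝓢(Space d, ℂ) → 𝓢(Space d, ℂ)
  | [], χ => χ
  | j :: L, χ => momW L (momS j χ)

lemma momS_mulS (j : Fin d) (χ u : 𝓢(Space d, ℂ)) :
    momS j (mulS χ u) = mulS χ (momS j u) + mulS (momS j χ) u := by
  ext x
  have h : ⇑(mulS χ u) = fun x => χ x * u x := funext (mulS_apply χ u)
  rw [momS_apply, h, ((χ.hasFDerivAt x).fun_mul (u.hasFDerivAt x)).fderiv]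
  simp only [add_apply, smul_apply, mulS_apply, momS_apply, smul_eq_mul]
  ring

/-- The Leibniz rule for `P(-i∇)`, as a pointwise bound for the terms containing derivatives
of the cutoff. -/
theorem norm_opS_mulS_sub_le {q : ℕ} {P : MvPolynomial (Fin d) ℝ} (hP : DegLT (q + 1) P)
    (χ u : 𝓢(Space d, ℂ)) (x : Space d) :
    ‖opS P (mulS χ u) x - χ x * opS P u x‖ ≤
      ∑ L ∈ wordsLE d q, ‖momW L χ x‖ * ‖opS (polyD L P) u x‖ := by
  let δ : Fin d → 𝓢(Space d, ℂ) →ₗ[ℝ] 𝓢(Space d, ℂ) := fun j => (momS j).restrictScalars ℝ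
  let Z : 𝓢(Space d, ℂ) →ₗ[ℝ] MvPolynomial (Fin d) ℝ →ₗ[ℝ] 𝓢(Space d, ℂ) :=
    LinearMap.mk₂ ℝ (fun χ P => mulS χ (opS P u))
      (fun χ χ' P => by ext x; simp [mulS_apply, add_mul])
      (fun c χ P => by ext x; simp [mulS_apply, mul_assoc])
      (fun χ P R => by ext x; simp [mulS_apply, mul_add])
      (fun c χ P => by ext x; simp [mulS_apply]; ring)
  have hZ : ∀ χ P, Z χ P = mulS χ (opS P u) := fun _ _ => rfl
  have hδ : ∀ i j m, δ i (δ j m) = δ j (δ i m) := fun i j m =>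
    LinearMap.congr_fun (momS_comm i j) m
  have hb : ∀ j m P, (endRestrictScalars 𝓢(Space d, ℂ)).comp opS (X j) (Z m P) =
      Z m (X j * P) + Z (δ j m) P := by
    intro j m P
    change opS (X j) (mulS m (opS P u)) = mulS m (opS (X j * P) u) + mulS (momS j m) (opS P u)
    rw [opS_X, momS_mulS, map_mul, Module.End.mul_apply, opS_X]
  have hexp := expansion hδ hb hP χ
  have e0 : ((endRestrictScalars 𝓢(Space d, ℂ)).comp opS P) (Z χ 1) = opS P (mulS χ u) := by
    rw [hZ, map_one]; rfl
  have hit : ∀ k χ P, ‖iterPairing δ Z k χ P x‖ ≤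
      ∑ L ∈ words d k, ‖momW L χ x‖ * ‖opS (polyD L P) u x‖ := by
    intro k
    induction k with
    | zero => intro χ P; simp [iterPairing, words, hZ, mulS_apply, momW, polyD]
    | succ k ih =>
      intro χ P
      rw [sum_words_succ, iterPairing, sum_apply]
      exact (norm_sum_le _ _).trans (Finset.sum_le_sum fun j _ => ih _ _)
  rw [← e0, hexp, Finset.sum_range_succ', add_apply, sum_apply, sum_wordsLE]
  have e1 : ((1 / (Nat.factorial 0 : ℝ)) • iterPairing δ Z 0 χ P) x = χ x * opS P u x := by
    simp [iterPairing, hZ, mulS_apply]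
  rw [e1, add_sub_cancel_right]
  refine (norm_sum_le _ _).trans ?_
  have e2 : ∀ F : ℕ → ℝ, ∑ k ∈ Finset.Icc 1 q, F k = ∑ k ∈ Finset.range q, F (k + 1) := by
    intro F
    rw [Finset.range_eq_Ico, Finset.sum_Ico_add' F 0 q 1]
    exact Finset.sum_congr (by ext; simp) fun _ _ => rfl
  rw [e2]
  refine Finset.sum_le_sum fun k _ => ?_
  refine le_trans ?_ (hit (k + 1) χ P)
  rw [smul_apply, norm_smul]
  -- Words count a mixed derivative once for each order of its letters; the factorial corrects this
  -- and may be dropped in an upper bound.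
  refine mul_le_of_le_one_left (norm_nonneg _) ?_
  rw [Real.norm_eq_abs, abs_of_nonneg (by positivity)]
  refine div_le_one_of_le₀ ?_ (by positivity)
  exact_mod_cast Nat.one_le_iff_ne_zero.2 (Nat.factorial_ne_zero _)

end Leibniz

/-! ### Cutoffs adapted to boxes -/

section Cutoff

/-- The open box with centre `y` and half side lengths `rⱼ`. -/
def box (y : Space d) (r : Fin d → ℝ) : Set (Space d) := {x | ∀ j, |x j - y j| < r j}

lemma isOpen_box (y : Space d) (r : Fin d → ℝ) : IsOpen (box y r) := by
  have : box y r = ⋂ j, {x : Space d | |x j - y j| < r j} := by ext; simp [box]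
  rw [this]
  exact isOpen_iInter_of_finite fun j => isOpen_lt (by fun_prop) continuous_const

lemma momS_eq_zero_of_eqOn {O : Set (Space d)} (hO : IsOpen O) {χ : 𝓢(Space d, ℂ)} {c : ℂ}
    (h : ∀ x ∈ O, χ x = c) (j : Fin d) : ∀ x ∈ O, momS j χ x = 0 := by
  intro x hx
  have : χ =ᶠ[𝓝 x] fun _ => c := by
    filter_upwards [hO.mem_nhds hx] with y hy using h y hy
  rw [momS_apply, this.fderiv_eq]
  simp

lemma momW_eq_zero_of_eqOn_zero {O : Set (Space d)} (hO : IsOpen O) {χ : 𝓢(Space d, ℂ)}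
    (h : ∀ x ∈ O, χ x = 0) (L : List (Fin d)) : ∀ x ∈ O, momW L χ x = 0 := by
  induction L generalizing χ with
  | nil => exact h
  | cons j L ih => exact ih (momS_eq_zero_of_eqOn hO h j)

lemma momW_eq_zero_of_eqOn {O : Set (Space d)} (hO : IsOpen O) {χ : 𝓢(Space d, ℂ)} {c : ℂ}
    (h : ∀ x ∈ O, χ x = c) {L : List (Fin d)} (hL : L ≠ []) : ∀ x ∈ O, momW L χ x = 0 := by
  cases L with
  | nil => exact absurd rfl hL
  | cons j L => exact momW_eq_zero_of_eqOn_zero hO (momS_eq_zero_of_eqOn hO h j) L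

/-- The affine map `x ↦ (xⱼ - yⱼ) / rⱼ`. -/
noncomputable def rescale (y : Space d) (r : Fin d → ℝ) (x : Space d) : Space d :=
  WithLp.toLp 2 fun j => (x j - y j) / r j

/-- The constant `c` collects the factors `1 / r j`, which puts the relation into a form that can be
iterated along a word. -/
lemma momS_rescale {y : Space d} {r : Fin d → ℝ} {χ Θ : 𝓢(Space d, ℂ)} {c : ℂ}
    (h : ∀ x, χ x = c * Θ (rescale y r x)) (j : Fin d) (x : Space d) :
    momS j χ x = (c / r j) * momS j Θ (rescale y r x) := by
  let Λ : Space d →L[ℝ] Space d :=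
    (PiLp.continuousLinearEquiv 2 ℝ (fun _ : Fin d => ℝ)).symm.toContinuousLinearMap.comp
      (ContinuousLinearMap.pi fun j =>
        (r j)⁻¹ • (EuclideanSpace.proj (𝕜 := ℝ) j : Space d →L[ℝ] ℝ))
  have hΛ : ∀ x, rescale y r x = Λ x + Λ (-y) := by
    intro x
    ext j
    simp [rescale, Λ]
    ring
  have hd : HasFDerivAt (rescale y r) Λ x := by
    have : rescale y r = fun x => Λ x + Λ (-y) := funext hΛ
    rw [this]
    exact (Λ.hasFDerivAt (x := x)).add_const _
  have hχ : ⇑χ = fun x => c * Θ (rescale y r x) := funext h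
  have e : Λ (stdVec j) = (r j)⁻¹ • stdVec j := by
    ext i
    simp [Λ, stdVec_apply]
    split_ifs with hij
    · rw [hij]
    · rfl
  have hd' : HasFDerivAt (fun x => c * Θ (rescale y r x))
      (c • (fderiv ℝ Θ (rescale y r x)).comp Λ) x :=
    ((Θ.hasFDerivAt (rescale y r x)).comp x hd).const_mul c
  rw [momS_apply, momS_apply, hχ, hd'.fderiv]
  simp only [smul_apply, ContinuousLinearMap.comp_apply, e, map_smul, smul_eq_mul,
    Complex.real_smul]
  push_cast
  ring

lemma norm_momW_rescale {y : Space d} {r : Fin d → ℝ} (hr : ∀ j, 0 < r j) {χ Θ : 𝓢(Space d, ℂ)}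
    {c : ℂ} (h : ∀ x, χ x = c * Θ (rescale y r x)) (L : List (Fin d)) (x : Space d) :
    ‖momW L χ x‖ = ‖c‖ * wordProd (fun j => (r j)⁻¹) L * ‖momW L Θ (rescale y r x)‖ := by
  induction L generalizing χ Θ c with
  | nil => simp [momW, h]
  | cons j L ih =>
    rw [momW, ih (momS_rescale h j), wordProd_cons, momW, norm_div, Complex.norm_real,
      Real.norm_eq_abs, abs_of_pos (hr j)]
    ring

/-- A smooth cutoff equal to one on the box of half side `1/2` and supported in the box of half
side `1`, together with its rescaled versions. -/
theorem exists_cutoff (d q : ℕ) : ∃ M : ℝ, 0 ≤ M ∧ ∀ (y : Space d) (r : Fin d → ℝ),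
    (∀ j, 0 < r j) → ∃ χ : 𝓢(Space d, ℂ), HasCompactSupport χ ∧ (∀ x, ‖χ x‖ ≤ 1) ∧
      (∀ x ∈ box y (fun j => r j / 2), χ x = 1) ∧
      (∀ L, ∀ x ∉ box y r, momW L χ x = 0) ∧
      (∀ L ≠ [], ∀ x ∈ box y (fun j => r j / 2), momW L χ x = 0) ∧
      ∀ L ∈ wordsLE d q, ∀ x, ‖momW L χ x‖ ≤ M * wordProd (fun j => (r j)⁻¹) L := by
  -- The outer radius is below `1` so that the cutoff vanishes on a neighbourhood of the complement
  -- of the open box, and with it all derivatives.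
  let β : ContDiffBump (0 : ℝ) := ⟨1 / 2, 3 / 4, by norm_num, by norm_num⟩
  have hβ1 : ∀ s : ℝ, |s| < 1 / 2 → β s = 1 := fun s hs =>
    β.one_of_mem_closedBall (by
      rw [mem_closedBall_zero_iff, Real.norm_eq_abs]; exact hs.le)
  have hβ0 : ∀ s : ℝ, 3 / 4 ≤ |s| → β s = 0 := fun s hs =>
    β.zero_of_le_dist (by simpa using hs)
  have key : ∀ (y : Space d) (r : Fin d → ℝ), (∀ j, 0 < r j) → ∃ χ : 𝓢(Space d, ℂ),
      HasCompactSupport χ ∧ ∀ x, χ x = ((∏ j, β ((x j - y j) / r j) : ℝ) : ℂ) := by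
    intro y r hr
    have h1 : HasCompactSupport (fun x : Space d => ((∏ j, β ((x j - y j) / r j) : ℝ) : ℂ)) := by
      refine HasCompactSupport.of_support_subset_isCompact
        (K := Metric.closedBall 0 (∑ j, (|y j| + r j))) (isCompact_closedBall _ _) ?_
      intro x hx
      have hx' : ∀ j, |x j - y j| < r j := by
        intro j
        by_contra hj
        push Not at hj
        apply hx
        have : β ((x j - y j) / r j) = 0 := by
          apply hβ0
          rw [abs_div, abs_of_pos (hr j), le_div_iff₀ (hr j)]
          nlinarith [hr j]
        change ((∏ j, β ((x j - y j) / r j) : ℝ) : ℂ) = 0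
        rw [Finset.prod_eq_zero (Finset.mem_univ j) this, Complex.ofReal_zero]
      rw [mem_closedBall_zero_iff]
      refine (norm_le_sum_abs x).trans (Finset.sum_le_sum fun j _ => ?_)
      have := abs_sub_abs_le_abs_sub (x j) (y j)
      linarith [hx' j]
    have h2 : ContDiff ℝ ∞ (fun x : Space d => ((∏ j, β ((x j - y j) / r j) : ℝ) : ℂ)) := by
      have h3 : ContDiff ℝ ∞ (fun x : Space d => ∏ j, β ((x j - y j) / r j)) := by
        refine contDiff_prod fun j _ => β.contDiff.comp ?_
        exact ((EuclideanSpace.proj (𝕜 := ℝ) j : Space d →L[ℝ] ℝ).contDiff.sub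
          contDiff_const).div_const _
      exact Complex.ofRealCLM.contDiff.comp h3
    exact ⟨h1.toSchwartzMap h2, h1, fun x => rfl⟩
  obtain ⟨Θ, hΘc, hΘ⟩ := key 0 (fun _ => 1) (fun _ => one_pos)
  have hbd : ∀ L, ∃ M, ∀ x, ‖momW L Θ x‖ ≤ M := fun L =>
    ⟨_, fun x => SchwartzMap.norm_le_seminorm ℝ (momW L Θ) x⟩
  choose M hM using hbd
  have hM0 : ∀ L, 0 ≤ M L := fun L => (norm_nonneg _).trans (hM L 0)
  refine ⟨∑ L ∈ wordsLE d q, M L, Finset.sum_nonneg fun L _ => hM0 L, fun y r hr => ?_⟩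
  obtain ⟨χ, hχc, hχ⟩ := key y r hr
  have hone : ∀ x ∈ box y (fun j => r j / 2), χ x = 1 := by
    intro x hx
    rw [hχ, Finset.prod_eq_one]
    · simp
    · intro j _
      apply hβ1
      rw [abs_div, abs_of_pos (hr j), div_lt_iff₀ (hr j)]
      have := hx j
      linarith
  refine ⟨χ, hχc, fun x => ?_, hone, fun L x hx => ?_, fun L hL => ?_, fun L hL x => ?_⟩
  · rw [hχ, Complex.norm_real, Real.norm_eq_abs,
      abs_of_nonneg (Finset.prod_nonneg fun j _ => β.nonneg)]
    exact Finset.prod_le_one (fun j _ => β.nonneg) fun j _ => β.le_one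
  · have hcl : IsClosed {x : Space d | ∀ j, |x j - y j| ≤ 3 / 4 * r j} := by
      have : {x : Space d | ∀ j, |x j - y j| ≤ 3 / 4 * r j} =
          ⋂ j, {x : Space d | |x j - y j| ≤ 3 / 4 * r j} := by ext; simp
      rw [this]
      exact isClosed_iInter fun j => isClosed_le (by fun_prop) continuous_const
    refine momW_eq_zero_of_eqOn_zero hcl.isOpen_compl (fun z hz => ?_) L x fun hx' => hx fun j => ?_
    · simp only [Set.mem_compl_iff, Set.mem_ofPred_eq, not_forall, not_le] at hz
      obtain ⟨j, hj⟩ := hz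
      rw [hχ, Finset.prod_eq_zero (Finset.mem_univ j), Complex.ofReal_zero]
      apply hβ0
      rw [abs_div, abs_of_pos (hr j), le_div_iff₀ (hr j)]
      exact hj.le
    · have := hx' j
      nlinarith [hr j]
  · exact momW_eq_zero_of_eqOn (isOpen_box _ _) hone hL
  · have h1 : ∀ x, χ x = 1 * Θ (rescale y r x) := by
      intro x; rw [hχ, hΘ]; simp [rescale]
    rw [norm_momW_rescale hr h1, norm_one, one_mul, mul_comm]
    refine mul_le_mul_of_nonneg_right ?_ (wordProd_nonneg (fun j => (inv_pos.2 (hr j)).le) L)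
    exact (hM L _).trans (Finset.single_le_sum (fun L _ => hM0 L) hL)

end Cutoff

end HigherOrderSchrodinger

/-! ### Localisation to boxes -/

namespace HigherOrderSchrodinger

open MvPolynomial

variable {d : ℕ}

lemma isBounded_box (y : Space d) (r : Fin d → ℝ) : Bornology.IsBounded (box y r) := by
  refine (Metric.isBounded_closedBall (x := (0 : Space d)) (r := ∑ j, (|y j| + r j))).subset ?_
  intro x hx
  rw [mem_closedBall_zero_iff]
  refine (norm_le_sum_abs x).trans (Finset.sum_le_sum fun j _ => ?_)
  have := abs_sub_abs_le_abs_sub (x j) (y j)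
  linarith [hx j]

lemma integrableOn_box {f : Space d → ℝ} (hf : Continuous f) (y : Space d) (r : Fin d → ℝ) :
    IntegrableOn f (box y r) :=
  (hf.continuousOn.integrableOn_compact (isBounded_box y r).isCompact_closure).mono_set
    subset_closure

lemma DegLT.polyD {n : ℕ} {P : MvPolynomial (Fin d) ℝ} (h : DegLT n P) (L : List (Fin d)) :
    DegLT n (polyD L P) := by
  induction L generalizing P with
  | nil => exact h
  | cons j L ih => exact ih ((h.mono (Nat.le_succ n)).pderiv j)

lemma DegLT.add_C {n : ℕ} {P : MvPolynomial (Fin d) ℝ} (h : DegLT (n + 1) P) (c : ℝ) :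
    DegLT (n + 1) (P + C c) := by
  intro α hα
  by_cases h0 : α = 0
  · simp [h0]
  · rw [coeff_add, coeff_C, if_neg (Ne.symm h0), add_zero] at hα
    exact h α hα

lemma continuous_weight {g : Space d → ℝ} (hg : Continuous g) (u : 𝓢(Space d, ℂ)) :
    Continuous fun x => Real.exp (2 * g x) * ‖u x‖ ^ 2 := by
  have := u.continuous
  fun_prop

/-- Localisation of a global estimate for compactly supported functions to boxes. -/
theorem local_estimate {q : ℕ} {Q : MvPolynomial (Fin d) ℝ} (hQ : DegLT (q + 1) Q) :
    ∃ C : ℝ, 0 ≤ C ∧ ∀ (y : Space d) (r : Fin d → ℝ), (∀ j, 0 < r j) →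
      ∀ g : Space d → ℝ, Continuous g → ∀ c C₀ C₁ : ℝ, 0 ≤ C₀ → 0 ≤ C₁ →
      ∀ t : Fin d → ℝ, (∀ j, 0 ≤ t j) →
      (∀ v : 𝓢(Space d, ℂ), HasCompactSupport v →
        ∑ L ∈ wordsLE d q, wordProd t L * wInt g Set.univ (opS (polyD L Q) v) ≤
          C₀ * wInt g Set.univ (opS (Q + MvPolynomial.C c) v) + C₁ * wInt g Set.univ v) →
      ∀ u : 𝓢(Space d, ℂ),
        ∑ L ∈ wordsLE d q, wordProd t L *
            wInt g (box y fun j => r j / 2) (opS (polyD L Q) u) ≤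
          2 * C₀ * wInt g (box y r) (opS (Q + MvPolynomial.C c) u) + C₁ * wInt g (box y r) u +
          C₀ * C * ∑ L ∈ wordsLE d q, wordProd (fun j => (r j)⁻¹ ^ 2) L *
            wInt g (box y r) (opS (polyD L Q) u) := by
  obtain ⟨M, hM0, hM⟩ := exists_cutoff d q
  -- `M` bounds the rescaled derivatives of the cutoff, the cardinality comes from Cauchy–Schwarz
  -- over the words, and `2` from `(a + b)² ≤ 2a² + 2b²`.
  refine ⟨2 * M ^ 2 * (wordsLE d q).card, by positivity, ?_⟩
  intro y r hr g hg c C₀ C₁ hC₀ hC₁ t ht H u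
  obtain ⟨χ, hχc, hχ1, hχone, hχout, hχin, hχM⟩ := hM y r hr
  have hbox := (isOpen_box y r).measurableSet
  have hχ0 : ∀ x ∉ box y r, χ x = 0 := hχout []
  have hsupp : ∀ P, DegLT (q + 1) P → ∀ x ∉ box y r, opS P (mulS χ u) x = 0 := by
    intro P hP x hx
    have h := norm_opS_mulS_sub_le hP χ u x
    rw [Finset.sum_eq_zero fun L _ => by rw [hχout L x hx, norm_zero, zero_mul], hχ0 x hx,
      zero_mul, sub_zero] at h
    exact norm_le_zero_iff.1 h
  have hint : ∀ (w : 𝓢(Space d, ℂ)), IntegrableOn (fun x => Real.exp (2 * g x) * ‖w x‖ ^ 2)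
      (box y r) := fun w => integrableOn_box (continuous_weight hg w) y r
  have huniv : ∀ w : 𝓢(Space d, ℂ), (∀ x ∉ box y r, w x = 0) →
      wInt g Set.univ w = wInt g (box y r) w := by
    intro w hw
    rw [wInt, wInt, setIntegral_univ]
    refine (setIntegral_eq_integral_of_forall_compl_eq_zero fun x hx => ?_).symm
    simp [hw x hx]
  have hv0 : ∀ x ∉ box y r, mulS χ u x = 0 := fun x hx => by rw [mulS_apply, hχ0 x hx, zero_mul]
  have hvc : HasCompactSupport (mulS χ u) := by
    have : ⇑(mulS χ u) = fun x => χ x * u x := funext (mulS_apply χ u)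
    rw [this]
    exact hχc.mul_right
  have hsmall : box y (fun j => r j / 2) ⊆ box y r := fun x hx j =>
    (hx j).trans (by linarith [hr j])
  have h1 : ∀ L ∈ wordsLE d q, wInt g (box y fun j => r j / 2) (opS (polyD L Q) u) ≤
      wInt g Set.univ (opS (polyD L Q) (mulS χ u)) := by
    intro L _
    rw [huniv _ (hsupp _ (hQ.polyD L))]
    have e : wInt g (box y fun j => r j / 2) (opS (polyD L Q) u) =
        wInt g (box y fun j => r j / 2) (opS (polyD L Q) (mulS χ u)) := by
      refine setIntegral_congr_fun (isOpen_box _ _).measurableSet fun x hx => ?_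
      have h := norm_opS_mulS_sub_le (hQ.polyD L) χ u x
      rw [Finset.sum_eq_zero fun L' hL' => by
        rw [hχin L' (by rintro rfl; simp [mem_wordsLE] at hL') x hx, norm_zero, zero_mul],
        hχone x hx, one_mul] at h
      have h' := sub_eq_zero.1 (norm_le_zero_iff.1 h)
      simp only [h']
    rw [e]
    exact setIntegral_mono_set (hint _) (Eventually.of_forall fun x => by positivity)
      (Eventually.of_forall hsmall)
  have h2 : wInt g Set.univ (mulS χ u) ≤ wInt g (box y r) u := by
    rw [huniv _ hv0]
    refine setIntegral_mono_on (hint _) (hint _) hbox fun x _ => ?_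
    rw [mulS_apply, norm_mul]
    have := mul_le_of_le_one_left (norm_nonneg (u x)) (hχ1 x)
    gcongr
  have h3 : wInt g Set.univ (opS (Q + MvPolynomial.C c) (mulS χ u)) ≤
      2 * wInt g (box y r) (opS (Q + MvPolynomial.C c) u) +
        2 * M ^ 2 * (wordsLE d q).card * ∑ L ∈ wordsLE d q, wordProd (fun j => (r j)⁻¹ ^ 2) L *
          wInt g (box y r) (opS (polyD L Q) u) := by
    rw [huniv _ (hsupp _ (hQ.add_C c))]
    have e : 2 * wInt g (box y r) (opS (Q + MvPolynomial.C c) u) +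
        2 * M ^ 2 * (wordsLE d q).card * ∑ L ∈ wordsLE d q, wordProd (fun j => (r j)⁻¹ ^ 2) L *
          wInt g (box y r) (opS (polyD L Q) u) =
        ∫ x in box y r, (2 * (Real.exp (2 * g x) * ‖opS (Q + MvPolynomial.C c) u x‖ ^ 2) +
          2 * M ^ 2 * (wordsLE d q).card * ∑ L ∈ wordsLE d q, wordProd (fun j => (r j)⁻¹ ^ 2) L *
            (Real.exp (2 * g x) * ‖opS (polyD L Q) u x‖ ^ 2)) := by
      rw [integral_add ((hint _).const_mul _) ((integrable_finsetSum _ fun L _ =>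
        (hint _).const_mul _).const_mul _), integral_const_mul, integral_const_mul,
        integral_finsetSum _ fun L _ => (hint _).const_mul _]
      simp only [integral_const_mul]
      rfl
    rw [e]
    refine setIntegral_mono_on (hint _) (((hint _).const_mul _).add ((integrable_finsetSum _
      fun L _ => (hint _).const_mul _).const_mul _)) hbox fun x _ => ?_
    have h := norm_opS_mulS_sub_le (hQ.add_C c) χ u x
    set a := opS (Q + MvPolynomial.C c) (mulS χ u) x
    set b := opS (Q + MvPolynomial.C c) u x
    have hb : ‖χ x * b‖ ≤ ‖b‖ := by
      rw [norm_mul]; exact mul_le_of_le_one_left (norm_nonneg _) (hχ1 x)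
    have hS : ‖a - χ x * b‖ ^ 2 ≤ M ^ 2 * (wordsLE d q).card *
        ∑ L ∈ wordsLE d q, wordProd (fun j => (r j)⁻¹ ^ 2) L * ‖opS (polyD L Q) u x‖ ^ 2 := by
      have h' : ‖a - χ x * b‖ ≤ ∑ L ∈ wordsLE d q,
          M * wordProd (fun j => (r j)⁻¹) L * ‖opS (polyD L Q) u x‖ := by
        refine h.trans (Finset.sum_le_sum fun L hL => ?_)
        rw [polyD_add_C (by rintro rfl; simp [mem_wordsLE] at hL)]
        exact mul_le_mul_of_nonneg_right (hχM L hL x) (norm_nonneg _)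
      calc ‖a - χ x * b‖ ^ 2 ≤ (∑ L ∈ wordsLE d q,
          M * wordProd (fun j => (r j)⁻¹) L * ‖opS (polyD L Q) u x‖) ^ 2 := by gcongr
        _ ≤ (wordsLE d q).card * ∑ L ∈ wordsLE d q,
          (M * wordProd (fun j => (r j)⁻¹) L * ‖opS (polyD L Q) u x‖) ^ 2 :=
            sq_sum_le_card_mul_sum_sq
        _ = _ := by
          rw [Finset.mul_sum, Finset.mul_sum]
          refine Finset.sum_congr rfl fun L _ => ?_
          have : wordProd (fun j => (r j)⁻¹ ^ 2) L = wordProd (fun j => (r j)⁻¹) L ^ 2 := by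
            simp only [sq]; exact wordProd_mul _ _ L
          rw [this]; ring
    have ha : ‖a‖ ^ 2 ≤ 2 * ‖b‖ ^ 2 + 2 * ‖a - χ x * b‖ ^ 2 := by
      have h5 : ‖a‖ ≤ ‖b‖ + ‖a - χ x * b‖ := by
        calc ‖a‖ = ‖χ x * b + (a - χ x * b)‖ := by congr 1; ring
          _ ≤ ‖χ x * b‖ + ‖a - χ x * b‖ := norm_add_le _ _
          _ ≤ _ := by gcongr
      nlinarith [norm_nonneg a, norm_nonneg b, norm_nonneg (a - χ x * b),
        sq_nonneg (‖b‖ - ‖a - χ x * b‖)]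
    have hE := Real.exp_pos (2 * g x)
    calc Real.exp (2 * g x) * ‖a‖ ^ 2
        ≤ Real.exp (2 * g x) * (2 * ‖b‖ ^ 2 + 2 * (M ^ 2 * (wordsLE d q).card *
        ∑ L ∈ wordsLE d q, wordProd (fun j => (r j)⁻¹ ^ 2) L * ‖opS (polyD L Q) u x‖ ^ 2)) := by
          gcongr; linarith
      _ = _ := by
        simp only [Finset.mul_sum, mul_add]
        congr 1
        · ring
        · refine Finset.sum_congr rfl fun L _ => ?_
          ring
  calc _ ≤ ∑ L ∈ wordsLE d q, wordProd t L * wInt g Set.univ (opS (polyD L Q) (mulS χ u)) :=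
        Finset.sum_le_sum fun L hL => mul_le_mul_of_nonneg_left (h1 L hL) (wordProd_nonneg ht L)
    _ ≤ _ := H _ hvc
    _ ≤ C₀ * (2 * wInt g (box y r) (opS (Q + MvPolynomial.C c) u) +
        2 * M ^ 2 * (wordsLE d q).card * ∑ L ∈ wordsLE d q, wordProd (fun j => (r j)⁻¹ ^ 2) L *
          wInt g (box y r) (opS (polyD L Q) u)) + C₁ * wInt g (box y r) u := by gcongr
    _ = _ := by ring

end HigherOrderSchrodinger

namespace HigherOrderSchrodinger

open MvPolynomial
open scoped FourierTransform

variable {d : ℕ}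

/-! ### Elliptic polynomials -/

section Elliptic

lemma degLT_totalDegree (P : MvPolynomial (Fin d) ℝ) : DegLT (P.totalDegree + 1) P := by
  intro α hα
  have := le_totalDegree (mem_support_iff.2 hα)
  rw [Nat.lt_succ_iff]
  simpa [Finsupp.degree_eq_sum, Finsupp.sum_fintype] using this

lemma DegLT.polyD_length {n : ℕ} (L : List (Fin d)) {P : MvPolynomial (Fin d) ℝ}
    (h : DegLT (n + L.length) P) : DegLT n (HigherOrderSchrodinger.polyD L P) := by
  induction L generalizing P with
  | nil => exact h
  | cons j L ih => exact ih (DegLT.pderiv (n := n + L.length) h j)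

lemma coeff_polyD_replicate_ne_zero (j : Fin d) (k m : ℕ) {P : MvPolynomial (Fin d) ℝ}
    (h : P.coeff (Finsupp.single j (m + k)) ≠ 0) :
    (polyD (List.replicate k j) P).coeff (Finsupp.single j m) ≠ 0 := by
  induction k generalizing P with
  | zero => simpa [polyD] using h
  | succ k ih =>
    rw [List.replicate_succ, polyD]
    apply ih
    rw [coeff_pderiv, ← Finsupp.single_add]
    refine mul_ne_zero h ?_
    positivity

/-- At the `j`-th basis vector the principal part reduces to this single coefficient. -/
lemma IsElliptic.coeff_ne_zero {Q : MvPolynomial (Fin d) ℝ} (hQ : IsElliptic Q) (j : Fin d) :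
    Q.coeff (Finsupp.single j Q.totalDegree) ≠ 0 := by
  classical
  have h := hQ (Pi.single j 1) (by simp)
  intro h0
  apply h
  rw [eval_eq']
  refine Finset.sum_eq_zero fun α hα => ?_
  rw [mem_support_iff, coeff_homogeneousComponent] at hα
  by_cases hs : ∃ i, i ≠ j ∧ α i ≠ 0
  · obtain ⟨i, hij, hi⟩ := hs
    rw [Finset.prod_eq_zero (Finset.mem_univ i), mul_zero]
    simp [hij, hi]
  · push Not at hs
    have hα' : α = Finsupp.single j (α j) := by
      ext i
      by_cases hij : i = j
      · subst hij; simp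
      · rw [hs i hij, Finsupp.single_apply, if_neg (Ne.symm hij)]
    have hdeg : α.degree = Q.totalDegree := by
      by_contra hne
      exact hα (if_neg hne)
    rw [hα', Finsupp.degree_single] at hdeg
    rw [hα', hdeg, coeff_homogeneousComponent, Finsupp.degree_single, if_pos rfl, h0, zero_mul]

/-- The `q`-th derivative of an elliptic polynomial of degree `q` in a coordinate direction is a
nonzero constant. -/
lemma IsElliptic.polyD_replicate {Q : MvPolynomial (Fin d) ℝ} (hQ : IsElliptic Q) (j : Fin d) :
    ∃ c : ℝ, c ≠ 0 ∧ polyD (List.replicate Q.totalDegree j) Q = C c := by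
  have h1 := coeff_polyD_replicate_ne_zero j Q.totalDegree 0 (by
    rw [zero_add]; exact hQ.coeff_ne_zero j)
  rw [Finsupp.single_zero] at h1
  refine ⟨_, h1, ?_⟩
  have h2 : DegLT 1 (polyD (List.replicate Q.totalDegree j) Q) :=
    DegLT.polyD_length _ (by
      rw [List.length_replicate, add_comm]; exact degLT_totalDegree Q)
  ext α
  rw [coeff_C]
  split_ifs with h
  · rw [← h]
  · by_contra hne
    have := h2 α hne
    rw [Nat.lt_one_iff, Finsupp.degree_eq_zero_iff] at this
    exact h this.symm

lemma DegLT.isLittleO {q : ℕ} {P : MvPolynomial (Fin d) ℝ} (hP : DegLT q P) :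
    (fun ξ : Fin d → ℝ => eval ξ P) =o[Bornology.cobounded (Fin d → ℝ)] fun ξ => ‖ξ‖ ^ q := by
  simp only [eval_eq']
  refine IsLittleO.fun_sum fun α hα => IsLittleO.const_mul_left ?_ _
  have h1 : (fun ξ : Fin d → ℝ => ∏ i, ξ i ^ α i) =O[Bornology.cobounded (Fin d → ℝ)]
      fun ξ => ‖ξ‖ ^ α.degree := by
    refine IsBigO.of_bound 1 (Eventually.of_forall fun ξ => ?_)
    rw [norm_prod, one_mul, norm_pow, norm_norm, Finsupp.degree_eq_sum,
      ← Finset.prod_pow_eq_pow_sum]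
    refine Finset.prod_le_prod (fun i _ => norm_nonneg _) fun i _ => ?_
    rw [norm_pow]
    exact pow_le_pow_left₀ (norm_nonneg _) (norm_le_pi_norm ξ i) _
  exact h1.trans_isLittleO
    ((isLittleO_pow_pow_atTop_of_lt (hP α (mem_support_iff.1 hα))).comp_tendsto
      tendsto_norm_cobounded_atTop)

lemma eval_smul_homogeneousComponent (Q : MvPolynomial (Fin d) ℝ) (q : ℕ) (s : ℝ)
    (η : Fin d → ℝ) : eval (s • η) (homogeneousComponent q Q) =
      s ^ q * eval η (homogeneousComponent q Q) := by
  rw [eval_eq', eval_eq', Finset.mul_sum]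
  refine Finset.sum_congr rfl fun α hα => ?_
  rw [mem_support_iff, coeff_homogeneousComponent] at hα
  have hdeg : α.degree = q := by
    by_contra hne
    exact hα (if_neg hne)
  simp only [Pi.smul_apply, smul_eq_mul, mul_pow, Finset.prod_mul_distrib]
  rw [Finset.prod_pow_eq_pow_sum, ← Finsupp.degree_eq_sum, hdeg]
  ring

/-- Compactness of the unit sphere and homogeneity bound the principal part from below; the
remaining terms have lower degree and are negligible at infinity. -/
lemma IsElliptic.isBigO {Q : MvPolynomial (Fin d) ℝ} (hQ : IsElliptic Q) :
    (fun ξ : Fin d → ℝ => ‖ξ‖ ^ Q.totalDegree) =O[Bornology.cobounded (Fin d → ℝ)]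
      fun ξ => eval ξ Q := by
  set q := Q.totalDegree with hq
  set Qh := homogeneousComponent q Q with hQh
  have hcont : Continuous fun ξ : Fin d → ℝ => |eval ξ Qh| := (continuous_eval Qh).abs
  have hlow : ∃ c > 0, ∀ ξ : Fin d → ℝ, ‖ξ‖ = 1 → c ≤ |eval ξ Qh| := by
    by_cases hne : (Metric.sphere (0 : Fin d → ℝ) 1).Nonempty
    · obtain ⟨ξ₀, hξ₀, hmin⟩ := (isCompact_sphere (0 : Fin d → ℝ) 1).exists_isMinOn hne
        hcont.continuousOn
      refine ⟨|eval ξ₀ Qh|, abs_pos.2 (hQ ξ₀ ?_), fun ξ hξ => hmin (by simpa using hξ)⟩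
      rintro rfl
      simp at hξ₀
    -- The sphere is empty only in dimension zero.
    · refine ⟨1, one_pos, fun ξ hξ => absurd ⟨ξ, by simpa using hξ⟩ hne⟩
  obtain ⟨c, hc, hlow⟩ := hlow
  have h1 : (fun ξ : Fin d → ℝ => ‖ξ‖ ^ q) =O[Bornology.cobounded (Fin d → ℝ)]
      fun ξ => eval ξ Qh := by
    refine IsBigO.of_bound c⁻¹ ?_
    filter_upwards [tendsto_norm_cobounded_atTop.eventually (eventually_gt_atTop (0 : ℝ))] with ξ hξ
    have h2 := hlow (‖ξ‖⁻¹ • ξ) (by rw [norm_smul, norm_inv, norm_norm, inv_mul_cancel₀ hξ.ne'])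
    have h3 : eval ξ Qh = ‖ξ‖ ^ q * eval (‖ξ‖⁻¹ • ξ) Qh := by
      rw [← eval_smul_homogeneousComponent, smul_smul, mul_inv_cancel₀ hξ.ne', one_smul]
    rw [h3, norm_mul, norm_pow, norm_norm, Real.norm_eq_abs]
    rw [inv_mul_eq_div, le_div_iff₀ hc]
    exact mul_le_mul_of_nonneg_left h2 (by positivity)
  have h2 : DegLT q (Q - Qh) := by
    intro α hα
    rw [coeff_sub, hQh, coeff_homogeneousComponent] at hα
    have h3 := degLT_totalDegree Q α
    by_cases h4 : α.degree = q
    · rw [if_pos h4, sub_self] at hα; exact absurd rfl hα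
    · rw [if_neg h4, sub_zero] at hα
      have := h3 hα
      omega
  have h3 : (fun ξ : Fin d → ℝ => eval ξ (Q - Qh)) =o[Bornology.cobounded (Fin d → ℝ)]
      fun ξ => eval ξ Qh := h2.isLittleO.trans_isBigO h1
  have h4 := h1.trans h3.right_isBigO_add
  refine h4.congr_right fun ξ => ?_
  simp

/-- Polynomials of lower degree are dominated by an elliptic polynomial. -/
lemma IsElliptic.exists_bound {Q : MvPolynomial (Fin d) ℝ} (hQ : IsElliptic Q)
    {P : MvPolynomial (Fin d) ℝ} (hP : DegLT Q.totalDegree P) {A : ℝ} (hA : 0 < A) :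
    ∃ C : ℝ, 0 ≤ C ∧ ∀ ξ : Fin d → ℝ, A * eval ξ P ^ 2 ≤ eval ξ Q ^ 2 + C := by
  have h := hP.isLittleO.trans_isBigO hQ.isBigO
  have h1 := h.def (c := (Real.sqrt A)⁻¹) (by positivity)
  obtain ⟨R, -, hR⟩ := (Filter.hasBasis_cobounded_norm (E := Fin d → ℝ)).eventually_iff.1 h1
  have hcont : Continuous fun ξ : Fin d → ℝ => A * eval ξ P ^ 2 :=
    continuous_const.mul ((continuous_eval P).pow 2)
  obtain ⟨C, hC⟩ := (isCompact_closedBall (0 : Fin d → ℝ) R).bddAbove_image hcont.continuousOn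
  refine ⟨max C 0, le_max_right _ _, fun ξ => ?_⟩
  by_cases hξ : ‖ξ‖ ≤ R
  · have := hC ⟨ξ, by simpa using hξ, rfl⟩
    have h2 := le_max_left C 0
    have h3 := sq_nonneg (eval ξ Q)
    simp only at this
    linarith
  · have h2 := hR (show ξ ∈ {x | R ≤ ‖x‖} from (not_le.1 hξ).le)
    rw [Real.norm_eq_abs, Real.norm_eq_abs] at h2
    have h3 : A * eval ξ P ^ 2 ≤ eval ξ Q ^ 2 := by
      rw [← sq_abs (eval ξ P), ← sq_abs (eval ξ Q)]
      have hA' : 0 < Real.sqrt A := Real.sqrt_pos.2 hA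
      have h4 : Real.sqrt A * |eval ξ P| ≤ |eval ξ Q| := by
        rw [inv_mul_eq_div, le_div_iff₀ hA'] at h2
        linarith
      calc A * |eval ξ P| ^ 2 = (Real.sqrt A * |eval ξ P|) ^ 2 := by
            rw [mul_pow, Real.sq_sqrt hA.le]
        _ ≤ _ := by gcongr
    linarith [le_max_right C 0]

end Elliptic

/-! ### Elliptic estimates through the Fourier transform -/

section Fourier

lemma fourier_momS (j : Fin d) (u : 𝓢(Space d, ℂ)) (ξ : Space d) :
    𝓕 (momS j u) ξ = ((2 * Real.pi * ξ j : ℝ) : ℂ) * 𝓕 u ξ := by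
  have h1 : 𝓕 (momS j u) = (-Complex.I) • 𝓕 (∂_{stdVec j} u) :=
    FourierTransform.fourier_smul (-Complex.I) (∂_{stdVec j} u)
  have h2 : Function.HasTemperateGrowth (fun x : Space d => inner ℝ x (stdVec j)) :=
    Function.hasTemperateGrowth_inner_left _
  rw [h1, SchwartzMap.fourier_lineDerivOp_eq, smul_apply, smul_apply,
    SchwartzMap.smulLeftCLM_apply_apply h2]
  have h3 : inner ℝ ξ (stdVec j) = ξ j := by
    rw [stdVec, EuclideanSpace.inner_single_right]; simp
  rw [h3]
  simp only [smul_eq_mul, Complex.real_smul]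
  push_cast
  linear_combination (-(2 * Real.pi * ξ j) * 𝓕 u ξ : ℂ) * Complex.I_mul_I

lemma fourier_opS (P : MvPolynomial (Fin d) ℝ) (u : 𝓢(Space d, ℂ)) (ξ : Space d) :
    𝓕 (opS P u) ξ = (eval (fun j => 2 * Real.pi * ξ j) P : ℝ) * 𝓕 u ξ := by
  induction P using MvPolynomial.induction_on generalizing u with
  | C c =>
    rw [opS_C, eval_C]
    have : 𝓕 (c • u) = c • 𝓕 u := FourierTransform.fourier_smul _ _
    rw [this, smul_apply, Complex.real_smul]
  | add P R hP hR =>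
    have : 𝓕 (opS P u + opS R u) = 𝓕 (opS P u) + 𝓕 (opS R u) := FourierTransform.fourier_add _ _
    rw [map_add, LinearMap.add_apply, this, add_apply, hP, hR, map_add]
    push_cast
    ring
  | mul_X P j hP =>
    rw [map_mul, Module.End.mul_apply, hP, opS_X, fourier_momS, map_mul, eval_X]
    push_cast
    ring

lemma norm_opS_sq (P : MvPolynomial (Fin d) ℝ) (u : 𝓢(Space d, ℂ)) :
    ‖toL2 (opS P u)‖ ^ 2 =
      ∫ ξ, eval (fun j => 2 * Real.pi * ξ j) P ^ 2 * ‖𝓕 u ξ‖ ^ 2 := by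
  rw [norm_toL2_sq, ← SchwartzMap.integral_norm_sq_fourier]
  congr 1
  funext ξ
  rw [fourier_opS, norm_mul, mul_pow, Complex.norm_real, Real.norm_eq_abs, sq_abs]

lemma integrable_norm_sq (u : 𝓢(Space d, ℂ)) : Integrable fun x => ‖u x‖ ^ 2 :=
  (memLp_two_iff_integrable_sq_norm u.continuous.aestronglyMeasurable).1 (u.memLp 2)

lemma integrable_eval_sq_mul (P : MvPolynomial (Fin d) ℝ) (u : 𝓢(Space d, ℂ)) :
    Integrable fun ξ : Space d => eval (fun j => 2 * Real.pi * ξ j) P ^ 2 * ‖𝓕 u ξ‖ ^ 2 := by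
  refine (integrable_norm_sq (𝓕 (opS P u))).congr (Eventually.of_forall fun ξ => ?_)
  simp only
  rw [fourier_opS, norm_mul, mul_pow, Complex.norm_real, Real.norm_eq_abs, sq_abs]

/-- By Plancherel this is the pointwise comparison of the symbols. The freedom in `A` will absorb
the errors made by cutoffs. -/
lemma IsElliptic.norm_le {Q : MvPolynomial (Fin d) ℝ} (hQ : IsElliptic Q)
    {P : MvPolynomial (Fin d) ℝ} (hP : DegLT Q.totalDegree P) {A : ℝ} (hA : 0 < A) :
    ∃ C : ℝ, 0 ≤ C ∧ ∀ u : 𝓢(Space d, ℂ),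
      A * ‖toL2 (opS P u)‖ ^ 2 ≤ ‖toL2 (opS Q u)‖ ^ 2 + C * ‖toL2 u‖ ^ 2 := by
  obtain ⟨C, hC, h⟩ := hQ.exists_bound hP hA
  refine ⟨C, hC, fun u => ?_⟩
  rw [norm_opS_sq, norm_opS_sq, norm_toL2_sq, ← SchwartzMap.integral_norm_sq_fourier,
    ← integral_const_mul, ← integral_const_mul,
    ← integral_add (integrable_eval_sq_mul Q u) ((integrable_norm_sq _).const_mul C)]
  refine integral_mono ((integrable_eval_sq_mul P u).const_mul A)
    ((integrable_eval_sq_mul Q u).add ((integrable_norm_sq _).const_mul C)) fun ξ => ?_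
  have := mul_le_mul_of_nonneg_right (h fun j => 2 * Real.pi * ξ j) (sq_nonneg ‖𝓕 u ξ‖)
  simp only
  linarith

lemma wInt_zero_univ (u : 𝓢(Space d, ℂ)) : wInt (fun _ => 0) Set.univ u = ‖toL2 u‖ ^ 2 := by
  simp [wInt, norm_toL2_sq]

/-- The global elliptic estimate with a large parameter. -/
theorem IsElliptic.global_estimate {Q : MvPolynomial (Fin d) ℝ} (hQ : IsElliptic Q)
    {τ : ℝ} (hτ : 0 < τ) :
    ∃ C₁ : ℝ, 0 ≤ C₁ ∧ ∀ v : 𝓢(Space d, ℂ),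
      ∑ L ∈ wordsLE d Q.totalDegree, wordProd (fun _ => τ) L *
          wInt (fun _ => 0) Set.univ (opS (polyD L Q) v) ≤
        1 * wInt (fun _ => 0) Set.univ (opS Q v) + C₁ * wInt (fun _ => 0) Set.univ v := by
  set W := wordsLE d Q.totalDegree
  -- The factor `W.card` is included in advance, so that summing over `W` still leaves coefficient
  -- one in front of `‖Q(p) u‖²`.
  have h : ∀ L ∈ W, ∃ C : ℝ, 0 ≤ C ∧ ∀ u : 𝓢(Space d, ℂ),
      (W.card * τ ^ L.length) * ‖toL2 (opS (polyD L Q) u)‖ ^ 2 ≤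
        ‖toL2 (opS Q u)‖ ^ 2 + C * ‖toL2 u‖ ^ 2 := by
    intro L hL
    refine hQ.norm_le (DegLT.polyD_length L ((degLT_totalDegree Q).mono ?_)) ?_
    · have := (mem_wordsLE.1 hL).1; omega
    · have : 0 < W.card := Finset.card_pos.2 ⟨L, hL⟩
      positivity
  choose! C hC0 hC using h
  refine ⟨∑ L ∈ W, C L, Finset.sum_nonneg hC0, fun v => ?_⟩
  simp only [wInt_zero_univ, wordProd_const, one_mul]
  rcases W.eq_empty_or_nonempty with hW | hW
  · simp [hW]
  have hcard : (0 : ℝ) < W.card := by exact_mod_cast hW.card_pos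
  have hsum := Finset.sum_le_sum fun L hL => hC L hL v
  simp only [Finset.sum_add_distrib, Finset.sum_const, nsmul_eq_mul, mul_assoc, ← Finset.mul_sum,
    ← Finset.sum_mul] at hsum
  have hcard1 : (1 : ℝ) ≤ W.card := by exact_mod_cast hW.card_pos
  have hnn : 0 ≤ (∑ L ∈ W, C L) * ‖toL2 v‖ ^ 2 :=
    mul_nonneg (Finset.sum_nonneg hC0) (sq_nonneg _)
  refine le_of_mul_le_mul_left (hsum.trans ?_) hcard
  rw [mul_add]
  nlinarith

end Fourier

end HigherOrderSchrodinger

namespace HigherOrderSchrodinger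

open MvPolynomial
open scoped FourierTransform

variable {d : ℕ}

/-! ### From tempered distributions to the weak form in L² -/

section Duality

/-- Complex conjugation of Schwartz functions. -/
noncomputable def conjS (u : 𝓢(Space d, ℂ)) : 𝓢(Space d, ℂ) :=
  SchwartzMap.postcompCLM (𝕜 := ℝ) (Complex.conjCLE : ℂ →L[ℝ] ℂ) u

lemma conjS_apply (u : 𝓢(Space d, ℂ)) (x : Space d) : conjS u x = starRingEnd ℂ (u x) := rfl

/-- Testing against conjugates turns the bilinear pairing into the inner product. The sign from the
distributional derivative and the one from conjugating `-i` cancel, as symmetry of the momentum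
requires. -/
lemma momentum_conjS (j : Fin d) (T : 𝓢'(Space d, ℂ)) (w : 𝓢(Space d, ℂ)) :
    momentum j T (conjS w) = T (conjS (momS j w)) := by
  have h : conjS (momS j w) = (-Complex.I) • (-∂_{stdVec j} (conjS w)) := by
    ext x
    have hd : HasFDerivAt (conjS w) ((Complex.conjCLE : ℂ →L[ℝ] ℂ).comp (fderiv ℝ w x)) x :=
      (Complex.conjCLE : ℂ →L[ℝ] ℂ).hasFDerivAt.comp x (w.hasFDerivAt x)
    rw [conjS_apply, momS_apply, smul_apply, neg_apply,
      SchwartzMap.lineDerivOp_apply_eq_fderiv, hd.fderiv]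
    simp
  rw [h, map_smul, ← TemperedDistribution.lineDerivOp_apply_apply]
  rfl

lemma momentum_pow_conjS (j : Fin d) (n : ℕ) (T : 𝓢'(Space d, ℂ)) (w : 𝓢(Space d, ℂ)) :
    (momentum j ^ n) T (conjS w) = T (conjS (opS (X j ^ n) w)) := by
  induction n generalizing w with
  | zero => simp
  | succ n ih =>
    have e : (momentum (d := d) j ^ (n + 1)) T = momentum j ((momentum j ^ n) T) := by
      rw [pow_succ']; rfl
    rw [e, momentum_conjS, ih, pow_succ, map_mul, Module.End.mul_apply, opS_X]

lemma list_prod_momentum_conjS (α : Fin d → ℕ) (l : List (Fin d)) (T : 𝓢'(Space d, ℂ))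
    (w : 𝓢(Space d, ℂ)) :
    (l.map fun j => momentum j ^ α j).prod T (conjS w) =
      T (conjS (opS (l.map fun j => X j ^ α j).prod w)) := by
  induction l generalizing w with
  | nil => simp
  | cons j l ih =>
    have e : ((j :: l).map fun j => momentum (d := d) j ^ α j).prod T =
        (momentum j ^ α j) ((l.map fun j => momentum j ^ α j).prod T) := by
      rw [List.map_cons, List.prod_cons]; rfl
    rw [e, momentum_pow_conjS, ih, List.map_cons, List.prod_cons, mul_comm, map_mul,
      Module.End.mul_apply]

lemma polyMomentum_conjS (Q : MvPolynomial (Fin d) ℝ) (T : 𝓢'(Space d, ℂ))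
    (w : 𝓢(Space d, ℂ)) :
    polyMomentum Q T (conjS w) = T (conjS (opS Q w)) := by
  have h1 : ∀ α : Fin d →₀ ℕ, momentumPow α T (conjS w) = T (conjS (opS (monomial α 1) w)) := by
    intro α
    rw [momentumPow, List.ofFn_eq_map, list_prod_momentum_conjS, ← List.ofFn_eq_map, List.prod_ofFn,
      monomial_eq, C_1, one_mul, Finsupp.prod_fintype]
    intro i; simp
  have h2 : conjS (opS Q w) = ∑ α ∈ Q.support, ((Q.coeff α : ℝ) : ℂ) •
      conjS (opS (monomial α 1) w) := by
    ext x
    conv_lhs => rw [Q.as_sum]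
    have e : ∀ α, monomial α (Q.coeff α) = Q.coeff α • monomial α (1 : ℝ) := by
      intro α; rw [smul_monomial, smul_eq_mul, mul_one]
    simp only [e, map_sum, map_smul, conjS_apply, LinearMap.sum_apply, sum_apply,
      LinearMap.smul_apply, smul_apply]
    simp
  rw [h2, map_sum]
  simp only [map_smul, ← h1]
  simp [polyMomentum]

lemma toTemperedDistribution_conjS (φ : L2 d) (w : 𝓢(Space d, ℂ)) :
    Lp.toTemperedDistribution φ (conjS w) = inner ℂ (toL2 w) φ := by
  rw [Lp.toTemperedDistribution_apply, L2.inner_def]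
  refine integral_congr_ae ?_
  filter_upwards [w.coeFn_toLp 2 volume] with x hx
  rw [toL2_apply, hx, RCLike.inner_apply, conjS_apply, smul_eq_mul, mul_comm]

/-- The weak form of `Q(p) φ = ψ`. -/
lemma inner_eq_of_polyMomentum {Q : MvPolynomial (Fin d) ℝ} {φ ψ : L2 d}
    (h : Lp.toTemperedDistribution ψ = polyMomentum Q (Lp.toTemperedDistribution φ))
    (w : 𝓢(Space d, ℂ)) : inner ℂ (toL2 w) ψ = inner ℂ (toL2 (opS Q w)) φ := by
  rw [← toTemperedDistribution_conjS, h, polyMomentum_conjS, toTemperedDistribution_conjS]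

end Duality

/-! ### Schwartz functions as a core, and elliptic regularity -/

section Approximation

lemma opS_symm (P : MvPolynomial (Fin d) ℝ) (u v : 𝓢(Space d, ℂ)) :
    inner ℂ (toL2 (opS P u)) (toL2 v) = inner ℂ (toL2 u) (toL2 (opS P v)) :=
  inner_aeval_eq (ι := toL2) (fun j u v => by rw [opS_X]; exact momS_symm j u v) P u v

/-- Symmetry of `P(p)` makes `⟨P(p) u, u⟩` real, so the cross term has real part zero. -/
lemma norm_opS_add_I_sq (P : MvPolynomial (Fin d) ℝ) (u : 𝓢(Space d, ℂ)) :
    ‖toL2 (opS P u + Complex.I • u)‖ ^ 2 = ‖toL2 (opS P u)‖ ^ 2 + ‖toL2 u‖ ^ 2 := by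
  rw [map_add, map_smul, norm_add_sq (𝕜 := ℂ), norm_smul, Complex.norm_I, one_mul,
    inner_smul_right]
  have h : (inner ℂ (toL2 (opS P u)) (toL2 u)).im = 0 := by
    rw [← Complex.conj_eq_iff_im, inner_conj_symm, opS_symm]
  simp [h]

/-- The range of `P(p) + c` on Schwartz functions is dense in `L²` for nonreal `c`. -/
lemma exists_opS_add_smul_near (P : MvPolynomial (Fin d) ℝ) {c : ℂ} (hc : c.im ≠ 0) (F : L2 d)
    {ε : ℝ} (hε : 0 < ε) : ∃ u : 𝓢(Space d, ℂ), ‖F - toL2 (opS P u + c • u)‖ < ε := by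
  obtain ⟨f, hf⟩ : ∃ f : 𝓢(Space d, ℂ), ‖F - toL2 f‖ < ε / 2 := by
    obtain ⟨f, hf⟩ := (SchwartzMap.denseRange_toLpCLM (F := ℂ) (p := 2)
      (μ := (volume : Measure (Space d))) (by norm_num)).exists_dist_lt F (half_pos hε)
    exact ⟨f, by rw [dist_eq_norm] at hf; exact hf⟩
  -- On the Fourier side a smooth compactly supported approximant can be divided by the symbol,
  -- which has no zero because its imaginary part is that of `c`.
  obtain ⟨G, hG1, hG2, hG3⟩ := MemLp.exist_eLpNorm_sub_le (p := 2) (by norm_num) (by norm_num)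
    ((𝓕 f).memLp 2 volume) (show 0 < ε / 4 by linarith)
  have hne : ∀ ξ : Space d, ((eval (fun j => 2 * Real.pi * ξ j) P : ℝ) : ℂ) + c ≠ 0 := by
    intro ξ h
    apply hc
    simpa using congrArg Complex.im h
  have hev : ContDiff ℝ ∞ fun ξ : Space d => eval (fun j => 2 * Real.pi * ξ j) P := by
    simp only [eval_eq']
    refine ContDiff.sum fun α _ => contDiff_const.mul (contDiff_prod fun i _ => ?_)
    exact (contDiff_const.mul
      (EuclideanSpace.proj (𝕜 := ℝ) i : Space d →L[ℝ] ℝ).contDiff).pow _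
  have hG4 : HasCompactSupport fun ξ : Space d =>
      (((eval (fun j => 2 * Real.pi * ξ j) P : ℝ) : ℂ) + c)⁻¹ * G ξ := hG1.mul_left
  have hG5 : ContDiff ℝ ∞ fun ξ : Space d =>
      (((eval (fun j => 2 * Real.pi * ξ j) P : ℝ) : ℂ) + c)⁻¹ * G ξ :=
    (((Complex.ofRealCLM.contDiff.comp hev).add contDiff_const).inv hne).mul hG2
  let K : 𝓢(Space d, ℂ) := hG4.toSchwartzMap hG5
  have hK : ∀ ξ, K ξ = (((eval (fun j => 2 * Real.pi * ξ j) P : ℝ) : ℂ) + c)⁻¹ * G ξ :=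
    fun _ => rfl
  refine ⟨𝓕⁻ K, ?_⟩
  set v := opS P (𝓕⁻ K) + c • 𝓕⁻ K with hv
  have hFv : ∀ ξ, 𝓕 v ξ = G ξ := by
    intro ξ
    have e1 : 𝓕 v = 𝓕 (opS P (𝓕⁻ K)) + 𝓕 (c • 𝓕⁻ K) := FourierTransform.fourier_add _ _
    have e2 : 𝓕 (c • 𝓕⁻ K) = c • 𝓕 (𝓕⁻ K) := FourierTransform.fourier_smul _ _
    rw [e1, e2, add_apply, fourier_opS, smul_apply, FourierTransform.fourier_fourierInv_eq, hK,
      smul_eq_mul]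
    field_simp [hne ξ]
  have h2 : ‖toL2 (f - v)‖ ≤ ε / 4 := by
    have e1 : ‖toL2 (f - v)‖ = ‖toL2 (𝓕 (f - v))‖ := by
      rw [toL2_apply, toL2_apply, SchwartzMap.norm_fourier_toL2_eq]
    have e2 : 𝓕 (f - v) = 𝓕 f - 𝓕 v :=
      map_sub (SchwartzMap.fourierTransformCLM ℂ) f v
    rw [e1, e2, toL2_apply, SchwartzMap.norm_toLp]
    have e3 : ⇑(𝓕 f - 𝓕 v) = ⇑(𝓕 f : 𝓢(Space d, ℂ)) - G := by
      funext ξ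
      rw [sub_apply, hFv, Pi.sub_apply]
    rw [e3]
    exact ENNReal.toReal_le_of_le_ofReal (by linarith) hG3
  calc ‖F - toL2 v‖ = ‖(F - toL2 f) + toL2 (f - v)‖ := by rw [map_sub]; congr 1; abel
    _ ≤ ‖F - toL2 f‖ + ‖toL2 (f - v)‖ := norm_add_le _ _
    _ < ε := by linarith

/-- The hypothesis says that `η` is orthogonal to the range of `Q(p) - i`, which is dense. -/
lemma eq_zero_of_weak {Q : MvPolynomial (Fin d) ℝ} {η : L2 d}
    (h : ∀ w : 𝓢(Space d, ℂ), inner ℂ (toL2 (opS Q w + (-Complex.I) • w)) η = 0) : η = 0 := by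
  by_contra hne
  have hpos : 0 < ‖η‖ := norm_pos_iff.2 hne
  obtain ⟨u, hu⟩ := exists_opS_add_smul_near Q (c := -Complex.I) (by simp) η hpos
  have h1 : inner ℂ (η - toL2 (opS Q u + (-Complex.I) • u)) η = (‖η‖ : ℂ) ^ 2 := by
    rw [inner_sub_left, h u, sub_zero, inner_self_eq_norm_sq_to_K]; rfl
  have h2 := norm_inner_le_norm (𝕜 := ℂ) (η - toL2 (opS Q u + (-Complex.I) • u)) η
  rw [h1, norm_pow, Complex.norm_real, norm_norm] at h2
  nlinarith

lemma cauchySeq_of_norm_sub_le {H : Type*} [NormedAddCommGroup H] {a b : ℕ → H}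
    (hb : CauchySeq b) {K : ℝ} (h : ∀ m n, ‖a m - a n‖ ≤ K * ‖b m - b n‖) : CauchySeq a := by
  rw [Metric.cauchySeq_iff'] at hb ⊢
  intro ε hε
  have hK : 0 < |K| + 1 := by positivity
  obtain ⟨N, hN⟩ := hb (ε / (|K| + 1)) (by positivity)
  refine ⟨N, fun n hn => ?_⟩
  have h1 := hN n hn
  rw [dist_eq_norm] at h1 ⊢
  rw [lt_div_iff₀ hK] at h1
  have h2 := h n N
  have h3 := le_abs_self K
  nlinarith [norm_nonneg (b n - b N)]

/-- Schwartz functions are a core of `Q(p)`. -/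
theorem exists_approx {Q : MvPolynomial (Fin d) ℝ} {φ ψ : L2 d}
    (h : Lp.toTemperedDistribution ψ = polyMomentum Q (Lp.toTemperedDistribution φ)) :
    ∃ u : ℕ → 𝓢(Space d, ℂ), Tendsto (fun n => toL2 (u n)) atTop (𝓝 φ) ∧
      Tendsto (fun n => toL2 (opS Q (u n))) atTop (𝓝 ψ) := by
  -- The approximation is made in the range of `Q(p) + i`: by `norm_opS_add_I_sq`, convergence there
  -- makes `u n` and `Q(p) u n` Cauchy separately.
  have hex : ∀ n : ℕ, ∃ u : 𝓢(Space d, ℂ),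
      ‖(ψ + Complex.I • φ) - toL2 (opS Q u + Complex.I • u)‖ < 1 / ((n : ℝ) + 1) :=
    fun n => exists_opS_add_smul_near Q (by simp) _ (by positivity)
  choose u hu using hex
  have hlim : Tendsto (fun n => toL2 (opS Q (u n) + Complex.I • u n)) atTop
      (𝓝 (ψ + Complex.I • φ)) := by
    rw [tendsto_iff_norm_sub_tendsto_zero]
    refine squeeze_zero (fun _ => norm_nonneg _) (fun n => ?_)
      tendsto_one_div_add_atTop_nhds_zero_nat
    rw [norm_sub_rev]
    exact (hu n).le
  have hc := hlim.cauchySeq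
  have hsub : ∀ m n, ‖toL2 (opS Q (u m - u n))‖ ^ 2 + ‖toL2 (u m - u n)‖ ^ 2 =
      ‖toL2 (opS Q (u m) + Complex.I • u m) - toL2 (opS Q (u n) + Complex.I • u n)‖ ^ 2 := by
    intro m n
    rw [← norm_opS_add_I_sq, ← map_sub, map_sub, smul_sub]
    congr 3
    abel
  obtain ⟨φ', hφ'⟩ := cauchySeq_tendsto_of_complete
    (cauchySeq_of_norm_sub_le (a := fun n => toL2 (u n)) (K := 1) hc fun m n => by
      rw [one_mul, ← map_sub]
      refine le_of_sq_le_sq ?_ (norm_nonneg _)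
      rw [← hsub m n]
      exact le_add_of_nonneg_left (sq_nonneg _))
  obtain ⟨ψ', hψ'⟩ := cauchySeq_tendsto_of_complete
    (cauchySeq_of_norm_sub_le (a := fun n => toL2 (opS Q (u n))) (K := 1) hc fun m n => by
      rw [one_mul, ← map_sub, ← map_sub]
      refine le_of_sq_le_sq ?_ (norm_nonneg _)
      rw [← hsub m n]
      exact le_add_of_nonneg_right (sq_nonneg _))
  have hsum : ψ' + Complex.I • φ' = ψ + Complex.I • φ := by
    refine tendsto_nhds_unique ?_ hlim
    simp only [map_add, map_smul]
    exact hψ'.add (hφ'.const_smul _)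
  have hweak : ∀ w : 𝓢(Space d, ℂ), inner ℂ (toL2 w) ψ' = inner ℂ (toL2 (opS Q w)) φ' := by
    intro w
    refine tendsto_nhds_unique (tendsto_const_nhds.inner hψ') ?_
    simp only [← opS_symm]
    exact tendsto_const_nhds.inner hφ'
  -- The limits satisfy the same weak equation, so the difference is a weak solution of `(Q(p) + i)
  -- η = 0`.
  have hη : φ - φ' = 0 := by
    refine eq_zero_of_weak (Q := Q) fun w => ?_
    have e : ψ - ψ' = -(Complex.I • (φ - φ')) := by
      rw [smul_sub, neg_sub, sub_eq_sub_iff_add_eq_add, add_comm, add_comm _ ψ', hsum, add_comm]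
    have h1 : inner ℂ (toL2 w) (ψ - ψ') = inner ℂ (toL2 (opS Q w)) (φ - φ') := by
      rw [inner_sub_right, inner_sub_right, hweak, inner_eq_of_polyMomentum h]
    rw [e, inner_neg_right, inner_smul_right] at h1
    rw [map_add, map_smul, inner_add_left, inner_smul_left, ← h1]
    simp
  have hφφ : φ' = φ := (sub_eq_zero.1 hη).symm
  subst hφφ
  exact ⟨u, hφ', by rwa [add_right_cancel hsum] at hψ'⟩

/-- Elliptic regularity: along suitable Schwartz approximations all derivatives of the symbol
converge in `L²`. -/
theorem exists_approx_derivs {Q : MvPolynomial (Fin d) ℝ} (hQ : IsElliptic Q) {φ ψ : L2 d}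
    (h : Lp.toTemperedDistribution ψ = polyMomentum Q (Lp.toTemperedDistribution φ)) :
    ∃ (u : ℕ → 𝓢(Space d, ℂ)) (Φ : List (Fin d) → L2 d),
      Tendsto (fun n => toL2 (u n)) atTop (𝓝 φ) ∧
      Tendsto (fun n => toL2 (opS Q (u n))) atTop (𝓝 ψ) ∧
      ∀ L ∈ wordsLE d Q.totalDegree,
        Tendsto (fun n => toL2 (opS (polyD L Q) (u n))) atTop (𝓝 (Φ L)) := by
  obtain ⟨u, hu1, hu2⟩ := exists_approx h
  have hL : ∀ L ∈ wordsLE d Q.totalDegree, ∃ Φ : L2 d,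
      Tendsto (fun n => toL2 (opS (polyD L Q) (u n))) atTop (𝓝 Φ) := by
    intro L hL
    have hdeg : DegLT Q.totalDegree (polyD L Q) :=
      DegLT.polyD_length L ((degLT_totalDegree Q).mono
        (by have := (mem_wordsLE.1 hL).1; omega))
    obtain ⟨C, hC, hbd⟩ := hQ.norm_le hdeg one_pos
    have hc : CauchySeq fun n => toL2 (opS Q (u n) + Complex.I • u n) := by
      simp only [map_add, map_smul]
      exact (hu2.add (hu1.const_smul Complex.I)).cauchySeq
    refine cauchySeq_tendsto_of_complete (cauchySeq_of_norm_sub_le (K := 1 + C) hc fun m n => ?_)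
    have h1 := hbd (u m - u n)
    have h2 : ‖toL2 (opS Q (u m - u n))‖ ^ 2 + ‖toL2 (u m - u n)‖ ^ 2 =
        ‖toL2 (opS Q (u m) + Complex.I • u m) - toL2 (opS Q (u n) + Complex.I • u n)‖ ^ 2 := by
      rw [← norm_opS_add_I_sq, ← map_sub, map_sub, smul_sub]
      congr 3
      abel
    rw [← map_sub, ← map_sub]
    refine le_of_sq_le_sq ?_ (by positivity)
    rw [mul_pow, ← h2]
    rw [one_mul] at h1
    refine h1.trans ?_
    have h3 := sq_nonneg ‖toL2 (opS Q (u m - u n))‖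
    have h4 := sq_nonneg ‖toL2 (u m - u n)‖
    nlinarith [mul_nonneg hC h3, mul_nonneg hC h4, mul_nonneg (sq_nonneg C) h3,
      mul_nonneg (sq_nonneg C) h4]
  choose! Φ hΦ using hL
  exact ⟨u, Φ, hu1, hu2, hΦ⟩

end Approximation

end HigherOrderSchrodinger

/-! ### Local estimates for L² solutions -/

namespace HigherOrderSchrodinger

open MvPolynomial

variable {d : ℕ}

lemma norm_sq_eq_integral (F : L2 d) : ‖F‖ ^ 2 = ∫ x, ‖F x‖ ^ 2 := by
  have h := inner_self_eq_norm_sq_to_K (𝕜 := ℂ) F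
  rw [L2.inner_def] at h
  have h2 : (fun x => inner ℂ (F x) (F x)) = fun x => ((‖F x‖ ^ 2 : ℝ) : ℂ) := by
    funext x
    rw [inner_self_eq_norm_sq_to_K]
    simp
  rw [h2, integral_complex_ofReal] at h
  exact Complex.ofReal_injective (by push_cast; exact h.symm)

lemma integrable_norm_sq_L2 (F : L2 d) : Integrable fun x => ‖F x‖ ^ 2 :=
  (memLp_two_iff_integrable_sq_norm (Lp.aestronglyMeasurable F)).1 (Lp.memLp F)

lemma exists_bound_on_box {g : Space d → ℝ} (hg : Continuous g) (y : Space d) (r : Fin d → ℝ) :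
    ∃ M, 0 ≤ M ∧ ∀ x ∈ box y r, g x ≤ M := by
  obtain ⟨M, hM⟩ := (isBounded_box y r).isCompact_closure.bddAbove_image hg.continuousOn
  exact ⟨max M 0, le_max_right _ _, fun x hx =>
    (hM ⟨x, subset_closure hx, rfl⟩).trans (le_max_left _ _)⟩

lemma integrableOn_weight {g : Space d → ℝ} (hg : Continuous g) (y : Space d) (r : Fin d → ℝ)
    (F : L2 d) : IntegrableOn (fun x => Real.exp (2 * g x) * ‖F x‖ ^ 2) (box y r) := by
  obtain ⟨M, -, hM⟩ := exists_bound_on_box (g := fun x => Real.exp (2 * g x)) (by fun_prop) y r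
  refine Integrable.bdd_mul (c := M) (integrable_norm_sq_L2 F).integrableOn ?_ ?_
  · exact (by fun_prop : Continuous fun x => Real.exp (2 * g x)).aestronglyMeasurable
  · filter_upwards [ae_restrict_mem (isOpen_box y r).measurableSet] with x hx
    rw [Real.norm_eq_abs, Real.abs_exp]
    exact hM x hx

lemma wInt_toL2 (g : Space d → ℝ) (S : Set (Space d)) (u : 𝓢(Space d, ℂ)) :
    wInt g S (toL2 u) = wInt g S u := by
  refine integral_congr_ae (ae_restrict_of_ae ?_)
  filter_upwards [u.coeFn_toLp 2 volume] with x hx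
  rw [toL2_apply, hx]

/-- The local weighted norm is continuous on `L²`. -/
lemma continuous_wInt {g : Space d → ℝ} (hg : Continuous g) (y : Space d) (r : Fin d → ℝ) :
    Continuous fun F : L2 d => wInt g (box y r) F := by
  have hbox := (isOpen_box y r).measurableSet
  obtain ⟨M, hM0, hM⟩ := exists_bound_on_box (g := fun x => Real.exp (g x)) (by fun_prop) y r
  let h : Space d → ℂ := (box y r).indicator fun x => (Real.exp (g x) : ℂ)
  have hc : Continuous fun x => (Real.exp (g x) : ℂ) := by fun_prop
  have hh : MemLp h ∞ volume := by
    refine memLp_top_of_bound (hc.aestronglyMeasurable.indicator hbox) M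
      (Eventually.of_forall fun x => ?_)
    by_cases hx : x ∈ box y r
    · simp only [h, Set.indicator_of_mem hx, Complex.norm_real, Real.norm_eq_abs, Real.abs_exp]
      exact hM x hx
    · simp [h, Set.indicator_of_notMem hx, hM0]
  -- Multiplication by `e^g` cut off to the box is bounded on L², and its norm is the local weighted
  -- norm.
  let T : L2 d →L[ℂ] L2 d :=
    (ContinuousLinearMap.mul ℂ ℂ).holderL (volume : Measure (Space d)) ∞ 2 2 (hh.toLp h)
  have hT : ∀ F : L2 d, ‖T F‖ ^ 2 = wInt g (box y r) F := by
    intro F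
    rw [norm_sq_eq_integral, wInt, ← integral_indicator hbox]
    refine integral_congr_ae ?_
    have e := (ContinuousLinearMap.mul ℂ ℂ).coeFn_holder (r := 2) (hh.toLp h) F
    filter_upwards [e, hh.coeFn_toLp] with x hx hx'
    have e1 : T F x = h x * F x := by
      change (ContinuousLinearMap.mul ℂ ℂ).holder 2 (hh.toLp h) F x = _
      rw [hx, hx']; rfl
    rw [e1]
    by_cases hxb : x ∈ box y r
    · simp only [h, Set.indicator_of_mem hxb, norm_mul, Complex.norm_real, Real.norm_eq_abs,
        Real.abs_exp, mul_pow, ← Real.exp_nat_mul]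
      norm_num
    · simp [h, Set.indicator_of_notMem hxb]
  simp only [← hT]
  fun_prop

/-- `u n` are Schwartz approximations of `φ`, along which `Q(p)` and all derivatives of its symbol
converge. -/
structure ApproxData (Q : MvPolynomial (Fin d) ℝ) (φ ψ : L2 d) (u : ℕ → 𝓢(Space d, ℂ))
    (Φ : List (Fin d) → L2 d) : Prop where
  tendsto_self : Tendsto (fun n => toL2 (u n)) atTop (𝓝 φ)
  tendsto_op : Tendsto (fun n => toL2 (opS Q (u n))) atTop (𝓝 ψ)
  tendsto_deriv : ∀ L ∈ wordsLE d Q.totalDegree,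
    Tendsto (fun n => toL2 (opS (polyD L Q) (u n))) atTop (𝓝 (Φ L))

/-- The density `∑_L t_L |Φ_L|²`. -/
noncomputable def energy (Φ : List (Fin d) → L2 d) (q : ℕ) (t : Fin d → ℝ) (x : Space d) : ℝ :=
  ∑ L ∈ wordsLE d q, wordProd t L * ‖Φ L x‖ ^ 2

lemma energy_nonneg (Φ : List (Fin d) → L2 d) (q : ℕ) {t : Fin d → ℝ} (ht : ∀ j, 0 ≤ t j)
    (x : Space d) : 0 ≤ energy Φ q t x :=
  Finset.sum_nonneg fun L _ => mul_nonneg (wordProd_nonneg ht L) (sq_nonneg _)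

lemma integral_energy {g : Space d → ℝ} (hg : Continuous g) (y : Space d) (r : Fin d → ℝ)
    (Φ : List (Fin d) → L2 d) (q : ℕ) (t : Fin d → ℝ) :
    IntegrableOn (fun x => Real.exp (2 * g x) * energy Φ q t x) (box y r) ∧
    ∫ x in box y r, Real.exp (2 * g x) * energy Φ q t x =
      ∑ L ∈ wordsLE d q, wordProd t L * wInt g (box y r) (Φ L) := by
  have e : (fun x => Real.exp (2 * g x) * energy Φ q t x) = fun x =>
      ∑ L ∈ wordsLE d q, wordProd t L * (Real.exp (2 * g x) * ‖Φ L x‖ ^ 2) := by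
    funext x
    rw [energy, Finset.mul_sum]
    exact Finset.sum_congr rfl fun L _ => by ring
  rw [e]
  refine ⟨integrable_finsetSum _ fun L _ => (integrableOn_weight hg y r _).const_mul _, ?_⟩
  rw [integral_finsetSum _ fun L _ => (integrableOn_weight hg y r _).const_mul _]
  simp only [integral_const_mul]
  rfl

/-- The local estimate for `L²` solutions. -/
theorem ApproxData.local_lintegral {Q : MvPolynomial (Fin d) ℝ} :
    ∃ C : ℝ, 0 ≤ C ∧ ∀ (φ ψ : L2 d) (u : ℕ → 𝓢(Space d, ℂ)) (Φ : List (Fin d) → L2 d),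
      ApproxData Q φ ψ u Φ → ∀ (y : Space d) (r : Fin d → ℝ), (∀ j, 0 < r j) →
      ∀ g : Space d → ℝ, Continuous g → ∀ c C₀ C₁ : ℝ, 0 ≤ C₀ → 0 ≤ C₁ →
      ∀ t : Fin d → ℝ, (∀ j, 0 ≤ t j) →
      (∀ v : 𝓢(Space d, ℂ), HasCompactSupport v →
        ∑ L ∈ wordsLE d Q.totalDegree, wordProd t L * wInt g Set.univ (opS (polyD L Q) v) ≤
          C₀ * wInt g Set.univ (opS (Q + MvPolynomial.C c) v) + C₁ * wInt g Set.univ v) →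
      ∫⁻ x in box y fun j => r j / 2,
          ENNReal.ofReal (Real.exp (2 * g x) * energy Φ Q.totalDegree t x) ≤
        ∫⁻ x in box y r, ENNReal.ofReal (Real.exp (2 * g x) *
          (2 * C₀ * ‖ψ x + (c : ℂ) * φ x‖ ^ 2 + C₁ * ‖φ x‖ ^ 2 +
            C₀ * C * energy Φ Q.totalDegree (fun j => (r j)⁻¹ ^ 2) x)) := by
  obtain ⟨C, hC, hloc⟩ := local_estimate (degLT_totalDegree Q)
  refine ⟨C, hC, ?_⟩
  intro φ ψ u Φ hu y r hr g hg c C₀ C₁ hC₀ hC₁ t ht H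
  set q := Q.totalDegree
  have hlim : ∀ (y : Space d) (r : Fin d → ℝ) {v : ℕ → 𝓢(Space d, ℂ)} {F : L2 d},
      Tendsto (fun n => toL2 (v n)) atTop (𝓝 F) →
      Tendsto (fun n => wInt g (box y r) (v n)) atTop (𝓝 (wInt g (box y r) F)) := by
    intro y r v F hv
    have := ((continuous_wInt hg y r).tendsto F).comp hv
    refine this.congr fun n => ?_
    exact wInt_toL2 g _ (v n)
  have hop : Tendsto (fun n => toL2 (opS (Q + MvPolynomial.C c) (u n))) atTop
      (𝓝 (ψ + (c : ℂ) • φ)) := by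
    have : ∀ n, toL2 (opS (Q + MvPolynomial.C c) (u n)) =
        toL2 (opS Q (u n)) + (c : ℂ) • toL2 (u n) := by
      intro n
      rw [map_add, LinearMap.add_apply, opS_C, map_add, ← map_smul]
      congr 2
    simp only [this]
    exact hu.tendsto_op.add (hu.tendsto_self.const_smul _)
  have hreal : ∑ L ∈ wordsLE d q, wordProd t L * wInt g (box y fun j => r j / 2) (Φ L) ≤
      2 * C₀ * wInt g (box y r) (ψ + (c : ℂ) • φ : L2 d) + C₁ * wInt g (box y r) φ +
        C₀ * C * ∑ L ∈ wordsLE d q, wordProd (fun j => (r j)⁻¹ ^ 2) L *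
          wInt g (box y r) (Φ L) := by
    refine le_of_tendsto_of_tendsto'
      (tendsto_finsetSum _ fun L hL => (hlim _ _ (hu.tendsto_deriv L hL)).const_mul _)
      ((((hlim _ _ hop).const_mul _).add ((hlim _ _ hu.tendsto_self).const_mul _)).add
        ((tendsto_finsetSum _ fun L hL => (hlim _ _ (hu.tendsto_deriv L hL)).const_mul _).const_mul
          _)) fun n => ?_
    exact hloc y r hr g hg c C₀ C₁ hC₀ hC₁ t ht H (u n)
  have hr2 : ∀ j, 0 ≤ (r j)⁻¹ ^ 2 := fun j => sq_nonneg _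
  obtain ⟨i1, e1⟩ := integral_energy hg y (fun j => r j / 2) Φ q t
  obtain ⟨i2, e2⟩ := integral_energy hg y r Φ q (fun j => (r j)⁻¹ ^ 2)
  have hψ : wInt g (box y r) (ψ + (c : ℂ) • φ : L2 d) =
      ∫ x in box y r, Real.exp (2 * g x) * ‖ψ x + (c : ℂ) * φ x‖ ^ 2 := by
    refine integral_congr_ae (ae_restrict_of_ae ?_)
    filter_upwards [Lp.coeFn_add ψ ((c : ℂ) • φ), Lp.coeFn_smul (c : ℂ) φ] with x h1 h2
    rw [h1, Pi.add_apply, h2, Pi.smul_apply, smul_eq_mul]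
  have i3 : IntegrableOn (fun x => Real.exp (2 * g x) * ‖ψ x + (c : ℂ) * φ x‖ ^ 2) (box y r) := by
    refine (integrableOn_weight hg y r (ψ + (c : ℂ) • φ)).congr (ae_restrict_of_ae ?_)
    filter_upwards [Lp.coeFn_add ψ ((c : ℂ) • φ), Lp.coeFn_smul (c : ℂ) φ] with x h1 h2
    rw [h1, Pi.add_apply, h2, Pi.smul_apply, smul_eq_mul]
  have i4 := integrableOn_weight hg y r φ
  have e : (fun x => Real.exp (2 * g x) *
          (2 * C₀ * ‖ψ x + (c : ℂ) * φ x‖ ^ 2 + C₁ * ‖φ x‖ ^ 2 +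
            C₀ * C * energy Φ q (fun j => (r j)⁻¹ ^ 2) x)) = fun x =>
      2 * C₀ * (Real.exp (2 * g x) * ‖ψ x + (c : ℂ) * φ x‖ ^ 2) +
      C₁ * (Real.exp (2 * g x) * ‖φ x‖ ^ 2) +
      C₀ * C * (Real.exp (2 * g x) * energy Φ q (fun j => (r j)⁻¹ ^ 2) x) := by
    funext x; ring
  have i6 : IntegrableOn (fun x => 2 * C₀ * (Real.exp (2 * g x) * ‖ψ x + (c : ℂ) * φ x‖ ^ 2) +
      C₁ * (Real.exp (2 * g x) * ‖φ x‖ ^ 2)) (box y r) :=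
    (i3.const_mul (2 * C₀)).add (i4.const_mul C₁)
  have i5 := i6.add (i2.const_mul (C₀ * C))
  rw [← ofReal_integral_eq_lintegral_ofReal i1 (Eventually.of_forall fun x =>
      mul_nonneg (Real.exp_pos _).le (energy_nonneg Φ q ht x)),
    ← ofReal_integral_eq_lintegral_ofReal (by rw [e]; exact i5)
      (Eventually.of_forall fun x => mul_nonneg (Real.exp_pos _).le (by
        have := energy_nonneg Φ q hr2 x
        positivity))]
  refine ENNReal.ofReal_le_ofReal ?_
  rw [e1, e, integral_add i6 (i2.const_mul (C₀ * C)),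
    integral_add (i3.const_mul (2 * C₀)) (i4.const_mul C₁), integral_const_mul,
    integral_const_mul, integral_const_mul, e2, ← hψ]
  exact hreal

end HigherOrderSchrodinger

/-! ### Averaging local estimates over boxes of variable size -/

namespace HigherOrderSchrodinger

variable {d : ℕ}

lemma volume_box (y : Space d) {r : Fin d → ℝ} (hr : ∀ j, 0 ≤ r j) :
    volume (box y r) = ENNReal.ofReal (∏ j, (2 * r j)) := by
  have h : box y r = (MeasurableEquiv.toLp 2 (Fin d → ℝ)).symm ⁻¹'
      (Set.univ.pi fun j => Set.Ioo (y j - r j) (y j + r j)) := by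
    ext x
    simp only [box, Set.mem_ofPred_eq, Set.mem_preimage, Set.mem_univ_pi, Set.mem_Ioo, abs_lt]
    refine forall_congr' fun j => ?_
    change _ ↔ y j - r j < x j ∧ x j < y j + r j
    constructor <;> rintro ⟨h1, h2⟩ <;> constructor <;> linarith
  rw [h, (EuclideanSpace.volume_preserving_symm_measurableEquiv_toLp (Fin d)).measure_preimage
    (MeasurableSet.univ_pi fun j => measurableSet_Ioo).nullMeasurableSet, Real.volume_pi_Ioo,
    ENNReal.ofReal_prod_of_nonneg fun j _ => by linarith [hr j]]
  refine Finset.prod_congr rfl fun j _ => ?_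
  congr 1
  ring

/-- Summation of local estimates over boxes with slowly varying side lengths. -/
theorem lintegral_le_of_boxes {r : ℝ → ℝ} (hr : ∀ s, 0 < r s)
    (hlip : ∀ s s', |r s - r s'| ≤ |s - s'| / 4) {F G : Space d → ℝ≥0∞} (hF : Measurable F)
    (hG : Measurable G)
    (h : ∀ y, ∫⁻ x in box y (fun j => r (y j) / 2), F x ≤ ∫⁻ x in box y (fun j => r (y j)), G x) :
    ∫⁻ x, F x ≤ 32 ^ d * ∫⁻ x, G x := by
  have hrc : Continuous r := by
    refine (LipschitzWith.of_dist_le_mul (K := 1) fun s s' => ?_).continuous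
    rw [Real.dist_eq, Real.dist_eq, NNReal.coe_one, one_mul]
    exact (hlip s s').trans (by linarith [abs_nonneg (s - s')])
  -- The estimates are integrated over all centres `y` against the inverse volume of the box, up to
  -- a constant; this replaces the choice of a locally finite covering.
  let w : Space d → ℝ≥0∞ := fun y => ENNReal.ofReal (∏ j, (r (y j))⁻¹)
  have hw : Measurable w := by
    refine ENNReal.measurable_ofReal.comp (Continuous.measurable ?_)
    exact continuous_finsetProd _ fun j _ =>
      (hrc.comp (by fun_prop)).inv₀ fun y => (hr _).ne'
  have hset : ∀ c : ℝ,
      MeasurableSet {p : Space d × Space d | p.2 ∈ box p.1 fun j => r (p.1 j) * c} := by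
    intro c
    have : {p : Space d × Space d | p.2 ∈ box p.1 fun j => r (p.1 j) * c} =
        ⋂ j, {p : Space d × Space d | |p.2 j - p.1 j| < r (p.1 j) * c} := by ext; simp [box]
    rw [this]
    exact (isOpen_iInter_of_finite fun j => isOpen_lt (by fun_prop)
      ((hrc.comp (by fun_prop)).mul continuous_const)).measurableSet
  have swap : ∀ (c : ℝ) (H : Space d → ℝ≥0∞), Measurable H →
      ∫⁻ y, w y * ∫⁻ x in box y (fun j => r (y j) * c), H x =
      ∫⁻ x, H x * ∫⁻ y, w y * Set.indicator {y | x ∈ box y fun j => r (y j) * c} 1 y := by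
    intro c H hH
    have h1 : ∀ y, w y * ∫⁻ x in box y (fun j => r (y j) * c), H x =
        ∫⁻ x, w y * (Set.indicator {p : Space d × Space d | p.2 ∈ box p.1 fun j => r (p.1 j) * c} 1
          (y, x) * H x) := by
      intro y
      rw [lintegral_const_mul' _ _ ENNReal.ofReal_ne_top,
        ← lintegral_indicator (isOpen_box _ _).measurableSet]
      congr 1
      refine lintegral_congr fun x => ?_
      by_cases hx : x ∈ box y fun j => r (y j) * c
      · rw [Set.indicator_of_mem hx, Set.indicator_of_mem (by exact hx)]; simp
      · rw [Set.indicator_of_notMem hx, Set.indicator_of_notMem (by exact hx)]; simp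
    simp only [h1]
    rw [lintegral_lintegral_swap]
    · refine lintegral_congr fun x => ?_
      rw [← lintegral_const_mul]
      · refine lintegral_congr fun y => ?_
        have : Set.indicator {p : Space d × Space d | p.2 ∈ box p.1 fun j => r (p.1 j) * c}
            (1 : Space d × Space d → ℝ≥0∞) (y, x) =
            Set.indicator {y | x ∈ box y fun j => r (y j) * c} 1 y := rfl
        rw [this]
        ring
      · refine hw.mul (measurable_one.indicator ?_)
        exact (hset c).preimage (by fun_prop : Measurable fun y : Space d => (y, x))
    · refine Measurable.aemeasurable ?_
      exact (hw.comp measurable_fst).mul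
        ((measurable_one.indicator (hset c)).mul (hH.comp measurable_snd))
  have hmain : ∫⁻ y, w y * ∫⁻ x in box y (fun j => r (y j) * (1 / 2)), F x ≤
      ∫⁻ y, w y * ∫⁻ x in box y (fun j => r (y j) * 1), G x := by
    refine lintegral_mono fun y => mul_le_mul_right ?_ _
    have := h y
    simpa only [mul_one, mul_one_div] using this
  rw [swap _ _ hF, swap _ _ hG] at hmain
  -- If `x` is in the box about `y`, slow variation puts `y` in the box about `x` with sides `4 r (x
  -- j)`, where the density is at most `∏ 2 / r (x j)`.
  have hup : ∀ x, ∫⁻ y, w y * Set.indicator {y | x ∈ box y fun j => r (y j) * 1} 1 y ≤ 8 ^ d := by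
    intro x
    calc ∫⁻ y, w y * Set.indicator {y | x ∈ box y fun j => r (y j) * 1} 1 y
        ≤ ∫⁻ y, Set.indicator (box x fun j => 2 * r (x j))
            (fun _ => ENNReal.ofReal (∏ j, 2 * (r (x j))⁻¹)) y := by
          refine lintegral_mono fun y => ?_
          by_cases hy : x ∈ box y fun j => r (y j) * 1
          · have hj : ∀ j, |x j - y j| < r (y j) := fun j => by simpa using hy j
            have h1 : ∀ j, r (x j) ≤ 2 * r (y j) ∧ r (y j) ≤ 2 * r (x j) := by
              intro j
              have := abs_le.1 (hlip (x j) (y j))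
              have := hj j
              have := hr (y j)
              constructor <;> linarith
            have hy' : y ∈ box x fun j => 2 * r (x j) := fun j => by
              rw [abs_sub_comm]; exact (hj j).trans_le (h1 j).2
            rw [Set.indicator_of_mem hy', Set.indicator_of_mem (by exact hy), Pi.one_apply, mul_one]
            refine ENNReal.ofReal_le_ofReal (Finset.prod_le_prod
              (fun j _ => (inv_pos.2 (hr _)).le) fun j _ => ?_)
            rw [inv_eq_one_div, inv_eq_one_div, mul_one_div, div_le_div_iff₀ (hr _) (hr _)]
            linarith [(h1 j).1]
          · rw [Set.indicator_of_notMem (by exact hy), mul_zero]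
            exact zero_le
      _ = 8 ^ d := by
          rw [lintegral_indicator_const (isOpen_box _ _).measurableSet,
            volume_box x fun j => by linarith [hr (x j)],
            ← ENNReal.ofReal_mul (Finset.prod_nonneg fun j _ => by
              have := inv_pos.2 (hr (x j)); positivity), ← Finset.prod_mul_distrib]
          have : ∀ j, 2 * (r (x j))⁻¹ * (2 * (2 * r (x j))) = 8 := fun j => by
            have := (hr (x j)).ne'
            field_simp
            norm_num
          simp only [this, Finset.prod_const, Finset.card_univ, Fintype.card_fin]
          rw [ENNReal.ofReal_pow (by norm_num)]
          norm_num
  -- The centres `y` in the box about `x` with sides `r (x j) / 2` all see `x` in their half boxes,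
  -- and the density there is at least `∏ 1 / (2 r (x j))`.
  have hlow : ∀ x, 1 ≤ 4 ^ d *
      ∫⁻ y, w y * Set.indicator {y | x ∈ box y fun j => r (y j) * (1 / 2)} 1 y := by
    intro x
    have h1 : ENNReal.ofReal ((1 / 4) ^ d) ≤
        ∫⁻ y, w y * Set.indicator {y | x ∈ box y fun j => r (y j) * (1 / 2)} 1 y := by
      calc ENNReal.ofReal ((1 / 4) ^ d) = ∫⁻ y, Set.indicator (box x fun j => r (x j) / 4)
            (fun _ => ENNReal.ofReal (∏ j, (r (x j))⁻¹ / 2)) y := by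
            rw [lintegral_indicator_const (isOpen_box _ _).measurableSet,
              volume_box x fun j => by linarith [hr (x j)],
              ← ENNReal.ofReal_mul (Finset.prod_nonneg fun j _ => by
                have := inv_pos.2 (hr (x j)); positivity), ← Finset.prod_mul_distrib]
            have : ∀ j, (r (x j))⁻¹ / 2 * (2 * (r (x j) / 4)) = 1 / 4 := fun j => by
              have := (hr (x j)).ne'
              field_simp
            simp only [this, Finset.prod_const, Finset.card_univ, Fintype.card_fin]
        _ ≤ _ := by
          refine lintegral_mono fun y => ?_
          by_cases hy : y ∈ box x fun j => r (x j) / 4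
          · have h1 : ∀ j, r (x j) ≤ 2 * r (y j) ∧ r (y j) ≤ 2 * r (x j) ∧
                |x j - y j| < r (y j) * (1 / 2) := by
              intro j
              have h2 := abs_le.1 (hlip (x j) (y j))
              have h3 : |x j - y j| < r (x j) / 4 := by rw [abs_sub_comm]; exact hy j
              have := hr (x j)
              refine ⟨?_, ?_, ?_⟩ <;> linarith
            have hy' : x ∈ box y fun j => r (y j) * (1 / 2) := fun j => (h1 j).2.2
            rw [Set.indicator_of_mem hy, Set.indicator_of_mem (by exact hy'), Pi.one_apply, mul_one]
            refine ENNReal.ofReal_le_ofReal (Finset.prod_le_prod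
              (fun j _ => by have := inv_pos.2 (hr (x j)); positivity) fun j _ => ?_)
            rw [inv_eq_one_div, inv_eq_one_div, div_div, div_le_div_iff₀ (by linarith [hr (x j)])
              (hr _)]
            linarith [(h1 j).2.1]
          · rw [Set.indicator_of_notMem hy]
            exact zero_le
    calc (1 : ℝ≥0∞) = 4 ^ d * ENNReal.ofReal ((1 / 4) ^ d) := by
          have : (4 : ℝ≥0∞) = ENNReal.ofReal 4 := by norm_num
          rw [this, ← ENNReal.ofReal_pow (by norm_num), ← ENNReal.ofReal_mul (by positivity),
            ← mul_pow]
          norm_num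
      _ ≤ _ := mul_le_mul_right h1 _
  calc ∫⁻ x, F x ≤ ∫⁻ x, 4 ^ d * (F x *
        ∫⁻ y, w y * Set.indicator {y | x ∈ box y fun j => r (y j) * (1 / 2)} 1 y) := by
        refine lintegral_mono fun x => ?_
        calc F x = F x * 1 := (mul_one _).symm
          _ ≤ F x * (4 ^ d * _) := mul_le_mul_right (hlow x) _
          _ = _ := by ring
    _ = 4 ^ d * ∫⁻ x, F x *
        ∫⁻ y, w y * Set.indicator {y | x ∈ box y fun j => r (y j) * (1 / 2)} 1 y :=
        lintegral_const_mul' _ _ (by norm_num)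
    _ ≤ 4 ^ d * ∫⁻ x, G x * 8 ^ d :=
        mul_le_mul_right (hmain.trans (lintegral_mono fun x => mul_le_mul_right (hup x) _)) _
    _ = 32 ^ d * ∫⁻ x, G x := by
        rw [lintegral_mul_const _ hG, show (32 : ℝ≥0∞) = 4 * 8 by norm_num, mul_pow]
        ring

end HigherOrderSchrodinger

/-! ### Superexponential decay of the derivatives -/

namespace HigherOrderSchrodinger

open MvPolynomial

variable {d : ℕ}

/-- The `ℓ¹` norm on `ℝ^d`. -/
def normOne (x : Space d) : ℝ := ∑ j, |x j|

lemma normOne_nonneg (x : Space d) : 0 ≤ normOne x := Finset.sum_nonneg fun _ _ => abs_nonneg _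

lemma continuous_normOne : Continuous (normOne : Space d → ℝ) :=
  continuous_finsetSum _ fun j _ => by fun_prop

lemma abs_normOne_sub_le (x y : Space d) : |normOne x - normOne y| ≤ ∑ j, |x j - y j| := by
  rw [normOne, normOne, ← Finset.sum_sub_distrib]
  exact (Finset.abs_sum_le_sum_abs _ _).trans
    (Finset.sum_le_sum fun j _ => abs_abs_sub_abs_le_abs_sub _ _)

lemma energy_le_energy (Φ : List (Fin d) → L2 d) (q : ℕ) {s t : Fin d → ℝ} (hs : ∀ j, 0 ≤ s j)
    (hst : ∀ j, s j ≤ t j) (x : Space d) : energy Φ q s x ≤ energy Φ q t x :=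
  Finset.sum_le_sum fun L _ =>
    mul_le_mul_of_nonneg_right (wordProd_le_wordProd hs hst L) (sq_nonneg _)

/-- A word of length at most `q` produces at most `q` factors `k ≥ 1`. -/
lemma energy_le_pow_mul (Φ : List (Fin d) → L2 d) (q : ℕ) {k : ℝ} (hk : 1 ≤ k) {s t : Fin d → ℝ}
    (hs : ∀ j, 0 ≤ s j) (ht : ∀ j, 0 ≤ t j) (hst : ∀ j, s j ≤ k * t j) (x : Space d) :
    energy Φ q s x ≤ k ^ q * energy Φ q t x := by
  refine (energy_le_energy Φ q hs hst x).trans ?_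
  rw [energy, energy, Finset.mul_sum]
  refine Finset.sum_le_sum fun L hL => ?_
  rw [wordProd_mul (fun _ => k), wordProd_const, mul_assoc]
  refine mul_le_mul_of_nonneg_right (pow_le_pow_right₀ hk (mem_wordsLE.1 hL).2) ?_
  exact mul_nonneg (wordProd_nonneg ht L) (sq_nonneg _)

/-- The empty word is excluded from the energy, so every term gains at least one factor `k ≤ 1`.
This makes the cutoff errors small. -/
lemma energy_le_mul (Φ : List (Fin d) → L2 d) (q : ℕ) {k : ℝ} (hk0 : 0 ≤ k) (hk : k ≤ 1)
    {s t : Fin d → ℝ} (hs : ∀ j, 0 ≤ s j) (ht : ∀ j, 0 ≤ t j) (hst : ∀ j, s j ≤ k * t j)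
    (x : Space d) : energy Φ q s x ≤ k * energy Φ q t x := by
  refine (energy_le_energy Φ q hs hst x).trans ?_
  rw [energy, energy, Finset.mul_sum]
  refine Finset.sum_le_sum fun L hL => ?_
  rw [wordProd_mul (fun _ => k), wordProd_const, mul_assoc]
  refine mul_le_mul_of_nonneg_right
    (pow_le_of_le_one hk0 hk (Nat.one_le_iff_ne_zero.1 (mem_wordsLE.1 hL).1)) ?_
  exact mul_nonneg (wordProd_nonneg ht L) (sq_nonneg _)

lemma measurable_norm_sq (F : L2 d) : Measurable fun x => ‖F x‖ ^ 2 :=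
  (Lp.stronglyMeasurable F).norm.measurable.pow_const 2

lemma measurable_energy (Φ : List (Fin d) → L2 d) (q : ℕ) {t : Space d → Fin d → ℝ}
    (ht : ∀ j, Measurable fun x => t x j) : Measurable fun x => energy Φ q (t x) x := by
  have h : ∀ L, Measurable fun x => wordProd (t x) L := by
    intro L
    induction L with
    | nil => simp
    | cons j L ih => simp only [wordProd_cons]; exact (ht j).mul ih
  exact Finset.measurable_sum _ fun L _ => (h L).mul (measurable_norm_sq _)

/-- Replacing the weight in a local estimate by one that is comparable to it. -/
lemma setLIntegral_change_weight {S T : Set (Space d)} (hT : MeasurableSet T)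
    (hS : MeasurableSet S) (hST : S ⊆ T) {f g A B : Space d → ℝ} {M : ℝ}
    (hA : ∀ x, 0 ≤ A x) (hB : ∀ x, 0 ≤ B x) (hfg : ∀ x ∈ T, |f x - g x| ≤ M)
    (h : ∫⁻ x in S, ENNReal.ofReal (Real.exp (2 * g x) * A x) ≤
      ∫⁻ x in T, ENNReal.ofReal (Real.exp (2 * g x) * B x)) :
    ∫⁻ x in S, ENNReal.ofReal (Real.exp (2 * f x) * A x) ≤
      ∫⁻ x in T, ENNReal.ofReal (Real.exp (4 * M) * (Real.exp (2 * f x) * B x)) := by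
  calc ∫⁻ x in S, ENNReal.ofReal (Real.exp (2 * f x) * A x)
      ≤ ∫⁻ x in S, ENNReal.ofReal (Real.exp (2 * M)) *
          ENNReal.ofReal (Real.exp (2 * g x) * A x) := by
        refine setLIntegral_mono' hS fun x hx => ?_
        rw [← ENNReal.ofReal_mul (Real.exp_pos _).le, ← mul_assoc, ← Real.exp_add]
        refine ENNReal.ofReal_le_ofReal (mul_le_mul_of_nonneg_right (Real.exp_le_exp.2 ?_) (hA x))
        linarith [(abs_le.1 (hfg x (hST hx))).2]
    _ = ENNReal.ofReal (Real.exp (2 * M)) *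
          ∫⁻ x in S, ENNReal.ofReal (Real.exp (2 * g x) * A x) :=
        lintegral_const_mul' _ _ ENNReal.ofReal_ne_top
    _ ≤ ENNReal.ofReal (Real.exp (2 * M)) *
          ∫⁻ x in T, ENNReal.ofReal (Real.exp (2 * g x) * B x) := mul_le_mul_right h _
    _ = ∫⁻ x in T, ENNReal.ofReal (Real.exp (2 * M)) *
          ENNReal.ofReal (Real.exp (2 * g x) * B x) :=
        (lintegral_const_mul' _ _ ENNReal.ofReal_ne_top).symm
    _ ≤ _ := by
        refine setLIntegral_mono' hT fun x hx => ?_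
        rw [← ENNReal.ofReal_mul (Real.exp_pos _).le, ← mul_assoc, ← mul_assoc, ← Real.exp_add,
          ← Real.exp_add]
        refine ENNReal.ofReal_le_ofReal (mul_le_mul_of_nonneg_right (Real.exp_le_exp.2 ?_) (hB x))
        linarith [(abs_le.1 (hfg x hx)).1]

lemma wInt_const (c : ℝ) (S : Set (Space d)) (u : Space d → ℂ) :
    wInt (fun _ => c) S u = Real.exp (2 * c) * wInt (fun _ => 0) S u := by
  simp [wInt, integral_const_mul]

lemma box_half_subset (y : Space d) {r : Fin d → ℝ} (hr : ∀ j, 0 ≤ r j) :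
    box y (fun j => r j / 2) ⊆ box y r :=
  fun _ hx j => (hx j).trans_le (by linarith [hr j])

/-- Absorption into the left side. The finiteness of `a` is indispensable; truncated weights or a
priori decay supply it in the applications. -/
lemma le_two_mul_of_le_add_half {a b : ℝ≥0∞} (ha : a ≠ ⊤) (h : a ≤ b + 2⁻¹ * a) :
    a ≤ 2 * b := by
  have h2 : 2⁻¹ * a + 2⁻¹ * a = a := by rw [← add_mul, ENNReal.inv_two_add_inv_two, one_mul]
  have h3 : 2⁻¹ * a ≤ b := by
    have h4 : 2⁻¹ * a + 2⁻¹ * a ≤ b + 2⁻¹ * a := h2.le.trans h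
    exact (ENNReal.add_le_add_iff_right (ENNReal.mul_ne_top (by norm_num) ha)).1 h4
  calc a = 2⁻¹ * a + 2⁻¹ * a := h2.symm
    _ ≤ b + b := add_le_add h3 h3
    _ = 2 * b := (two_mul b).symm

/-- If `φ` and `Q(p) φ` decay faster than any exponential then so do the derivatives of `φ`. -/
theorem ApproxData.lintegral_exp_energy_ne_top {Q : MvPolynomial (Fin d) ℝ} (hQ : IsElliptic Q)
    {φ ψ : L2 d} {u : ℕ → 𝓢(Space d, ℂ)} {Φ : List (Fin d) → L2 d} (hu : ApproxData Q φ ψ u Φ)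
    {s : ℝ} (hs : 0 ≤ s)
    (hφ : ∫⁻ x, ENNReal.ofReal (Real.exp (2 * (s * normOne x)) * ‖φ x‖ ^ 2) ≠ ⊤)
    (hψ : ∫⁻ x, ENNReal.ofReal (Real.exp (2 * (s * normOne x)) * ‖ψ x‖ ^ 2) ≠ ⊤) :
    ∫⁻ x, ENNReal.ofReal (Real.exp (2 * (s * normOne x)) *
      energy Φ Q.totalDegree (fun _ => 1) x) ≠ ⊤ := by
  obtain ⟨C, hC, hloc⟩ := ApproxData.local_lintegral (Q := Q)
  set q := Q.totalDegree
  set E := Real.exp (4 * (s * d)) with hE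
  have hE0 : 0 < E := Real.exp_pos _
  -- The commutator errors sit at parameter `1` and the left side at `τ`; this size of `τ` lets them
  -- be absorbed after summation over boxes, with the weight frozen at the cost `E`.
  set τ := max 1 (2 * (32 ^ d * E * C)) with hτdef
  have hτ1 : 1 ≤ τ := le_max_left _ _
  have hτ0 : 0 < τ := one_pos.trans_le hτ1
  have hτ : 32 ^ d * (E * C * τ⁻¹) ≤ 1 / 2 := by
    have := le_max_right 1 (2 * (32 ^ d * E * C))
    rw [← hτdef] at this
    rw [← mul_assoc, ← div_eq_mul_inv, div_le_iff₀ hτ0]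
    linarith
  obtain ⟨C₁, hC₁, hglob⟩ := hQ.global_estimate hτ0
  let B₀ : Space d → ℝ := fun x => 2 * ‖ψ x‖ ^ 2 + C₁ * ‖φ x‖ ^ 2
  have hB₀ : ∀ x, 0 ≤ B₀ x := fun x => by positivity
  have mB₀ : Measurable B₀ :=
    ((measurable_norm_sq ψ).const_mul 2).add ((measurable_norm_sq φ).const_mul C₁)
  have hone : ∀ j : Fin d, (0 : ℝ) ≤ (fun _ => 1 : Fin d → ℝ) j := fun _ => zero_le_one
  have hτj : ∀ j : Fin d, (0 : ℝ) ≤ (fun _ => τ : Fin d → ℝ) j := fun _ => hτ0.le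
  have en : ∀ x, 0 ≤ energy Φ q (fun _ => τ) x := energy_nonneg Φ q hτj
  have en1 : ∀ x, 0 ≤ energy Φ q (fun _ => 1) x := energy_nonneg Φ q hone
  have men : Measurable fun x => energy Φ q (fun _ => τ) x :=
    measurable_energy Φ q fun _ => measurable_const
  have men1 : Measurable fun x => energy Φ q (fun _ => 1) x :=
    measurable_energy Φ q fun _ => measurable_const
  let K : ℝ≥0∞ := ∫⁻ x, ENNReal.ofReal (E * (Real.exp (2 * (s * normOne x)) * B₀ x))
  have hK : K ≠ ⊤ := by
    have e : K = ENNReal.ofReal (E * 2) *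
        (∫⁻ x, ENNReal.ofReal (Real.exp (2 * (s * normOne x)) * ‖ψ x‖ ^ 2)) +
        ENNReal.ofReal (E * C₁) *
        ∫⁻ x, ENNReal.ofReal (Real.exp (2 * (s * normOne x)) * ‖φ x‖ ^ 2) := by
      have m : Measurable fun x : Space d => Real.exp (2 * (s * normOne x)) := by
        have := continuous_normOne (d := d)
        exact Continuous.measurable (by fun_prop)
      rw [← lintegral_const_mul' _ _ ENNReal.ofReal_ne_top,
        ← lintegral_const_mul' _ _ ENNReal.ofReal_ne_top, ← lintegral_add_left]
      · refine lintegral_congr fun x => ?_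
        rw [← ENNReal.ofReal_mul (by positivity), ← ENNReal.ofReal_mul (by positivity),
          ← ENNReal.ofReal_add (by positivity) (by positivity)]
        congr 1
        simp only [B₀]
        ring
      · exact (m.mul (measurable_norm_sq ψ)).ennreal_ofReal.const_mul _
    rw [e]
    exact ENNReal.add_ne_top.2 ⟨ENNReal.mul_ne_top ENNReal.ofReal_ne_top hψ,
      ENNReal.mul_ne_top ENNReal.ofReal_ne_top hφ⟩
  -- Truncating the weight at `n` makes the left side finite, hence absorbable. Truncation does not
  -- increase its oscillation on unit boxes, so the bound is uniform in `n` and survives monotone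
  -- convergence.
  have key : ∀ n : ℕ, ∫⁻ x, ENNReal.ofReal (Real.exp (2 * min (s * normOne x) n) *
      energy Φ q (fun _ => τ) x) ≤ 2 * (32 ^ d * K) := by
    intro n
    set m : Space d → ℝ := fun x => min (s * normOne x) n with hm
    have cm : Continuous m := (continuous_const.mul continuous_normOne).min continuous_const
    have mm : Measurable fun x => Real.exp (2 * m x) :=
      Continuous.measurable (by fun_prop)
    have hfin : ∫⁻ x, ENNReal.ofReal (Real.exp (2 * m x) * energy Φ q (fun _ => τ) x) ≠ ⊤ := by
      have hi : Integrable fun x => energy Φ q (fun _ => τ) x :=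
        integrable_finsetSum _ fun L _ => (integrable_norm_sq_L2 (Φ L)).const_mul _
      have hi2 : Integrable fun x => Real.exp (2 * m x) * energy Φ q (fun _ => τ) x := by
        refine Integrable.bdd_mul (c := Real.exp (2 * n)) hi mm.aestronglyMeasurable
          (Eventually.of_forall fun x => ?_)
        rw [Real.norm_eq_abs, Real.abs_exp]
        exact Real.exp_le_exp.2 (by linarith [min_le_right (s * normOne x) (n : ℝ)])
      rw [← ofReal_integral_eq_lintegral_ofReal hi2 (Eventually.of_forall fun x =>
        mul_nonneg (Real.exp_pos _).le (en x))]
      exact ENNReal.ofReal_ne_top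
    refine le_two_mul_of_le_add_half hfin ?_
    have hG : Measurable fun x => ENNReal.ofReal (E * (Real.exp (2 * m x) *
        (B₀ x + C * energy Φ q (fun _ => 1) x))) :=
      ((mm.mul (mB₀.add (men1.const_mul C))).const_mul E).ennreal_ofReal
    have hF : Measurable fun x =>
        ENNReal.ofReal (Real.exp (2 * m x) * energy Φ q (fun _ => τ) x) :=
      (mm.mul men).ennreal_ofReal
    have hbox := lintegral_le_of_boxes (d := d) (r := fun _ => 1) (fun _ => one_pos)
      (fun s s' => by simp only [sub_self, abs_zero]; positivity)
      hF hG (fun y => by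
        have hl := hloc φ ψ u Φ hu y (fun _ => 1) (fun _ => one_pos) (fun _ => m y)
          continuous_const 0 1 C₁ zero_le_one hC₁ (fun _ => τ) hτj (fun v _ => by
            simp only [wInt_const (m y)]
            have := mul_le_mul_of_nonneg_left (hglob v) (Real.exp_pos (2 * m y)).le
            rw [Finset.mul_sum] at this
            calc _ = _ := Finset.sum_congr rfl fun L _ => by ring
              _ ≤ _ := this
              _ = _ := by rw [map_zero, add_zero]; ring)
        have hl2 : ∫⁻ x in box y fun _ => 1 / 2,
              ENNReal.ofReal (Real.exp (2 * m y) * energy Φ q (fun _ => τ) x) ≤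
            ∫⁻ x in box y fun _ => 1, ENNReal.ofReal (Real.exp (2 * m y) *
              (B₀ x + C * energy Φ q (fun _ => 1) x)) := by
          simpa [B₀] using hl
        refine setLIntegral_change_weight (isOpen_box _ _).measurableSet
          (isOpen_box _ _).measurableSet (box_half_subset y hone) (g := fun _ => m y) en
          (fun x => add_nonneg (hB₀ x) (mul_nonneg hC (en1 x))) (fun x hx => ?_) hl2
        have h1 : |m x - m y| ≤ |s * normOne x - s * normOne y| := by
          have := abs_min_sub_min_le_max (s * normOne x) n (s * normOne y) n
          simpa using this
        refine h1.trans ?_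
        rw [← mul_sub, abs_mul, abs_of_nonneg hs]
        refine mul_le_mul_of_nonneg_left ((abs_normOne_sub_le x y).trans ?_) hs
        calc _ ≤ ∑ _j : Fin d, (1 : ℝ) := Finset.sum_le_sum fun j _ => (hx j).le
          _ = d := by simp)
    refine hbox.trans ?_
    have hGle : ∫⁻ x, ENNReal.ofReal (E * (Real.exp (2 * m x) *
        (B₀ x + C * energy Φ q (fun _ => 1) x))) ≤ K + ENNReal.ofReal (E * C * τ⁻¹) *
        ∫⁻ x, ENNReal.ofReal (Real.exp (2 * m x) * energy Φ q (fun _ => τ) x) := by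
      rw [← lintegral_const_mul' _ _ ENNReal.ofReal_ne_top, ← lintegral_add_right _
        (hF.const_mul _)]
      refine lintegral_mono fun x => ?_
      rw [← ENNReal.ofReal_mul (by positivity),
        ← ENNReal.ofReal_add (by have := hB₀ x; positivity) (by have := en x; positivity)]
      refine ENNReal.ofReal_le_ofReal ?_
      have h1 : energy Φ q (fun _ => 1) x ≤ τ⁻¹ * energy Φ q (fun _ => τ) x :=
        energy_le_mul Φ q (inv_nonneg.2 hτ0.le) (inv_le_one_of_one_le₀ hτ1) hone hτj
          (fun _ => by rw [inv_mul_cancel₀ hτ0.ne']) x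
      have h2 : Real.exp (2 * m x) ≤ Real.exp (2 * (s * normOne x)) :=
        Real.exp_le_exp.2 (by linarith [min_le_left (s * normOne x) (n : ℝ)])
      calc _ = E * (Real.exp (2 * m x) * B₀ x) +
            E * Real.exp (2 * m x) * C * energy Φ q (fun _ => 1) x := by ring
        _ ≤ E * (Real.exp (2 * (s * normOne x)) * B₀ x) +
            E * Real.exp (2 * m x) * C * (τ⁻¹ * energy Φ q (fun _ => τ) x) := by
          have := hB₀ x
          gcongr
        _ = _ := by ring
    refine (mul_le_mul_right hGle _).trans ?_
    rw [mul_add, ← mul_assoc]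
    refine add_le_add le_rfl (mul_le_mul_left ?_ _)
    have e32 : (32 : ℝ≥0∞) ^ d = ENNReal.ofReal (32 ^ d) := by
      rw [ENNReal.ofReal_pow (by norm_num)]; norm_num
    rw [e32, ← ENNReal.ofReal_mul (by positivity)]
    refine (ENNReal.ofReal_le_ofReal hτ).trans_eq ?_
    rw [one_div, ENNReal.ofReal_inv_of_pos two_pos]
    norm_num
  have hlim := lintegral_tendsto_of_tendsto_of_monotone (μ := (volume : Measure (Space d)))
    (f := fun (n : ℕ) x => ENNReal.ofReal (Real.exp (2 * min (s * normOne x) n) *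
      energy Φ q (fun _ => τ) x))
    (F := fun x => ENNReal.ofReal (Real.exp (2 * (s * normOne x)) * energy Φ q (fun _ => τ) x))
    (fun n => by
      have : Continuous fun x : Space d => Real.exp (2 * min (s * normOne x) n) := by
        have := continuous_normOne (d := d)
        fun_prop
      exact (this.measurable.mul men).ennreal_ofReal.aemeasurable)
    (Eventually.of_forall fun x n k hnk => by
      refine ENNReal.ofReal_le_ofReal (mul_le_mul_of_nonneg_right (Real.exp_le_exp.2 ?_) (en x))
      have : (n : ℝ) ≤ k := Nat.cast_le.2 hnk
      have := min_le_min_left (s * normOne x) this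
      linarith)
    (Eventually.of_forall fun x => by
      refine tendsto_const_nhds.congr' ?_
      obtain ⟨n₀, hn₀⟩ := exists_nat_ge (s * normOne x)
      filter_upwards [eventually_ge_atTop n₀] with n hn
      rw [min_eq_left (hn₀.trans (Nat.cast_le.2 hn))])
  have hle := le_of_tendsto' hlim key
  refine ne_top_of_le_ne_top ?_ ((lintegral_mono fun x => ENNReal.ofReal_le_ofReal
    (mul_le_mul_of_nonneg_left (energy_le_energy Φ q hone (fun _ => hτ1) x)
      (Real.exp_pos _).le)).trans hle)
  exact ENNReal.mul_ne_top (by norm_num) (ENNReal.mul_ne_top (by norm_num) hK)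

end HigherOrderSchrodinger

/-! ### Slowly varying scales and their convex weights -/

namespace HigherOrderSchrodinger

/-- Functions `≥ 1` of slow variation whose inverse square is integrable. -/
structure SlowScale (a : ℝ → ℝ) : Prop where
  one_le : ∀ s, 1 ≤ a s
  lipschitz : ∀ s s', |a s - a s'| ≤ |s - s'|
  integrable : Integrable fun s => (a s ^ 2)⁻¹

namespace SlowScale

variable {a : ℝ → ℝ}

lemma pos (ha : SlowScale a) (s : ℝ) : 0 < a s := one_pos.trans_le (ha.one_le s)

lemma continuous (ha : SlowScale a) : Continuous a := by
  refine (LipschitzWith.of_dist_le_mul (K := 1) fun s s' => ?_).continuous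
  rw [Real.dist_eq, Real.dist_eq, NNReal.coe_one, one_mul]
  exact ha.lipschitz s s'

lemma inv_sq_le (ha : SlowScale a) {κ : ℝ} (hκ : κ ≤ 1 / 4) {y s : ℝ} (h : |s - y| ≤ κ * a y) :
    (a y ^ 2)⁻¹ ≤ 2 * (a s ^ 2)⁻¹ ∧ (a s ^ 2)⁻¹ ≤ 2 * (a y ^ 2)⁻¹ := by
  have hy := ha.pos y
  have hs := ha.pos s
  have h1 : |a s - a y| ≤ a y / 4 := (ha.lipschitz s y).trans (h.trans (by nlinarith))
  have := abs_le.1 h1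
  rw [← div_eq_mul_inv, ← div_eq_mul_inv, inv_eq_one_div, inv_eq_one_div,
    div_le_div_iff₀ (by positivity) (by positivity), div_le_div_iff₀ (by positivity)
    (by positivity)]
  constructor <;> nlinarith

/-- The relative oscillation of `a⁻²` at distance `κ a` is of order `κ`; multiplied by `a⁻² (κ a)²`
this gives a second order Taylor error of order `κ³`. -/
lemma abs_inv_sq_sub_le (ha : SlowScale a) {κ : ℝ} (hκ0 : 0 ≤ κ) (hκ : κ ≤ 1 / 4) {y s : ℝ}
    (h : |s - y| ≤ κ * a y) : |(a s ^ 2)⁻¹ - (a y ^ 2)⁻¹| ≤ 4 * κ * (a y ^ 2)⁻¹ := by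
  have hy := ha.pos y
  have hs := ha.pos s
  have h0 : |a s - a y| ≤ κ * a y := (ha.lipschitz s y).trans h
  have h1 := abs_le.1 h0
  have h2 : 3 / 4 * a y ≤ a s := by nlinarith
  have h3 : a s ≤ 5 / 4 * a y := by nlinarith
  have e : (a s ^ 2)⁻¹ - (a y ^ 2)⁻¹ = (a y - a s) * (a y + a s) / a s ^ 2 * (a y ^ 2)⁻¹ := by
    field_simp
    ring
  rw [e, abs_mul, abs_of_pos (inv_pos.2 (pow_pos hy 2))]
  refine mul_le_mul_of_nonneg_right ?_ (inv_pos.2 (pow_pos hy 2)).le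
  rw [abs_div, abs_mul, abs_of_pos (add_pos hy hs), abs_of_pos (pow_pos hs 2),
    div_le_iff₀ (pow_pos hs 2), abs_sub_comm]
  calc |a s - a y| * (a y + a s) ≤ κ * a y * (9 / 4 * a y) :=
        mul_le_mul h0 (by linarith) (by positivity) (by positivity)
    _ = 4 * κ * (3 / 4 * a y) ^ 2 := by ring
    _ ≤ 4 * κ * a s ^ 2 := by gcongr

end SlowScale

/-- Second order Taylor estimate. -/
lemma abs_sub_taylor_two_le {h h₁ h₂ : ℝ → ℝ} (h1 : ∀ s, HasDerivAt h (h₁ s) s)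
    (h2 : ∀ s, HasDerivAt h₁ (h₂ s) s) {y s k e : ℝ}
    (he : ∀ z ∈ Set.uIcc y s, |h₂ z - k| ≤ e) :
    |h s - h y - h₁ y * (s - y) - k * (s - y) ^ 2 / 2| ≤ e * |s - y| ^ 2 := by
  have hy : y ∈ Set.uIcc y s := Set.left_mem_uIcc
  have hs : s ∈ Set.uIcc y s := Set.right_mem_uIcc
  have hR1 : ∀ z ∈ Set.uIcc y s, |h₁ z - h₁ y - k * (z - y)| ≤ e * |s - y| := by
    intro z hz
    have := (convex_uIcc y s).norm_image_sub_le_of_norm_hasDerivWithin_le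
      (f := fun z => h₁ z - k * z) (f' := fun z => h₂ z - k) (C := e)
      (fun x _ => ((h2 x).sub (by simpa using (hasDerivAt_id x).const_mul k)).hasDerivWithinAt)
      (fun x hx => he x hx) hy hz
    rw [Real.norm_eq_abs, Real.norm_eq_abs] at this
    have e1 : h₁ z - k * z - (h₁ y - k * y) = h₁ z - h₁ y - k * (z - y) := by ring
    rw [e1] at this
    refine this.trans (mul_le_mul_of_nonneg_left ?_ ((abs_nonneg _).trans (he y hy)))
    rw [abs_sub_comm z y, abs_sub_comm s y]
    exact Set.abs_sub_left_of_mem_uIcc hz |>.trans_eq' (abs_sub_comm _ _) |>.trans_eq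
      (abs_sub_comm _ _)
  have := (convex_uIcc y s).norm_image_sub_le_of_norm_hasDerivWithin_le
    (f := fun z => h z - h₁ y * z - k * (z - y) ^ 2 / 2)
    (f' := fun z => h₁ z - h₁ y - k * (z - y)) (C := e * |s - y|)
    (fun x _ => by
      have d1 : HasDerivAt (fun z => h₁ y * z) (h₁ y) x := by
        simpa using (hasDerivAt_id x).const_mul (h₁ y)
      have d2 : HasDerivAt (fun z => k * (z - y) ^ 2 / 2) (k * (x - y)) x := by
        have := ((((hasDerivAt_id x).sub_const y).pow 2).const_mul k).div_const 2
        refine this.congr_deriv ?_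
        simp only [id_eq]
        push_cast
        ring
      exact (((h1 x).sub d1).sub d2).hasDerivWithinAt)
    (fun x hx => hR1 x hx) hy hs
  rw [Real.norm_eq_abs, Real.norm_eq_abs] at this
  calc _ = |h s - h₁ y * s - k * (s - y) ^ 2 / 2 - (h y - h₁ y * y - k * (y - y) ^ 2 / 2)| := by
        congr 1; ring
    _ ≤ _ := this
    _ = _ := by ring

/-- The weight whose second derivative is `a⁻²`. -/
theorem SlowScale.exists_weight {a : ℝ → ℝ} (ha : SlowScale a) :
    ∃ (h h₁ : ℝ → ℝ) (M : ℝ), 0 ≤ M ∧ Continuous h ∧ (∀ s, |h s| ≤ M * |s|) ∧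
      ∀ κ, 0 < κ → κ ≤ 1 / 4 → ∀ y s, |s - y| ≤ κ * a y →
        |h s - h y - h₁ y * (s - y) - (a y ^ 2)⁻¹ * (s - y) ^ 2 / 2| ≤ 4 * κ ^ 3 := by
  have c2 : Continuous fun s => (a s ^ 2)⁻¹ :=
    (ha.continuous.pow 2).inv₀ fun s => (pow_pos (ha.pos s) 2).ne'
  -- Integrability of `a⁻²` bounds this first primitive, so the second one grows at most linearly.
  let h₁ : ℝ → ℝ := fun s => ∫ z in (0 : ℝ)..s, (a z ^ 2)⁻¹
  let h : ℝ → ℝ := fun s => ∫ z in (0 : ℝ)..s, h₁ z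
  have d1 : ∀ s, HasDerivAt h₁ ((a s ^ 2)⁻¹) s := fun s =>
    intervalIntegral.integral_hasDerivAt_right (c2.intervalIntegrable _ _)
      (c2.stronglyMeasurableAtFilter _ _) c2.continuousAt
  have c1 : Continuous h₁ := continuous_iff_continuousAt.2 fun s => (d1 s).continuousAt
  have d0 : ∀ s, HasDerivAt h (h₁ s) s := fun s =>
    intervalIntegral.integral_hasDerivAt_right (c1.intervalIntegrable _ _)
      (c1.stronglyMeasurableAtFilter _ _) c1.continuousAt
  have hM : ∀ s, |h₁ s| ≤ ∫ z, (a z ^ 2)⁻¹ := by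
    intro s
    have h0 : ∀ z, 0 ≤ (a z ^ 2)⁻¹ := fun z => inv_nonneg.2 (sq_nonneg _)
    calc |h₁ s| = ‖∫ z in (0 : ℝ)..s, (a z ^ 2)⁻¹‖ := (Real.norm_eq_abs _).symm
      _ ≤ ∫ z in Set.uIoc 0 s, ‖(a z ^ 2)⁻¹‖ :=
          intervalIntegral.norm_integral_le_integral_norm_uIoc
      _ = ∫ z in Set.uIoc 0 s, (a z ^ 2)⁻¹ :=
          integral_congr_ae (Eventually.of_forall fun z => by
            simp only [Real.norm_eq_abs, abs_of_nonneg (h0 z)])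
      _ ≤ _ := setIntegral_le_integral ha.integrable (Eventually.of_forall h0)
  refine ⟨h, h₁, ∫ z, (a z ^ 2)⁻¹, (abs_nonneg _).trans (hM 0),
    continuous_iff_continuousAt.2 fun s => (d0 s).continuousAt, fun s => ?_, ?_⟩
  · have := intervalIntegral.norm_integral_le_of_norm_le_const (a := 0) (b := s) (f := h₁)
      (C := ∫ z, (a z ^ 2)⁻¹) fun z _ => hM z
    simpa using this
  · intro κ hκ0 hκ y s hys
    have hy := ha.pos y
    have := abs_sub_taylor_two_le d0 d1 (y := y) (s := s) (k := (a y ^ 2)⁻¹)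
      (e := 4 * κ * (a y ^ 2)⁻¹) fun z hz => ha.abs_inv_sq_sub_le hκ0.le hκ (by
        have := Set.abs_sub_left_of_mem_uIcc hz
        exact this.trans hys)
    refine this.trans ?_
    calc 4 * κ * (a y ^ 2)⁻¹ * |s - y| ^ 2 ≤ 4 * κ * (a y ^ 2)⁻¹ * (κ * a y) ^ 2 := by gcongr
      _ = 4 * κ ^ 3 := by field_simp

/-- The scale `(1 + |s|)^β`. -/
lemma slowScale_rpow {β : ℝ} (h1 : 1 / 2 < β) (h2 : β ≤ 1) :
    SlowScale fun s : ℝ => (1 + |s|) ^ β where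
  one_le s := Real.one_le_rpow (by linarith [abs_nonneg s]) (by linarith)
  lipschitz := by
    have key : ∀ u v : ℝ, 1 ≤ v → v ≤ u → u ^ β - v ^ β ≤ u - v := by
      intro u v hv huv
      have hv0 : 0 < v := by linarith
      have e1 : (u / v) ^ β ≤ u / v := by
        have : 1 ≤ u / v := (one_le_div hv0).2 huv
        simpa using Real.rpow_le_rpow_of_exponent_le this h2
      have e2 : u ^ β = v ^ β * (u / v) ^ β := by
        rw [← Real.mul_rpow hv0.le (div_nonneg (hv0.le.trans huv) hv0.le),
          mul_div_cancel₀ _ hv0.ne']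
      have e3 : v ^ β ≤ v := by simpa using Real.rpow_le_rpow_of_exponent_le hv h2
      have e4 : u - v = v * (u / v - 1) := by field_simp
      have e5 : 0 ≤ u / v - 1 := sub_nonneg.2 ((one_le_div hv0).2 huv)
      have e6 : 0 ≤ v ^ β := Real.rpow_nonneg hv0.le _
      calc u ^ β - v ^ β = v ^ β * ((u / v) ^ β - 1) := by rw [e2]; ring
        _ ≤ v ^ β * (u / v - 1) := by gcongr
        _ ≤ v * (u / v - 1) := by gcongr
        _ = u - v := e4.symm
    have key2 : ∀ s s' : ℝ, (1 + |s|) ^ β - (1 + |s'|) ^ β ≤ |s - s'| := by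
      intro s s'
      have n1 := abs_nonneg s
      have n2 := abs_nonneg s'
      rcases le_total |s'| |s| with h | h
      · refine (key _ _ (by linarith) (by linarith)).trans ?_
        linarith [abs_sub_abs_le_abs_sub s s']
      · have : (1 + |s|) ^ β ≤ (1 + |s'|) ^ β :=
          Real.rpow_le_rpow (by linarith) (by linarith) (by linarith)
        linarith [abs_nonneg (s - s')]
    intro s s'
    exact abs_le.2 ⟨by have := key2 s' s; rw [abs_sub_comm] at this; linarith, key2 s s'⟩
  integrable := by
    have := integrable_one_add_norm (E := ℝ) (μ := volume) (r := 2 * β) (by simp; linarith)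
    refine this.congr (Eventually.of_forall fun s => ?_)
    have h0 : 0 ≤ 1 + |s| := by positivity
    simp only [Real.norm_eq_abs]
    rw [← Real.rpow_natCast, ← Real.rpow_mul h0, ← Real.rpow_neg h0]
    congr 1
    push_cast
    ring

end HigherOrderSchrodinger

/-! ### The Carleman argument -/

namespace HigherOrderSchrodinger

open MvPolynomial

variable {d : ℕ}

/-- For elliptic `Q`, `φ` itself is, up to a constant, one of the derivatives `Φ_L`. -/
lemma ApproxData.exists_eq_smul {Q : MvPolynomial (Fin d) ℝ} (hQ : IsElliptic Q)
    (hq : 1 ≤ Q.totalDegree) {φ ψ : L2 d} {u : ℕ → 𝓢(Space d, ℂ)} {Φ : List (Fin d) → L2 d}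
    (hu : ApproxData Q φ ψ u Φ) (j : Fin d) :
    ∃ c : ℝ, 0 ≤ c ∧ ∀ᵐ x, ‖φ x‖ ^ 2 = c * ‖Φ (List.replicate Q.totalDegree j) x‖ ^ 2 := by
  obtain ⟨c, hc, hL⟩ := hQ.polyD_replicate j
  have hmem : List.replicate Q.totalDegree j ∈ wordsLE d Q.totalDegree :=
    mem_wordsLE.2 (by simpa using hq)
  have h1 := hu.tendsto_deriv _ hmem
  have h2 : Tendsto (fun n => toL2 (opS (polyD (List.replicate Q.totalDegree j) Q) (u n))) atTop
      (𝓝 ((c : ℂ) • φ)) := by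
    have : ∀ n, toL2 (opS (polyD (List.replicate Q.totalDegree j) Q) (u n)) =
        (c : ℂ) • toL2 (u n) := by
      intro n
      rw [hL, opS_C, ← map_smul]
      congr 1
    simp only [this]
    exact hu.tendsto_self.const_smul _
  have h3 := tendsto_nhds_unique h1 h2
  refine ⟨(c ^ 2)⁻¹, inv_nonneg.2 (sq_nonneg _), ?_⟩
  filter_upwards [Lp.coeFn_smul (c : ℂ) φ] with x hx
  rw [h3, hx, Pi.smul_apply, norm_smul, mul_pow, Complex.norm_real, Real.norm_eq_abs, sq_abs]
  field_simp

/-- The Carleman inequality on compactly supported functions with a quadratic weight. -/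
lemma sum_wordProd_wInt_le {Q : MvPolynomial (Fin d) ℝ} (k c : ℝ) (b : Fin d → ℝ)
    {t : Fin d → ℝ} (ht : ∀ j, 0 ≤ t j) {v : 𝓢(Space d, ℂ)} (hv : HasCompactSupport v) :
    ∑ L ∈ wordsLE d Q.totalDegree, wordProd t L *
        wInt (quadWeight k b t) Set.univ (opS (polyD L Q) v) ≤
      (∑ L ∈ wordsLE d Q.totalDegree, ((Q.totalDegree + 1 : ℕ) : ℝ) ^ L.length) *
        wInt (quadWeight k b t) Set.univ (opS (Q + C c) v) := by
  rw [Finset.sum_mul]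
  refine Finset.sum_le_sum fun L hL => ?_
  have := treves_word k b ht L ((degLT_totalDegree Q).add_C c) hv
  rwa [polyD_add_C (List.ne_nil_of_length_pos (mem_wordsLE.1 hL).1)] at this

/-- The separable weight compared with its second order Taylor polynomial on a box. -/
lemma SlowScale.abs_sub_quadWeight_le {h h₁ : ℝ → ℝ} {a : ℝ → ℝ} {κ σ : ℝ} (hσ : 0 ≤ σ)
    {x y : Space d}
    (hT : ∀ j, |h (x j) - h (y j) - h₁ (y j) * (x j - y j) -
      (a (y j) ^ 2)⁻¹ * (x j - y j) ^ 2 / 2| ≤ 4 * κ ^ 3) :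
    |σ * ∑ j, h (x j) - quadWeight
      (∑ j, σ * (h (y j) - h₁ (y j) * y j + (a (y j) ^ 2)⁻¹ * y j ^ 2 / 2))
      (fun j => σ * (h₁ (y j) - (a (y j) ^ 2)⁻¹ * y j)) (fun j => σ * (a (y j) ^ 2)⁻¹) x| ≤
      d * (4 * (σ * κ ^ 2) * κ) := by
  have e : σ * ∑ j, h (x j) - quadWeight
      (∑ j, σ * (h (y j) - h₁ (y j) * y j + (a (y j) ^ 2)⁻¹ * y j ^ 2 / 2))
      (fun j => σ * (h₁ (y j) - (a (y j) ^ 2)⁻¹ * y j)) (fun j => σ * (a (y j) ^ 2)⁻¹) x =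
      ∑ j, σ * (h (x j) - h (y j) - h₁ (y j) * (x j - y j) -
        (a (y j) ^ 2)⁻¹ * (x j - y j) ^ 2 / 2) := by
    rw [quadWeight, Finset.mul_sum, ← Finset.sum_add_distrib, ← Finset.sum_sub_distrib]
    exact Finset.sum_congr rfl fun j _ => by ring
  rw [e]
  calc _ ≤ ∑ j, |σ * (h (x j) - h (y j) - h₁ (y j) * (x j - y j) -
        (a (y j) ^ 2)⁻¹ * (x j - y j) ^ 2 / 2)| := Finset.abs_sum_le_sum_abs _ _
    _ ≤ ∑ _j : Fin d, σ * (4 * κ ^ 3) := Finset.sum_le_sum fun j _ => by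
        rw [abs_mul, abs_of_nonneg hσ]
        exact mul_le_mul_of_nonneg_left (hT j) hσ
    _ = _ := by
        rw [Finset.sum_const, Finset.card_univ, Fintype.card_fin, nsmul_eq_mul]
        ring

/-- With `k` fixed, decreasing `κ` makes the Taylor error `4 d k κ` small and `σ = k / κ²` large at
the same time; the latter controls the potential term `B / σ`. -/
lemma exists_scale_parameter {κ₀ : ℝ} (hκ₀ : 0 < κ₀) {k : ℝ} (hk : 1 ≤ k) {B : ℝ} (hB : 0 ≤ B) :
    ∃ κ : ℝ, 0 < κ ∧ κ ≤ 1 / 4 ∧ κ ≤ κ₀ ∧ d * (4 * k * κ) ≤ 1 ∧ 1 ≤ k / κ ^ 2 ∧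
      B / (k / κ ^ 2) ≤ 1 / 4 := by
  have hd : 0 < 4 * k * d + 1 := by positivity
  set κ := min (min (1 / 4) κ₀) (min (1 / (4 * k * d + 1)) (1 / (4 * B + 1)))
  have p1 : κ ≤ 1 / 4 := (min_le_left _ _).trans (min_le_left _ _)
  have p2 : κ ≤ κ₀ := (min_le_left _ _).trans (min_le_right _ _)
  have p3 : κ ≤ 1 / (4 * k * d + 1) := (min_le_right _ _).trans (min_le_left _ _)
  have p4 : κ ≤ 1 / (4 * B + 1) := (min_le_right _ _).trans (min_le_right _ _)
  have p0 : 0 < κ := lt_min (lt_min (by norm_num) hκ₀) (lt_min (by positivity) (by positivity))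
  rw [le_div_iff₀ hd] at p3
  rw [le_div_iff₀ (by positivity)] at p4
  have hs : 4 * B + 1 ≤ k / κ ^ 2 := by
    rw [le_div_iff₀ (by positivity)]
    have : κ * (4 * B + 1) * κ ≤ 1 * κ := mul_le_mul_of_nonneg_right p4 p0.le
    nlinarith
  refine ⟨κ, p0, p1, p2, by nlinarith, by linarith, ?_⟩
  rw [div_le_iff₀ (by positivity)]
  linarith

lemma pow_mul_norm_sq_le_energy (Φ : List (Fin d) → L2 d) {q : ℕ} (hq : 1 ≤ q) {t : Fin d → ℝ}
    (ht : ∀ j, 0 ≤ t j) (j : Fin d) (x : Space d) :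
    t j ^ q * ‖Φ (List.replicate q j) x‖ ^ 2 ≤ energy Φ q t x := by
  have e : wordProd t (List.replicate q j) = t j ^ q := by simp [wordProd]
  rw [← e]
  exact Finset.single_le_sum (f := fun L => wordProd t L * ‖Φ L x‖ ^ 2)
    (fun L _ => mul_nonneg (wordProd_nonneg ht L) (sq_nonneg _))
    (mem_wordsLE.2 (by simpa using hq))

/-- A perturbation of size `α^q`, where `t' = σ α`, is absorbed by the energy at parameter
`t ≥ t' / 2` when `σ` is large. -/
lemma perturbation_le_energy (Φ : List (Fin d) → L2 d) {q : ℕ} (hq : 1 ≤ q) {t : Fin d → ℝ}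
    (ht : ∀ j, 0 ≤ t j) {j : Fin d} {x : Space d} {σ α Cv c₀ w p : ℝ} (hσ : 1 ≤ σ) (hα : 0 ≤ α)
    (hc₀ : 0 ≤ c₀) (hαt : σ * α ≤ 2 * t j) (hw : w ≤ Cv * α ^ q * p)
    (hp : p = c₀ * ‖Φ (List.replicate q j) x‖ ^ 2) :
    w ≤ 2 ^ q * |Cv| * c₀ / σ * energy Φ q t x := by
  have hσ0 : 0 < σ := one_pos.trans_le hσ
  have e1 : α ^ q * σ ≤ 2 ^ q * t j ^ q := by
    calc α ^ q * σ ≤ α ^ q * σ ^ q := by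
          gcongr
          exact le_self_pow₀ hσ (by omega)
      _ = (σ * α) ^ q := by rw [← mul_pow, mul_comm]
      _ ≤ (2 * t j) ^ q := by gcongr
      _ = _ := mul_pow _ _ _
  have e2 := pow_mul_norm_sq_le_energy Φ hq ht j x
  have hp0 : 0 ≤ p := by rw [hp]; positivity
  calc _ ≤ _ := hw
    _ ≤ |Cv| * α ^ q * p := by
        gcongr
        exact le_abs_self _
    _ = |Cv| * c₀ / σ * ‖Φ (List.replicate q j) x‖ ^ 2 * (α ^ q * σ) := by
        rw [hp]
        field_simp
    _ ≤ |Cv| * c₀ / σ * ‖Φ (List.replicate q j) x‖ ^ 2 * (2 ^ q * t j ^ q) := by gcongr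
    _ = 2 ^ q * |Cv| * c₀ / σ * (t j ^ q * ‖Φ (List.replicate q j) x‖ ^ 2) := by ring
    _ ≤ _ := by gcongr

/-- A local estimate whose right side is dominated by the quantity it controls. -/
lemma setLIntegral_absorb {S T : Set (Space d)} (hT : MeasurableSet T) (hS : MeasurableSet S)
    (hST : S ⊆ T) {f g A B E : Space d → ℝ} {M k θ : ℝ} (hk : 0 ≤ k) (hθ : 0 ≤ θ)
    (hA : ∀ x, 0 ≤ A x) (hB : ∀ x, 0 ≤ B x) (hfg : ∀ x ∈ T, |f x - g x| ≤ M)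
    (h : ∫⁻ x in S, ENNReal.ofReal (Real.exp (2 * g x) * A x) ≤
      ∫⁻ x in T, ENNReal.ofReal (Real.exp (2 * g x) * B x))
    (hEA : ∀ x ∈ S, E x ≤ k * A x) (hBE : ∀ᵐ x, x ∈ T → B x ≤ θ * E x) :
    ∫⁻ x in S, ENNReal.ofReal (Real.exp (2 * f x) * E x) ≤
      ∫⁻ x in T, ENNReal.ofReal (k * (Real.exp (4 * M) * θ)) *
        ENNReal.ofReal (Real.exp (2 * f x) * E x) := by
  calc ∫⁻ x in S, ENNReal.ofReal (Real.exp (2 * f x) * E x)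
      ≤ ∫⁻ x in S, ENNReal.ofReal k * ENNReal.ofReal (Real.exp (2 * f x) * A x) := by
        refine setLIntegral_mono' hS fun x hx => ?_
        rw [← ENNReal.ofReal_mul hk]
        refine ENNReal.ofReal_le_ofReal ?_
        calc Real.exp (2 * f x) * E x ≤ Real.exp (2 * f x) * (k * A x) :=
              mul_le_mul_of_nonneg_left (hEA x hx) (Real.exp_pos _).le
          _ = _ := by ring
    _ = ENNReal.ofReal k * ∫⁻ x in S, ENNReal.ofReal (Real.exp (2 * f x) * A x) :=
        lintegral_const_mul' _ _ ENNReal.ofReal_ne_top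
    _ ≤ _ := mul_le_mul_right (setLIntegral_change_weight hT hS hST hA hB hfg h) _
    _ = _ := (lintegral_const_mul' _ _ ENNReal.ofReal_ne_top).symm
    _ ≤ _ := by
        refine lintegral_mono_ae ?_
        filter_upwards [ae_restrict_mem hT, ae_restrict_of_ae hBE] with x hx hBx
        rw [← ENNReal.ofReal_mul hk, ← ENNReal.ofReal_mul (by positivity)]
        refine ENNReal.ofReal_le_ofReal ?_
        calc k * (Real.exp (4 * M) * (Real.exp (2 * f x) * B x)) ≤
              k * (Real.exp (4 * M) * (Real.exp (2 * f x) * (θ * E x))) := by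
              gcongr
              exact hBx hx
          _ = _ := by ring

/-- Unique continuation at infinity: a function decaying faster than any exponential for which
`Q(p) φ` is, on boxes of size `a`, up to a constant multiple of `φ`, dominated by `a^{-q} |φ|`,
vanishes. -/
theorem ApproxData.eq_zero {Q : MvPolynomial (Fin d) ℝ} (hQ : IsElliptic Q)
    (hq : 1 ≤ Q.totalDegree) {φ ψ : L2 d} {u : ℕ → 𝓢(Space d, ℂ)} {Φ : List (Fin d) → L2 d}
    (hu : ApproxData Q φ ψ u Φ) (j₀ : Fin d) {a : ℝ → ℝ} (ha : SlowScale a) {c : Space d → ℝ}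
    {κ₀ Cv : ℝ} (hκ₀ : 0 < κ₀)
    (hpot : ∀ κ, 0 < κ → κ ≤ κ₀ → ∀ y, ∀ᵐ x, x ∈ box y (fun j => κ * a (y j)) →
      ‖ψ x + (c y : ℂ) * φ x‖ ^ 2 ≤ Cv * (a (y j₀) ^ 2)⁻¹ ^ Q.totalDegree * ‖φ x‖ ^ 2)
    (hfin : ∀ s, 0 ≤ s → ∫⁻ x, ENNReal.ofReal (Real.exp (2 * (s * normOne x)) *
      energy Φ Q.totalDegree (fun _ => 1) x) ≠ ⊤) : φ = 0 := by
  obtain ⟨C, hC, hloc⟩ := ApproxData.local_lintegral (Q := Q)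
  obtain ⟨h, h₁, M, hM, hh, hhM, hTay⟩ := ha.exists_weight
  obtain ⟨c₀, hc₀, hφΦ⟩ := hu.exists_eq_smul hQ hq j₀
  set q := Q.totalDegree
  set C₀ := ∑ L ∈ wordsLE d q, ((q + 1 : ℕ) : ℝ) ^ L.length with hC₀def
  have hC₀ : 0 ≤ C₀ := Finset.sum_nonneg fun L _ => by positivity
  clear_value C₀
  set D : ℝ := 32 ^ d * 2 ^ q * Real.exp 4 * C₀ with hD
  have hD0 : 0 ≤ D := by positivity
  clear_value D
  -- Cutoff derivatives cost `(κ a)⁻² = t / k` per letter, so `k` must be large before `κ` is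
  -- chosen. They take one quarter of the final bound, the potential the other.
  obtain ⟨k, hk2, hk⟩ : ∃ k : ℝ, 2 ≤ k ∧ D * (2 * C) / k ≤ 1 / 4 := by
    refine ⟨max 2 (4 * (D * (2 * C))), le_max_left _ _, ?_⟩
    have := le_max_right 2 (4 * (D * (2 * C)))
    have h0 : 0 < max 2 (4 * (D * (2 * C))) := two_pos.trans_le (le_max_left _ _)
    rw [div_le_iff₀ h0]
    linarith
  have hk0 : 0 < k := by linarith
  obtain ⟨κ, hκ0, hκ4, hκκ, hκd, hσ1, hσD⟩ := exists_scale_parameter (d := d) hκ₀ (k := k)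
    (by linarith) (B := D * (2 ^ (q + 1) * |Cv| * c₀)) (by positivity)
  set σ := k / κ ^ 2 with hσ
  have hσ0 : 0 < σ := one_pos.trans_le hσ1
  have hσκ : σ * κ ^ 2 = k := by rw [hσ]; field_simp
  clear_value σ
  set θ₀ := C₀ * (2 ^ (q + 1) * |Cv| * c₀ / σ + 2 * C / k) with hθ₀def
  have hθ₀ : 0 ≤ θ₀ := by positivity
  set θ := 2 ^ q * (Real.exp (4 * 1) * θ₀) with hθ
  have hθhalf : 32 ^ d * θ ≤ 1 / 2 := by
    calc 32 ^ d * θ = D * (2 ^ (q + 1) * |Cv| * c₀) / σ + D * (2 * C) / k := by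
          rw [hθ, hθ₀def, hD, mul_one]; ring
      _ ≤ 1 / 2 := by linarith
  clear_value θ₀
  let f : Space d → ℝ := fun x => σ * ∑ j, h (x j)
  let t : Space d → Fin d → ℝ := fun x j => σ * (a (x j) ^ 2)⁻¹
  have ht0 : ∀ x j, 0 ≤ t x j := fun x j => by have := ha.pos (x j); positivity
  have htm : ∀ j, Measurable fun x => t x j := fun j => by
    refine Continuous.measurable (continuous_const.mul (Continuous.inv₀ ?_ fun x => ?_))
    · exact (ha.continuous.comp (by fun_prop)).pow 2
    · exact (pow_pos (ha.pos _) 2).ne'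
  have hfm : Measurable fun x => Real.exp (2 * f x) := by
    refine Continuous.measurable (Real.continuous_exp.comp (continuous_const.mul
      (continuous_const.mul (continuous_finsetSum _ fun j _ => hh.comp (by fun_prop)))))
  have hFm : Measurable fun x => ENNReal.ofReal (Real.exp (2 * f x) * energy Φ q (t x) x) :=
    (hfm.mul (measurable_energy Φ q htm)).ennreal_ofReal
  -- The superexponential decay enters here: `f` is at most a multiple of the `ℓ¹` norm and `t ≤ σ`.
  have hFfin : ∫⁻ x, ENNReal.ofReal (Real.exp (2 * f x) * energy Φ q (t x) x) ≠ ⊤ := by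
    have hle : ∀ x, Real.exp (2 * f x) * energy Φ q (t x) x ≤
        σ ^ q * (Real.exp (2 * (σ * M * normOne x)) * energy Φ q (fun _ => 1) x) := by
      intro x
      have h1 : energy Φ q (t x) x ≤ σ ^ q * energy Φ q (fun _ => 1) x :=
        energy_le_pow_mul Φ q hσ1 (ht0 x) (fun _ => zero_le_one) (fun j => by
          refine mul_le_mul_of_nonneg_left (inv_le_one_of_one_le₀ ?_) hσ0.le
          exact one_le_pow₀ (ha.one_le _)) x
      have h2 : f x ≤ σ * M * normOne x := by
        rw [mul_assoc]
        refine mul_le_mul_of_nonneg_left ?_ hσ0.le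
        rw [normOne, Finset.mul_sum]
        exact Finset.sum_le_sum fun j _ => (le_abs_self _).trans (hhM _)
      have h3 := energy_nonneg Φ q (t := fun _ => 1) (fun _ => zero_le_one) x
      calc _ ≤ Real.exp (2 * (σ * M * normOne x)) * (σ ^ q * energy Φ q (fun _ => 1) x) := by
            gcongr
            exact energy_nonneg Φ q (ht0 x) x
        _ = _ := by ring
    refine ne_top_of_le_ne_top ?_ (lintegral_mono fun x => ENNReal.ofReal_le_ofReal (hle x))
    simp only [ENNReal.ofReal_mul (pow_nonneg hσ0.le q)]
    rw [lintegral_const_mul' _ _ ENNReal.ofReal_ne_top]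
    exact ENNReal.mul_ne_top ENNReal.ofReal_ne_top (hfin _ (by positivity))
  have hboxes := lintegral_le_of_boxes (d := d) (r := fun s => κ * a s)
    (fun s => mul_pos hκ0 (ha.pos s))
    (fun s s' => by
      rw [← mul_sub, abs_mul, abs_of_pos hκ0]
      have := ha.lipschitz s s'
      nlinarith [abs_nonneg (a s - a s')])
    hFm (hFm.const_mul (ENNReal.ofReal θ)) (fun y => by
      have hcomp : ∀ x ∈ box y (fun j => κ * a (y j)), ∀ j,
          t y j ≤ 2 * t x j ∧ t x j ≤ 2 * t y j := by
        intro x hx j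
        obtain ⟨e1, e2⟩ := ha.inv_sq_le hκ4 (hx j).le
        constructor
        · calc t y j ≤ σ * (2 * (a (x j) ^ 2)⁻¹) := mul_le_mul_of_nonneg_left e1 hσ0.le
            _ = _ := by simp only [t]; ring
        · calc t x j ≤ σ * (2 * (a (y j) ^ 2)⁻¹) := mul_le_mul_of_nonneg_left e2 hσ0.le
            _ = _ := by simp only [t]; ring
      have hr0 : ∀ j, 0 < κ * a (y j) := fun j => mul_pos hκ0 (ha.pos _)
      -- The second order Taylor polynomial of `f` at `y`, whose Hessian is diagonal because `f` is
      -- separable.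
      set g := quadWeight
        (∑ j, σ * (h (y j) - h₁ (y j) * y j + (a (y j) ^ 2)⁻¹ * y j ^ 2 / 2))
        (fun j => σ * (h₁ (y j) - (a (y j) ^ 2)⁻¹ * y j)) (t y) with hg
      have hl := hloc φ ψ u Φ hu y (fun j => κ * a (y j)) hr0 g
        (contDiff_quadWeight _ _ (t y)).continuous (c y) C₀ 0 hC₀ le_rfl (t y) (ht0 y)
        (fun v hv => by
          rw [zero_mul, add_zero, hC₀def, hg]
          exact sum_wordProd_wInt_le _ (c y) _ (ht0 y) hv)
      have hr2 : ∀ j, 0 ≤ (κ * a (y j))⁻¹ ^ 2 := fun j => sq_nonneg _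
      refine setLIntegral_absorb (isOpen_box _ _).measurableSet
        (isOpen_box _ _).measurableSet (box_half_subset y fun j => (hr0 j).le) (M := 1)
        (pow_nonneg zero_le_two q) hθ₀ (energy_nonneg Φ q (ht0 y))
        (fun x => by have := energy_nonneg Φ q hr2 x; positivity)
        (fun x hx => (SlowScale.abs_sub_quadWeight_le hσ0.le fun j =>
          hTay κ hκ0 hκ4 (y j) (x j) (hx j).le).trans (by rw [hσκ]; exact hκd)) hl
        (fun x hx => energy_le_pow_mul Φ q one_le_two (ht0 x) (ht0 y)
          (fun j => (hcomp x (box_half_subset y (fun j => (hr0 j).le) hx) j).2) x) ?_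
      filter_upwards [hpot κ hκ0 hκκ y, hφΦ] with x hp hφx hx
      have hen := energy_nonneg Φ q (ht0 x) x
      have h1 : energy Φ q (fun j => (κ * a (y j))⁻¹ ^ 2) x ≤
          2 / k * energy Φ q (t x) x := by
        refine energy_le_mul Φ q (by positivity) ((div_le_one hk0).2 hk2) hr2 (ht0 x)
          (fun j => ?_) x
        calc (κ * a (y j))⁻¹ ^ 2 = t y j / k := by
              rw [← hσκ]
              simp only [t]
              have := (ha.pos (y j)).ne'
              field_simp
          _ ≤ 2 * t x j / k := by gcongr; exact (hcomp x hx j).1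
          _ = _ := by ring
      have h2 : ‖ψ x + (c y : ℂ) * φ x‖ ^ 2 ≤
          2 ^ q * |Cv| * c₀ / σ * energy Φ q (t x) x :=
        perturbation_le_energy Φ hq (ht0 x) hσ1 (inv_nonneg.2 (sq_nonneg _)) hc₀
          (hcomp x hx j₀).1 (hp hx) hφx
      calc _ ≤ 2 * C₀ * (2 ^ q * |Cv| * c₀ / σ * energy Φ q (t x) x) + 0 * ‖φ x‖ ^ 2 +
            C₀ * C * (2 / k * energy Φ q (t x) x) :=
          add_le_add (add_le_add (mul_le_mul_of_nonneg_left h2 (mul_nonneg zero_le_two hC₀)) le_rfl)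
            (mul_le_mul_of_nonneg_left h1 (mul_nonneg hC₀ hC))
        _ = _ := by rw [hθ₀def]; ring)
  rw [lintegral_const_mul _ hFm, ← mul_assoc] at hboxes
  have hzero : ∫⁻ x, ENNReal.ofReal (Real.exp (2 * f x) * energy Φ q (t x) x) = 0 := by
    have h1 : (32 : ℝ≥0∞) ^ d * ENNReal.ofReal θ ≤ 2⁻¹ := by
      have e32 : (32 : ℝ≥0∞) ^ d = ENNReal.ofReal (32 ^ d) := by
        rw [ENNReal.ofReal_pow (by norm_num)]; norm_num
      rw [e32, ← ENNReal.ofReal_mul (by positivity)]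
      refine (ENNReal.ofReal_le_ofReal hθhalf).trans_eq ?_
      rw [one_div, ENNReal.ofReal_inv_of_pos two_pos]
      norm_num
    -- The weighted energy is finite and at most half of itself.
    have h2 := le_two_mul_of_le_add_half (b := 0) hFfin (by
      rw [zero_add]
      exact hboxes.trans (mul_le_mul_left h1 _))
    simpa using h2
  rw [lintegral_eq_zero_iff hFm] at hzero
  refine (Lp.eq_zero_iff_ae_eq_zero).2 ?_
  filter_upwards [hzero, hφΦ] with x hx hφx
  have h1 : Real.exp (2 * f x) * energy Φ q (t x) x ≤ 0 := ENNReal.ofReal_eq_zero.1 hx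
  have h2 : energy Φ q (t x) x ≤ 0 := by
    by_contra hcon
    push Not at hcon
    have := mul_pos (Real.exp_pos (2 * f x)) hcon
    linarith
  have h3 := pow_mul_norm_sq_le_energy Φ hq (ht0 x) j₀ x
  have h4 : 0 < t x j₀ ^ q := pow_pos (mul_pos hσ0 (inv_pos.2 (pow_pos (ha.pos _) 2))) q
  have h5 : ‖Φ (List.replicate q j₀) x‖ ^ 2 ≤ 0 := by
    by_contra hcon
    push Not at hcon
    have := mul_pos h4 hcon
    linarith
  have h6 : ‖φ x‖ ^ 2 ≤ 0 := by rw [hφx]; exact mul_nonpos_of_nonneg_of_nonpos hc₀ h5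
  have h7 : ‖φ x‖ = 0 := by
    have := sq_nonneg ‖φ x‖
    exact pow_eq_zero_iff two_ne_zero |>.1 (le_antisymm h6 this)
  simpa using h7

end HigherOrderSchrodinger

/-! ### Decay of the potential on boxes, and the assumption of infinite decay rate -/

namespace HigherOrderSchrodinger

variable {d : ℕ}

/-- A decay rate at infinity and local boundedness give a global bound. -/
lemma exists_bound_of_isBigO {f : Space d → ℝ} {p : ℝ} (hp : 0 ≤ p)
    (hloc : ∀ R : ℝ, ∃ B, ∀ x, ‖x‖ ≤ R → |f x| ≤ B)
    (h : f =O[Bornology.cobounded (Space d)] fun x => ‖x‖ ^ (-p)) :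
    ∃ C, 0 ≤ C ∧ ∀ x, |f x| ≤ C * (1 + ‖x‖) ^ (-p) := by
  obtain ⟨c, hc, hfc⟩ := h.exists_pos
  obtain ⟨R, -, hR⟩ := (hasBasis_cobounded_norm (E := Space d)).eventually_iff.1 hfc.bound
  obtain ⟨B, hB⟩ := hloc (max R 1)
  have hRR : 0 ≤ 1 + max R 1 := by linarith [le_max_right R 1]
  refine ⟨max (c * 2 ^ p) (|B| * (1 + max R 1) ^ p), le_max_of_le_left (by positivity),
    fun x => ?_⟩
  have hx : 0 < 1 + ‖x‖ := by positivity
  rcases le_total ‖x‖ (max R 1) with hxR | hxR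
  · have h1 : 1 ≤ (1 + max R 1) ^ p * (1 + ‖x‖) ^ (-p) := by
      rw [Real.rpow_neg hx.le, ← div_eq_mul_inv, one_le_div (Real.rpow_pos_of_pos hx _)]
      exact Real.rpow_le_rpow hx.le (by linarith) hp
    calc |f x| ≤ |B| * 1 := by rw [mul_one]; exact (hB x hxR).trans (le_abs_self _)
      _ ≤ |B| * ((1 + max R 1) ^ p * (1 + ‖x‖) ^ (-p)) := by gcongr
      _ = |B| * (1 + max R 1) ^ p * (1 + ‖x‖) ^ (-p) := by ring
      _ ≤ _ := by gcongr; exact le_max_right _ _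
  · have h1 := hR (show x ∈ {x : Space d | R ≤ ‖x‖} from (le_max_left _ _).trans hxR)
    have hx1 : 1 ≤ ‖x‖ := (le_max_right _ _).trans hxR
    rw [Real.norm_eq_abs, Real.norm_of_nonneg (Real.rpow_nonneg (norm_nonneg x) _)] at h1
    have h2 : ‖x‖ ^ (-p) ≤ 2 ^ p * (1 + ‖x‖) ^ (-p) := by
      calc ‖x‖ ^ (-p) ≤ ((1 + ‖x‖) / 2) ^ (-p) :=
            Real.rpow_le_rpow_of_nonpos (by positivity) (by linarith) (by linarith)
        _ = _ := by
            rw [Real.div_rpow hx.le zero_le_two, Real.rpow_neg zero_le_two, div_inv_eq_mul,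
              mul_comm]
    calc |f x| ≤ c * ‖x‖ ^ (-p) := h1
      _ ≤ c * (2 ^ p * (1 + ‖x‖) ^ (-p)) := by gcongr
      _ = c * 2 ^ p * (1 + ‖x‖) ^ (-p) := by ring
      _ ≤ _ := by gcongr; exact le_max_left _ _

lemma abs_apply_le_norm (x : Space d) (j : Fin d) : |x j| ≤ ‖x‖ := by
  simpa using PiLp.norm_apply_le x j

lemma opNorm_le_sum_abs (T : Space d →L[ℝ] ℝ) : ‖T‖ ≤ ∑ j, |T (stdVec j)| := by
  refine T.opNorm_le_bound (Finset.sum_nonneg fun _ _ => abs_nonneg _) fun x => ?_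
  conv_lhs => rw [← sum_smul_stdVec x, map_sum]
  rw [Finset.sum_mul]
  refine (norm_sum_le _ _).trans (Finset.sum_le_sum fun j _ => ?_)
  rw [map_smul, norm_smul, Real.norm_eq_abs, Real.norm_eq_abs, mul_comm]
  exact mul_le_mul_of_nonneg_left (abs_apply_le_norm x j) (abs_nonneg _)

lemma exists_norm_fderiv_le {V : Space d → ℝ} (hV : ContDiff ℝ ∞ V) {p : ℝ} (hp : 0 ≤ p)
    (h : ∀ j, partialDeriv (fun _ : Fin 1 => j) V =O[Bornology.cobounded (Space d)]
      fun x => ‖x‖ ^ (-p)) :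
    ∃ C, 0 ≤ C ∧ ∀ x, ‖fderiv ℝ V x‖ ≤ C * (1 + ‖x‖) ^ (-p) := by
  have e : ∀ j, partialDeriv (fun _ : Fin 1 => j) V = fun x => fderiv ℝ V x (stdVec j) := by
    intro j
    funext x
    rw [partialDeriv, iteratedFDeriv_one_apply]
  have hc : ∀ j : Fin d, Continuous fun x => fderiv ℝ V x (stdVec j) := fun j =>
    (hV.continuous_fderiv (by simp)).clm_apply continuous_const
  have hb : ∀ j : Fin d, ∃ C, 0 ≤ C ∧ ∀ x, |fderiv ℝ V x (stdVec j)| ≤ C * (1 + ‖x‖) ^ (-p) := by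
    intro j
    refine exists_bound_of_isBigO hp (fun R => ?_) (e j ▸ h j)
    obtain ⟨B, hB⟩ := (isCompact_closedBall (0 : Space d) R).bddAbove_image
      (hc j).abs.continuousOn
    exact ⟨B, fun x hx => hB ⟨x, by simpa using hx, rfl⟩⟩
  choose C hC0 hC using hb
  refine ⟨∑ j, C j, Finset.sum_nonneg fun j _ => hC0 j, fun x => ?_⟩
  rw [Finset.sum_mul]
  exact (opNorm_le_sum_abs _).trans (Finset.sum_le_sum fun j _ => hC j x)

/-- On boxes of slowly varying size, `V₁(y) - V₁(x) - V₂(x)` is as small as the weight requires. -/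
lemma sq_potential_sub_le {V₁ V₂ : Space d → ℝ} (hV₁ : ContDiff ℝ ∞ V₁) {q : ℕ}
    {β p₁ p₂ C₁ C₂ : ℝ} (hβ0 : 0 ≤ β) (hβ : β ≤ 1) (hp₁ : β + β * q ≤ p₁) (hp₂ : β * q ≤ p₂)
    (hC₁ : 0 ≤ C₁) (hC₂ : 0 ≤ C₂) (h₁ : ∀ x, ‖fderiv ℝ V₁ x‖ ≤ C₁ * (1 + ‖x‖) ^ (-p₁))
    (h₂ : ∀ x, |V₂ x| ≤ C₂ * (1 + ‖x‖) ^ (-p₂)) {κ : ℝ} (hκ0 : 0 ≤ κ) (hκ : d * κ ≤ 1 / 2)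
    {x y : Space d} (hx : x ∈ box y fun j => κ * (1 + |y j|) ^ β) (j : Fin d) :
    (V₁ y - V₁ x - V₂ x) ^ 2 ≤
      (C₁ * 2 ^ p₁ + C₂ * 2 ^ p₂) ^ 2 * (((1 + |y j|) ^ β) ^ 2)⁻¹ ^ q := by
  set Y := 1 + ‖y‖ with hY
  have hY1 : 1 ≤ Y := by linarith [norm_nonneg y]
  have hY0 : 0 < Y := by linarith
  have hβq : 0 ≤ β * q := by positivity
  -- As `d κ ≤ 1/2` and `β ≤ 1`, the box lies in the ball of radius `Y / 2` about `y`, where `1 +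
  -- ‖z‖` is at least `Y / 2` and decay rates can be read off at `y`.
  have hxy : ‖x - y‖ ≤ Y ^ β / 2 := by
    refine (norm_le_sum_abs _).trans ?_
    calc ∑ j, |(x - y) j| ≤ ∑ _j : Fin d, κ * Y ^ β := Finset.sum_le_sum fun j _ => by
          refine (hx j).le.trans (mul_le_mul_of_nonneg_left ?_ hκ0)
          exact Real.rpow_le_rpow (by positivity) (by linarith [abs_apply_le_norm y j]) hβ0
      _ = d * κ * Y ^ β := by
          rw [Finset.sum_const, Finset.card_univ, Fintype.card_fin, nsmul_eq_mul]; ring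
      _ ≤ 1 / 2 * Y ^ β := by gcongr
      _ = _ := by ring
  have hYβ : Y ^ β ≤ Y := by simpa using Real.rpow_le_rpow_of_exponent_le hY1 hβ
  have hball : ∀ p : ℝ, 0 ≤ p → ∀ z ∈ Metric.closedBall y (Y / 2),
      (1 + ‖z‖) ^ (-p) ≤ 2 ^ p * Y ^ (-p) := by
    intro p hp z hz
    have h3 : ‖y‖ - ‖z‖ ≤ Y / 2 := by
      have := norm_sub_norm_le y z
      rw [Metric.mem_closedBall, dist_comm, dist_eq_norm] at hz
      linarith
    calc (1 + ‖z‖) ^ (-p) ≤ (Y / 2) ^ (-p) :=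
          Real.rpow_le_rpow_of_nonpos (by positivity) (by linarith) (by linarith)
      _ = _ := by
          rw [Real.div_rpow hY0.le zero_le_two, Real.rpow_neg zero_le_two, div_inv_eq_mul,
            mul_comm]
  have hxmem : x ∈ Metric.closedBall y (Y / 2) := by
    rw [Metric.mem_closedBall, dist_eq_norm]; linarith
  have hymem : y ∈ Metric.closedBall y (Y / 2) := Metric.mem_closedBall_self (by positivity)
  have b1 : |V₁ y - V₁ x| ≤ C₁ * 2 ^ p₁ * Y ^ (-(β * q)) := by
    have hmv := (convex_closedBall y (Y / 2)).norm_image_sub_le_of_norm_fderiv_le (𝕜 := ℝ)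
      (f := V₁) (C := C₁ * (2 ^ p₁ * Y ^ (-p₁)))
      (fun z _ => (hV₁.differentiable (by simp)).differentiableAt)
      (fun z hz => (h₁ z).trans (mul_le_mul_of_nonneg_left (hball p₁ (by linarith) z hz) hC₁))
      hymem hxmem
    rw [Real.norm_eq_abs, abs_sub_comm] at hmv
    calc |V₁ y - V₁ x| ≤ _ := hmv
      _ ≤ C₁ * (2 ^ p₁ * Y ^ (-p₁)) * Y ^ β := by
          refine mul_le_mul_of_nonneg_left (hxy.trans ?_) (by positivity)
          linarith [Real.rpow_nonneg hY0.le β]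
      _ = C₁ * 2 ^ p₁ * Y ^ (-p₁ + β) := by rw [Real.rpow_add hY0]; ring
      _ ≤ _ := mul_le_mul_of_nonneg_left
          (Real.rpow_le_rpow_of_exponent_le hY1 (by linarith)) (by positivity)
  have b2 : |V₂ x| ≤ C₂ * 2 ^ p₂ * Y ^ (-(β * q)) := by
    calc |V₂ x| ≤ _ := h₂ x
      _ ≤ C₂ * (2 ^ p₂ * Y ^ (-p₂)) :=
          mul_le_mul_of_nonneg_left (hball p₂ (by linarith) x hxmem) hC₂
      _ = C₂ * 2 ^ p₂ * Y ^ (-p₂) := by ring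
      _ ≤ _ := mul_le_mul_of_nonneg_left
          (Real.rpow_le_rpow_of_exponent_le hY1 (by linarith)) (by positivity)
  have b3 : |V₁ y - V₁ x - V₂ x| ≤ (C₁ * 2 ^ p₁ + C₂ * 2 ^ p₂) * Y ^ (-(β * q)) :=
    (abs_sub _ _).trans (by linarith)
  have hj : 0 < 1 + |y j| := by positivity
  -- Decay in the full norm dominates decay in any one coordinate, and a single coordinate suffices
  -- to recover `φ` from the energy.
  have b4 : Y ^ (-(β * q)) ≤ ((1 + |y j|) ^ β)⁻¹ ^ q := by
    calc Y ^ (-(β * q)) ≤ (1 + |y j|) ^ (-(β * q)) :=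
          Real.rpow_le_rpow_of_nonpos hj (by linarith [abs_apply_le_norm y j]) (by linarith)
      _ = _ := by rw [Real.rpow_neg hj.le, Real.rpow_mul hj.le, Real.rpow_natCast, inv_pow]
  calc (V₁ y - V₁ x - V₂ x) ^ 2 = |V₁ y - V₁ x - V₂ x| ^ 2 := (sq_abs _).symm
    _ ≤ ((C₁ * 2 ^ p₁ + C₂ * 2 ^ p₂) * ((1 + |y j|) ^ β)⁻¹ ^ q) ^ 2 := by
        gcongr
        exact b3.trans (by gcongr)
    _ = _ := by
        rw [mul_pow, ← pow_mul, mul_comm q 2, pow_mul, inv_pow]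

/-- Infinite critical decay rate means decay faster than any exponential. -/
lemma lintegral_exp_ne_top_of_criticalDecayRate_eq_top {φ : L2 d} (h : criticalDecayRate φ = ⊤)
    (s : ℝ) : ∫⁻ x, ENNReal.ofReal (Real.exp (2 * (s * normOne x)) * ‖φ x‖ ^ 2) ≠ ⊤ := by
  have h1 : ENNReal.ofReal (|s| * d) < criticalDecayRate φ := by
    rw [h]; exact ENNReal.ofReal_lt_top
  obtain ⟨_, ⟨σ, rfl, hσ⟩, hlt⟩ := lt_sSup_iff.1 h1
  have hσ' : |s| * d ≤ σ := by
    have := (ENNReal.toReal_lt_toReal ENNReal.ofReal_ne_top ENNReal.coe_ne_top).2 hlt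
    rw [ENNReal.toReal_ofReal (by positivity), ENNReal.coe_toReal] at this
    exact this.le
  have hint := (memLp_two_iff_integrable_sq_norm hσ.aestronglyMeasurable).1 hσ
  refine ne_top_of_le_ne_top hint.lintegral_lt_top.ne (lintegral_mono fun x => ?_)
  refine ENNReal.ofReal_le_ofReal ?_
  rw [norm_mul, mul_pow, Complex.norm_real, Real.norm_eq_abs, Real.abs_exp, ← Real.exp_nat_mul]
  refine mul_le_mul_of_nonneg_right (Real.exp_le_exp.2 ?_) (sq_nonneg _)
  have h2 : normOne x ≤ d * ‖x‖ := by
    calc normOne x ≤ ∑ _j : Fin d, ‖x‖ := Finset.sum_le_sum fun j _ => abs_apply_le_norm x j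
      _ = _ := by simp
  push_cast
  refine mul_le_mul_of_nonneg_left ?_ zero_le_two
  calc s * normOne x ≤ |s| * (d * ‖x‖) :=
        mul_le_mul (le_abs_self s) h2 (normOne_nonneg x) (abs_nonneg s)
    _ = |s| * d * ‖x‖ := by ring
    _ ≤ σ * ‖x‖ := by gcongr

end HigherOrderSchrodinger

/-! ### The main theorem -/

theorem theorem4 {d q : ℕ} (hq : 1 ≤ q)
    (Q : MvPolynomial (Fin d) ℝ) (hQdeg : Q.totalDegree = q)
    (hQell : HigherOrderSchrodinger.IsElliptic Q)
    (V₁ V₂ : HigherOrderSchrodinger.Space d → ℝ)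
    (hV₁smooth : ContDiff ℝ ∞ V₁) (hV₁bdd : ∃ C : ℝ, ∀ x, |V₁ x| ≤ C)
    (hV₂meas : Measurable V₂) (hV₂bdd : ∃ C : ℝ, ∀ x, |V₂ x| ≤ C)
    (hVlim : Tendsto (fun x => V₁ x + V₂ x)
      (Bornology.cobounded (HigherOrderSchrodinger.Space d)) (𝓝 0))
    (δ : ℝ) (hδ : 0 < δ)
    (hV₂ : V₂ =O[Bornology.cobounded (HigherOrderSchrodinger.Space d)]
      fun x => ‖x‖ ^ (-(q : ℝ) / 2 - δ))
    (hV₁ : ∀ k : ℕ, 1 ≤ k → k ≤ q → ∀ J : Fin k → Fin d,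
      HigherOrderSchrodinger.partialDeriv J V₁
        =O[Bornology.cobounded (HigherOrderSchrodinger.Space d)]
          fun x => ‖x‖ ^ (-(δ + (q : ℝ) + (k : ℝ)) / 2))
    (lam : ℝ) (φ : HigherOrderSchrodinger.L2 d)
    (hφ : HigherOrderSchrodinger.SolvesEigenEq Q (fun x => V₁ x + V₂ x) lam φ)
    (hφ0 : φ ≠ 0) :
    HigherOrderSchrodinger.criticalDecayRate φ < ⊤ := by
  obtain ⟨ψ, hψ, heq⟩ := hφ
  by_contra hcon
  have htop := not_lt_top_iff.1 hcon
  subst hQdeg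
  -- In dimension zero every polynomial is constant, against `q ≥ 1`.
  obtain ⟨j₀⟩ : Nonempty (Fin d) := by
    by_contra hd
    rw [not_nonempty_iff] at hd
    rw [MvPolynomial.eq_C_of_isEmpty Q, MvPolynomial.totalDegree_C] at hq
    omega
  obtain ⟨u, Φ, hu1, hu2, hu3⟩ := HigherOrderSchrodinger.exists_approx_derivs hQell hψ
  have hu : HigherOrderSchrodinger.ApproxData Q φ ψ u Φ := ⟨hu1, hu2, hu3⟩
  obtain ⟨B₁, hB₁⟩ := hV₁bdd
  obtain ⟨B₂, hB₂⟩ := hV₂bdd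
  have hφexp :=
    HigherOrderSchrodinger.lintegral_exp_ne_top_of_criticalDecayRate_eq_top htop
  have hψexp : ∀ s : ℝ, ∫⁻ x, ENNReal.ofReal
      (Real.exp (2 * (s * HigherOrderSchrodinger.normOne x)) * ‖ψ x‖ ^ 2) ≠ ⊤ := by
    intro s
    refine ne_top_of_le_ne_top (ENNReal.mul_ne_top
      (ENNReal.ofReal_ne_top (r := (|lam| + B₁ + B₂) ^ 2)) (hφexp s)) ?_
    rw [← lintegral_const_mul' _ _ ENNReal.ofReal_ne_top]
    refine lintegral_mono_ae ?_
    filter_upwards [heq] with x hx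
    rw [← ENNReal.ofReal_mul (sq_nonneg _)]
    refine ENNReal.ofReal_le_ofReal ?_
    have e : ψ x = ((lam - V₁ x - V₂ x : ℝ) : ℂ) * φ x := by
      push_cast at hx ⊢
      linear_combination hx
    rw [e, norm_mul, mul_pow, Complex.norm_real, Real.norm_eq_abs]
    have hb : |lam - V₁ x - V₂ x| ≤ |lam| + B₁ + B₂ := by
      have t1 := abs_sub (lam - V₁ x) (V₂ x)
      have t2 := abs_sub lam (V₁ x)
      linarith [hB₁ x, hB₂ x]
    calc _ ≤ Real.exp (2 * (s * HigherOrderSchrodinger.normOne x)) *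
          ((|lam| + B₁ + B₂) ^ 2 * ‖φ x‖ ^ 2) := by gcongr
      _ = _ := by ring
  have hq1 : (1 : ℝ) ≤ Q.totalDegree := by exact_mod_cast hq
  set q : ℝ := (Q.totalDegree : ℝ) with hqdef
  obtain ⟨C₁, hC₁, hgrad⟩ := HigherOrderSchrodinger.exists_norm_fderiv_le hV₁smooth
    (p := (δ + q + 1) / 2) (by positivity) (fun j => by
      have := hV₁ 1 le_rfl hq fun _ => j
      rwa [Nat.cast_one, neg_div] at this)
  obtain ⟨C₂, hC₂, hV₂'⟩ := HigherOrderSchrodinger.exists_bound_of_isBigO (p := q / 2 + δ)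
    (by positivity) (fun _ => ⟨B₂, fun x _ => hB₂ x⟩) (by
      rwa [show -q / 2 - δ = -(q / 2 + δ) by ring] at hV₂)
  -- `β > 1/2` makes `a⁻²` integrable, while `β (q + 1) ≤ (δ + q + 1) / 2` makes the oscillation of
  -- `V₁` over a box of size `a` at most of order `a^{-q}`. Both together also give `β q ≤ q / 2 +
  -- δ`, as needed for `V₂`.
  set β := min 1 (1 / 2 + δ / (2 * (q + 1))) with hβ
  have hβ1 : β ≤ 1 := min_le_left _ _
  have hβ2 : 1 / 2 < β := lt_min (by norm_num) (by
    have : 0 < δ / (2 * (q + 1)) := by positivity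
    linarith)
  have hβ3 : β * (q + 1) ≤ (δ + q + 1) / 2 := by
    calc β * (q + 1) ≤ (1 / 2 + δ / (2 * (q + 1))) * (q + 1) :=
          mul_le_mul_of_nonneg_right (min_le_right _ _) (by positivity)
      _ = _ := by field_simp; ring
  refine hφ0 (hu.eq_zero hQell hq j₀ (HigherOrderSchrodinger.slowScale_rpow hβ2 hβ1)
    -- `V₁` is frozen at the centre of each box; `κ₀` ensures `d κ ≤ 1/2`.
    (c := fun y => V₁ y - lam) (κ₀ := 1 / (2 * d + 1))
    (Cv := (C₁ * 2 ^ ((δ + q + 1) / 2) + C₂ * 2 ^ (q / 2 + δ)) ^ 2) (by positivity) ?_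
    fun s hs => hu.lintegral_exp_energy_ne_top hQell hs (hφexp s) (hψexp s))
  intro κ hκ0 hκ y
  filter_upwards [heq] with x hx hxbox
  have hdκ : d * κ ≤ 1 / 2 := by
    rw [le_div_iff₀ (by positivity)] at hκ
    linarith
  have hpot := HigherOrderSchrodinger.sq_potential_sub_le hV₁smooth (q := Q.totalDegree)
    (by linarith) hβ1 (by rw [← hqdef]; linarith) (by rw [← hqdef]; linarith) hC₁ hC₂ hgrad hV₂'
    hκ0.le hdκ hxbox j₀
  have e : ψ x + ((V₁ y - lam : ℝ) : ℂ) * φ x = ((V₁ y - V₁ x - V₂ x : ℝ) : ℂ) * φ x := by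
    push_cast at hx ⊢
    linear_combination hx
  rw [e, norm_mul, mul_pow, Complex.norm_real, Real.norm_eq_abs, sq_abs]
  exact mul_le_mul_of_nonneg_right hpot (sq_nonneg _)
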